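/- Let $\mathbb{T}=\mathbb{R}/\mathbb{Z}$. For $\beta\in\mathbb{R}$ let $\mathcal{C}^\beta$ be the closure of $C^\infty(\mathbb{T};\mathbb{R})$ in the Besov norm $\|f\|_{\mathcal{C}^\beta}=\sup_{k\ge -1}2^{\beta k}\|\Delta_kf\|_{L^\infty}$, where $\Delta_k$ are the Littlewood--Paley projections, and for $\mathfrak{m}\in\mathbb{R}$ let $\mathcal{C}^\beta_{\mathfrak m}$ be the set of $f\in\mathcal{C}^\beta$ with spatial mean $\bar f=\langle f,1\rangle=\mathfrak{m}$. For $T>0$ let $C_T\mathcal{C}^\beta_{\mathfrak m}$ be the set of continuous maps $[0,T]\to\mathcal{C}^\beta_{\mathfrak m}$, with $\|Z\|_{C_T\mathcal{C}^\beta}=\sup_{t\in[0,T]}\|Z_t\|_{\mathcal{C}^\beta}$, and for $\eta>0$ let $C_{\eta;T}\mathcal{C}^\beta$ be the set of continuous $f:(0,T]\to\mathcal{C}^\beta$ with $\|f\|_{C_{\eta;T}\mathcal{C}^\beta}=\sup_{t\in(0,T]}(t^\eta\wedge1)\|f_t\|_{\mathcal{C}^\beta}<\infty$; $C_{\eta;T}\mathcal{C}^\beta_{\mathfrak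 m}$ is its subset of $\mathcal{C}^\beta_{\mathfrak m}$-valued maps. Let $\alpha_0\in(-\frac12,0)$, $\alpha\in(0,\alpha_0+\frac12)$, $\frac{\alpha-\alpha_0}{2}<\eta<\frac14$, $T>0$, $\chi>0$ and $\mathfrak{m}\in\{0,1\}$. For $\zeta\in\mathcal{C}^{\alpha_0}_{\mathfrak m}$ and $Z\in C_T\mathcal{C}^\alpha_0$, a mild solution on $[0,T]$, started from $\zeta$ and driven by $Z$, of the remainder equation $$\partial_tw-\partial_{xx}w=\chi\,\partial_x\big((w+Z)^2\partial_x\rho_{w+Z}\big),\qquad -\partial_{xx}\rho_{w+Z}=w-\bar w+Z,\qquad w|_{t=0}=\zeta,$$ ($\rho_{w+Z}$ mean-free) is a $w\in C_{\eta;T}\mathcal{C}^\alpha$ such that for every $t\in(0,T]$ $$w_t=e^{t\Delta}\zeta+\int_0^te^{(t-s)\Delta}\chi\,\partial_x\big((w_s+Z_s)^2\partial_x\rho_{w_s+Z_s}\big)\,\mathrm{d}s .$$ Then for every $\zeta\in\mathcal{C}^{\alpha_0}_{\mathfrak m}$ and $Z\in C_T\mathcal{C}^\alpha_0$ there is a unique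 mild solution $w=w(\zeta,Z)\in C_{\eta;T}\mathcal{C}^\alpha$ on $[0,T]$. Moreover the map $$\mathscr{S}:\mathcal{C}^{\alpha_0}_{\mathfrak m}\times C_T\mathcal{C}^\alpha_0\to C_{\eta;T}\mathcal{C}^\alpha_{\mathfrak m},\qquad(\zeta,Z)\mapsto w(\zeta,Z)+Z,$$ is well defined and jointly locally Lipschitz, in the sense that it is Lipschitz on bounded sets: for every $R\ge0$ there is $K\ge 0$ such that $$\|\mathscr{S}(\zeta,Z)-\mathscr{S}(\zeta',Z')\|_{C_{\eta;T}\mathcal{C}^\alpha}\le K\big(\|\zeta-\zeta'\|_{\mathcal{C}^{\alpha_0}}+\|Z-Z'\|_{C_T\mathcal{C}^\alpha}\big)$$ whenever $\|\zeta\|_{\mathcal{C}^{\alpha_0}}+\|Z\|_{C_T\mathcal{C}^\alpha}<R$ and $\|\zeta'\|_{\mathcal{C}^{\alpha_0}}+\|Z'\|_{C_T\mathcal{C}^\alpha}<R$. -/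

import Mathlib

open Set Filter Topology MeasureTheory
open scoped ENNReal NNReal ContDiff

noncomputable section

namespace Chemorepulsion

/-- The one-dimensional torus `ℝ/ℤ`. -/
abbrev Torus : Type := UnitAddCircle

/-- Test functions: smooth, `1`-periodic, real-valued functions. -/
def SmoothPeriodic : Submodule ℝ (ℝ → ℝ) where
  carrier := {φ | ContDiff ℝ ∞ φ ∧ Function.Periodic φ 1}
  add_mem' := by
    rintro f g ⟨hf, hf'⟩ ⟨hg, hg'⟩
    exact ⟨hf.add hg, hf'.add hg'⟩
  zero_mem' := ⟨contDiff_const, fun _ => rfl⟩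
  smul_mem' := by
    rintro c f ⟨hf, hf'⟩
    exact ⟨contDiff_const.smul hf, fun x => by simp [hf' x]⟩

/-- Real periodic distributions: linear functionals on the test functions that are
continuous for the family of seminorms `sup |φ^{(k)}|`. -/
def PeriodicDist : Submodule ℝ (Module.Dual ℝ SmoothPeriodic) where
  carrier := {u | ∃ (N : ℕ) (C : ℝ), ∀ (φ : SmoothPeriodic) (M : ℝ),
    (∀ k ≤ N, ∀ x : ℝ, |iteratedDeriv k φ.1 x| ≤ M) → |u φ| ≤ C * M}
  add_mem' := by
    rintro u v ⟨N, C, hu⟩ ⟨N', C', hv⟩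
    refine ⟨max N N', C + C', fun φ M h => ?_⟩
    have h1 := hu φ M fun k hk => h k (hk.trans (le_max_left _ _))
    have h2 := hv φ M fun k hk => h k (hk.trans (le_max_right _ _))
    calc |(u + v) φ| ≤ |u φ| + |v φ| := abs_add_le _ _
      _ ≤ (C + C') * M := by linarith
  zero_mem' := ⟨0, 0, fun φ M _ => by simp⟩
  smul_mem' := by
    rintro c u ⟨N, C, hu⟩
    refine ⟨N, |c| * C, fun φ M h => ?_⟩
    have h1 := hu φ M h
    calc |(c • u) φ| = |c| * |u φ| := by simp [abs_mul]
      _ ≤ |c| * (C * M) := by gcongr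
      _ = |c| * C * M := by ring

/-- The test function `x ↦ cos (2πnx)`. -/
def cosTest (n : ℤ) : SmoothPeriodic :=
  ⟨fun x => Real.cos (2 * Real.pi * n * x), by
    refine ⟨Real.contDiff_cos.comp (contDiff_const.mul contDiff_id), fun x => ?_⟩
    have : 2 * Real.pi * n * (x + 1) = 2 * Real.pi * n * x + n * (2 * Real.pi) := by ring
    simp only [this, Real.cos_add_int_mul_two_pi]⟩

/-- The test function `x ↦ sin (2πnx)`. -/
def sinTest (n : ℤ) : SmoothPeriodic :=
  ⟨fun x => Real.sin (2 * Real.pi * n * x), by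
    refine ⟨Real.contDiff_sin.comp (contDiff_const.mul contDiff_id), fun x => ?_⟩
    have : 2 * Real.pi * n * (x + 1) = 2 * Real.pi * n * x + n * (2 * Real.pi) := by ring
    simp only [this, Real.sin_add_int_mul_two_pi]⟩

/-- Differentiation of test functions. -/
def derivTest : SmoothPeriodic →ₗ[ℝ] SmoothPeriodic where
  toFun φ := ⟨deriv φ.1, by
    refine ⟨(contDiff_infty_iff_deriv.1 φ.2.1).2, fun x => ?_⟩
    have h : (fun y => φ.1 (y + 1)) = φ.1 := funext φ.2.2
    rw [← deriv_comp_add_const, h]⟩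
  map_add' φ ψ := by
    ext x
    exact deriv_add ((contDiff_infty_iff_deriv.1 φ.2.1).1 x)
      ((contDiff_infty_iff_deriv.1 ψ.2.1).1 x)
  map_smul' c φ := by
    ext x
    exact deriv_const_smul c ((contDiff_infty_iff_deriv.1 φ.2.1).1 x)

/-- The distributional derivative `⟨∂u, φ⟩ = -⟨u, φ'⟩`. -/
def distDeriv (u : PeriodicDist) : PeriodicDist :=
  ⟨-(u.1 ∘ₗ derivTest), by
    obtain ⟨N, C, hu⟩ := u.2
    refine ⟨N + 1, C, fun φ M h => ?_⟩
    have := hu (derivTest φ) M fun k hk x => by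
      have h' := h (k + 1) (by omega) x
      rwa [iteratedDeriv_succ'] at h'
    simpa using this⟩

/-- The distribution `φ ↦ ∫₀¹ f φ` attached to a continuous function on the torus. -/
def toDist (f : C(Torus, ℝ)) : PeriodicDist :=
  ⟨{ toFun := fun φ => ∫ x in (0 : ℝ)..1, f (x : Torus) * φ.1 x
     map_add' := fun φ ψ => by
      have hf : Continuous fun x : ℝ => f (x : Torus) :=
        f.continuous.comp (AddCircle.continuous_mk' 1)
      have h : ∀ φ : SmoothPeriodic, IntervalIntegrable
          (fun x : ℝ => f (x : Torus) * φ.1 x) volume 0 1 :=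
        fun φ => (hf.mul φ.2.1.continuous).intervalIntegrable _ _
      rw [← intervalIntegral.integral_add (h φ) (h ψ)]
      simp [mul_add]
     map_smul' := fun c φ => by
      simp only [RingHom.id_apply, smul_eq_mul, ← intervalIntegral.integral_const_mul]
      congr 1
      ext x
      simp only [Submodule.coe_smul, Pi.smul_apply, smul_eq_mul]
      ring }, by
    refine ⟨0, ‖f‖, fun φ M h => ?_⟩
    have h1 := intervalIntegral.norm_integral_le_of_norm_le_const (a := (0 : ℝ)) (b := 1)
      (C := ‖f‖ * M) (f := fun x : ℝ => f (x : Torus) * φ.1 x) (fun x _ => by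
        rw [norm_mul]
        have := h 0 le_rfl x
        rw [iteratedDeriv_zero] at this
        exact mul_le_mul (f.norm_coe_le_norm _) this (norm_nonneg _) (norm_nonneg _))
    simpa using h1⟩

/-- The Fourier coefficient `û(n) = ⟨u, e^{-2πinx}⟩`. -/
def fourierCoef (u : PeriodicDist) (n : ℤ) : ℂ :=
  (u.1 (cosTest n) : ℂ) - Complex.I * (u.1 (sinTest n) : ℂ)

/-- The spatial mean `⟨u, 1⟩` of a distribution. -/
def mean (u : PeriodicDist) : ℝ := u.1 (cosTest 0)

/-- A smooth even cut-off, equal to `1` on `[-1,1]` and to `0` outside `(-2,2)`. -/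
def cutoff (r : ℝ) : ℝ := Real.smoothTransition (2 - |r|)

/-- The dyadic partition of unity; index `j` stands for the frequency scale `k = j - 1 ≥ -1`.
The function of index `0` is supported in `{|r| ≤ 2}`, the one of index `k + 1` in
`{2^k ≤ |r| ≤ 4 · 2^k}`. -/
def dyadic : ℕ → ℝ → ℝ
  | 0, r => cutoff r
  | k + 1, r => cutoff (r / 2 ^ (k + 1)) - cutoff (r / 2 ^ k)

/-- The Littlewood--Paley block `Δ_{j-1} u`. All frequencies on which `dyadic j` does not
vanish satisfy `|n| ≤ 2^{j+1}`. -/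
def lpBlock (j : ℕ) (u : PeriodicDist) (x : ℝ) : ℂ :=
  ∑ n ∈ Finset.Icc (-(2 : ℤ) ^ (j + 1)) (2 ^ (j + 1)),
    (dyadic j n : ℂ) * fourierCoef u n * Complex.exp (2 * Real.pi * Complex.I * n * x)

/-- The norm of the Besov space `B^β_{∞,∞}`, `sup_{k ≥ -1} 2^{βk} ‖Δ_k u‖_∞`
(possibly infinite). -/
def besovNorm (β : ℝ) (u : PeriodicDist) : ℝ≥0∞ :=
  ⨆ (j : ℕ) (x : ℝ), ENNReal.ofReal ((2 : ℝ) ^ (β * ((j : ℝ) - 1)) * ‖lpBlock j u x‖)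

/-- The Hölder--Besov space `𝒞^β`: the closure of the smooth functions for the
`B^β_{∞,∞}`-norm. -/
def HolderBesov (β : ℝ) : Set PeriodicDist :=
  {u | ∀ ε : ℝ≥0∞, 0 < ε → ∃ φ : C(Torus, ℝ),
    ContDiff ℝ ∞ (fun x : ℝ => φ (x : Torus)) ∧ besovNorm β (u - toDist φ) ≤ ε}

/-- The subspace `𝒞^β_𝔪` of elements with spatial mean `𝔪`. -/
def HolderBesovMean (β m : ℝ) : Set PeriodicDist :=
  {u | u ∈ HolderBesov β ∧ mean u = m}

/-- The `B^β_{∞,∞}`-norm of a continuous function. For `β > 0` the elements of `𝒞^β` are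
continuous functions, and they are treated as such below. -/
def hbNorm (β : ℝ) (f : C(Torus, ℝ)) : ℝ≥0∞ := besovNorm β (toDist f)

/-- Continuity on the time set `I` of a curve of functions for the `B^β_{∞,∞}`-norm. -/
def ContinuousInTime (I : Set ℝ) (β : ℝ) (f : ℝ → C(Torus, ℝ)) : Prop :=
  ∀ t ∈ I, Tendsto (fun s => hbNorm β (f s - f t)) (𝓝[I] t) (𝓝 0)

/-- The norm of `C_T 𝒞^β`; only the values at times in `[0,T]` matter. -/
def normCT (T β : ℝ) (f : ℝ → C(Torus, ℝ)) : ℝ≥0∞ :=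
  ⨆ t ∈ Icc 0 T, hbNorm β (f t)

/-- The space `C_T 𝒞^β_𝔪` (for `β > 0`) of continuous maps from `[0,T]` to `𝒞^β_𝔪`. -/
def SpaceCT (T β m : ℝ) : Set (ℝ → C(Torus, ℝ)) :=
  {f | (∀ t ∈ Icc 0 T, toDist (f t) ∈ HolderBesovMean β m) ∧ ContinuousInTime (Icc 0 T) β f}

/-- The norm of `C_{η;T} 𝒞^β`, `sup_{t ∈ (0,T]} (t^η ∧ 1) ‖f_t‖`; only the values at times in
`(0,T]` matter. -/
def normCeta (η T β : ℝ) (f : ℝ → C(Torus, ℝ)) : ℝ≥0∞ :=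
  ⨆ t ∈ Ioc 0 T, ENNReal.ofReal (min (t ^ η) 1) * hbNorm β (f t)

/-- The space `C_{η;T} 𝒞^β` (for `β > 0`) of continuous maps from `(0,T]` to `𝒞^β` of finite
weighted norm. -/
def SpaceCeta (η T β : ℝ) : Set (ℝ → C(Torus, ℝ)) :=
  {f | (∀ t ∈ Ioc 0 T, toDist (f t) ∈ HolderBesov β) ∧ ContinuousInTime (Ioc 0 T) β f ∧
    normCeta η T β f < ⊤}

/-- The space `C_{η;T} 𝒞^β_𝔪`. -/
def SpaceCetaMean (η T β m : ℝ) : Set (ℝ → C(Torus, ℝ)) :=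
  {f | f ∈ SpaceCeta η T β ∧ ∀ t ∈ Ioc 0 T, mean (toDist (f t)) = m}

/-- The heat semigroup `(e^{tΔ} u)(x) = ∑ₙ e^{-4π²n²t} û(n) e^{2πinx}`, for `t > 0`. The sum is
real because `û(-n)` is the complex conjugate of `û(n)`. -/
def heat (t : ℝ) (u : PeriodicDist) (x : ℝ) : ℝ :=
  (∑' n : ℤ, (Real.exp (-4 * Real.pi ^ 2 * (n : ℝ) ^ 2 * t) : ℂ) * fourierCoef u n *
    Complex.exp (2 * Real.pi * Complex.I * n * x)).re

/-- The primitive `∫₀ˣ (u - ū)`. -/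
def primitive (u : C(Torus, ℝ)) (x : ℝ) : ℝ :=
  ∫ y in (0 : ℝ)..x, (u (y : Torus) - mean (toDist u))

theorem hasDerivAt_primitive (u : C(Torus, ℝ)) (x : ℝ) :
    HasDerivAt (primitive u) (u (x : Torus) - mean (toDist u)) x := by
  have hf : Continuous fun y : ℝ => u (y : Torus) - mean (toDist u) :=
    (u.continuous.comp (AddCircle.continuous_mk' 1)).sub continuous_const
  exact intervalIntegral.integral_hasDerivAt_right (hf.intervalIntegrable _ _)
    (hf.stronglyMeasurableAtFilter _ _) hf.continuousAt

theorem mean_toDist (u : C(Torus, ℝ)) :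
    mean (toDist u) = ∫ y in (0 : ℝ)..1, u (y : Torus) := by
  simp [mean, toDist, cosTest]

theorem primitive_periodic (u : C(Torus, ℝ)) : Function.Periodic (primitive u) 1 := by
  intro x
  have hu : Continuous fun y : ℝ => u (y : Torus) :=
    u.continuous.comp (AddCircle.continuous_mk' 1)
  have hf : Continuous fun y : ℝ => u (y : Torus) - mean (toDist u) :=
    hu.sub continuous_const
  have hp : Function.Periodic (fun y : ℝ => u (y : Torus) - mean (toDist u)) 1 := by
    intro y
    simp only [AddCircle.coe_add, AddCircle.coe_period, add_zero]
  have h0 : ∫ y in (0 : ℝ)..1, (u (y : Torus) - mean (toDist u)) = 0 := by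
    rw [intervalIntegral.integral_sub (hu.intervalIntegrable _ _) (by simp), ← mean_toDist]
    simp
  unfold primitive
  rw [← intervalIntegral.integral_add_adjacent_intervals (hf.intervalIntegrable 0 x)
    (hf.intervalIntegrable x (x + 1)), hp.intervalIntegral_add_eq x 0, zero_add, h0, add_zero]

/-- The gradient `∂ₓρ_u`, where `ρ_u` is the mean-free solution of `-∂ₓₓρ_u = u - ū` on the
torus: the mean-free periodic function with derivative `-(u - ū)`. -/
def gradPotential (u : C(Torus, ℝ)) : C(Torus, ℝ) where
  toFun := Function.Periodic.lift (f := fun x => (∫ y in (0 : ℝ)..1, primitive u y) - primitive u x)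
    (c := 1) fun x => by simp only [primitive_periodic u x]
  continuous_toFun := continuous_coinduced_dom.2 <| continuous_const.sub <|
    continuous_iff_continuousAt.2 fun x => (hasDerivAt_primitive u x).continuousAt

theorem gradPotential_coe (u : C(Torus, ℝ)) (x : ℝ) :
    gradPotential u (x : Torus) = (∫ y in (0 : ℝ)..1, primitive u y) - primitive u x := rfl

/-- `gradPotential u` is the derivative of a `1`-periodic mean-free `ρ` with
`-ρ'' = u - ū`. -/
theorem gradPotential_spec (u : C(Torus, ℝ)) :
    ∃ ρ : ℝ → ℝ, Function.Periodic ρ 1 ∧ ∫ x in (0 : ℝ)..1, ρ x = 0 ∧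
      (∀ x : ℝ, HasDerivAt ρ (gradPotential u (x : Torus)) x) ∧
      ∀ x : ℝ, HasDerivAt (fun y : ℝ => gradPotential u (y : Torus))
        (-(u (x : Torus) - mean (toDist u))) x := by
  have hP : Continuous (primitive u) :=
    continuous_iff_continuousAt.2 fun x => (hasDerivAt_primitive u x).continuousAt
  have hg : Continuous fun y : ℝ => gradPotential u (y : Torus) :=
    (gradPotential u).continuous.comp (AddCircle.continuous_mk' 1)
  set R : ℝ → ℝ := fun x => ∫ y in (0 : ℝ)..x, gradPotential u (y : Torus) with hR
  have hRd : ∀ x : ℝ, HasDerivAt R (gradPotential u (x : Torus)) x := fun x =>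
    intervalIntegral.integral_hasDerivAt_right (hg.intervalIntegrable _ _)
      (hg.stronglyMeasurableAtFilter _ _) hg.continuousAt
  have hRc : Continuous R := continuous_iff_continuousAt.2 fun x => (hRd x).continuousAt
  have hzero : ∫ y in (0 : ℝ)..1, gradPotential u (y : Torus) = 0 := by
    simp only [gradPotential_coe]
    rw [intervalIntegral.integral_sub (by simp) (hP.intervalIntegrable _ _)]
    simp
  have hgp : Function.Periodic (fun y : ℝ => gradPotential u (y : Torus)) 1 := by
    intro y
    simp only [AddCircle.coe_add, AddCircle.coe_period, add_zero]
  have hRp : Function.Periodic R 1 := by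
    intro x
    simp only [hR]
    rw [← intervalIntegral.integral_add_adjacent_intervals (hg.intervalIntegrable 0 x)
      (hg.intervalIntegrable x (x + 1)), hgp.intervalIntegral_add_eq x 0, zero_add, hzero,
      add_zero]
  refine ⟨fun x => R x - ∫ y in (0 : ℝ)..1, R y, fun x => by simp only [hRp x], ?_,
    fun x => (hRd x).sub_const _, fun x => ?_⟩
  · rw [intervalIntegral.integral_sub (hRc.intervalIntegrable _ _) (by simp)]
    simp
  · simp only [gradPotential_coe]
    exact (hasDerivAt_primitive u x).const_sub _

/-- The flux `u² ∂ₓρ_u`. -/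
def flux (u : C(Torus, ℝ)) : C(Torus, ℝ) := u ^ 2 * gradPotential u

/-- `w ∈ C_{η;T} 𝒞^α` is a mild solution on `[0,T]`, started from `ζ` and driven by `Z`, of
`∂ₜw - ∂ₓₓw = χ ∂ₓ((w+Z)² ∂ₓρ_{w+Z})`. -/
structure IsMildSolution (α η T χ : ℝ) (ζ : PeriodicDist) (Z w : ℝ → C(Torus, ℝ)) : Prop where
  mem : w ∈ SpaceCeta η T α
  integrable : ∀ t ∈ Ioc 0 T, ∀ x : ℝ, IntervalIntegrable
    (fun s => heat (t - s) (χ • distDeriv (toDist (flux (w s + Z s)))) x) volume 0 t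
  eq : ∀ t ∈ Ioc 0 T, ∀ x : ℝ, w t (x : Torus) = heat t ζ x +
    ∫ s in (0 : ℝ)..t, heat (t - s) (χ • distDeriv (toDist (flux (w s + Z s)))) x

end Chemorepulsion

end

set_option maxSynthPendingDepth 3

noncomputable section

namespace Chemorepulsion

open AddCircle ComplexConjugate

/-! Write u = w + Z. The source is cubic in u, so a fixed point argument alone gives only short
times; the repulsive sign of the equation rules out blow-up. Testing with w produces the dissipation
avg((∂ₓw)²) and χ avg(u² ∂ₓρ ∂ₓw). Since w² ∂ₓw = ∂ₓ(w³)/3 and ∂ₓₓρ = -(u - ū), an integration by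
parts turns the leading part of the latter into (χ/3) avg(w⁴), with the good sign. The noise is only
Hölder, so Z is split into a smooth low-frequency part, onto which derivatives may be moved, and a
high-frequency part small in sup norm, whose contribution is absorbed by the dissipation and the
quartic term. Hence the square of the L² norm of w grows at most linearly in time
(`avg_flux_mul_deriv`, `energy_lower`, `l2sq_le_of_truncSol`).

No continuation argument is needed. The flux is composed with the radial retraction onto the ball of
radius M s^{-γ}, and the truncated Duhamel equation is solved on all of (0,T] by a contraction in an
exponentially weighted norm (`exists_weight`, `exists_truncSol`). The flux is homogeneous of degree
3, so the truncation only multiplies it by a number θ in [0,1] that is constant in space, and the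
energy estimate holds uniformly in M. Near time 0 the solution does not feel the truncation
(`exists_shortTime`). After that, the L² bound makes the L² norm of the flux at most affine in the
sup norm of w, while e^{tΔ}∂ₓ maps L² to L^∞ with an integrable singularity; a singular Grönwall
lemma gives a sup bound independent of M (`exists_apriori_bound`). For M large the truncation is
inactive (`exists_duhamelSol`).

Exponents: data in 𝒞^{α₀} cost t^{-γ} in sup norm with γ = (δ - α₀)/2, the cubic flux has Lipschitz
constant of order s^{-2γ}, and e^{tΔ}∂ₓ costs t^{-(1+δ)/2}. The argument closes if (1+δ)/2 + 2γ < 1,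
which small δ > 0 achieves because α₀ > -1/2. Uniqueness uses the same stability estimate with η in
place of γ, and there η < 1/4 enters (`IsMildSolution.unique`). For the Lipschitz bound, stability
in sup norm is put back into the Duhamel formula, which is then measured block by block
(`exists_duhamel_lipschitz`).

All linear operators are Fourier multipliers. Their bounds on sup norms come from an L¹ bound of the
kernel by ℓ² norms of the symbol and of its differences (`norm_mulOp_le_of_sq`). -/

instance : CompactSpace Torus := AddCircle.compactSpace 1

/-! ### Fourier multipliers on the torus -/

/-- The `n`-th Fourier coefficient as a continuous linear functional. -/
def coefC (n : ℤ) : C(Torus, ℂ) →L[ℂ] ℂ :=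
  LinearMap.mkContinuous
    { toFun := fun f => fourierCoeff f n
      map_add' := fun f g => congrFun (fourierCoeff.add
        (f.continuous.integrable_of_hasCompactSupport (HasCompactSupport.of_compactSpace f))
        (g.continuous.integrable_of_hasCompactSupport (HasCompactSupport.of_compactSpace g))) n
      map_smul' := fun c f => fourierCoeff.const_smul f c n } 1 (by
    intro f
    rw [one_mul]
    change ‖∫ t, fourier (-n) t • f t ∂haarAddCircle‖ ≤ ‖f‖
    refine (norm_integral_le_of_norm_le_const (C := ‖f‖) (ae_of_all _ fun t => ?_)).trans ?_
    · rw [norm_smul]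
      have h1 : ‖fourier (-n) t‖ ≤ 1 := by
        have := (fourier (T := 1) (-n)).norm_coe_le_norm t
        rwa [fourier_norm] at this
      calc _ ≤ 1 * ‖f t‖ := by gcongr
        _ ≤ ‖f‖ := by rw [one_mul]; exact f.norm_coe_le_norm t
    · simp)

theorem coefC_apply (n : ℤ) (f : C(Torus, ℂ)) : coefC n f = fourierCoeff f n := rfl

theorem norm_coefC_le (n : ℤ) (f : C(Torus, ℂ)) : ‖coefC n f‖ ≤ ‖f‖ := by
  have := (coefC n).le_of_opNorm_le (LinearMap.mkContinuous_norm_le _ zero_le_one _) f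
  simpa using this

/-- The character `x ↦ e^{2πinx}`. -/
def fou (n : ℤ) : C(Torus, ℂ) := fourier n

theorem coefC_fou (n k : ℤ) : coefC n (fou k) = if n = k then 1 else 0 := by
  rw [coefC_apply, fou, fourierCoeff_fourier, Pi.single_apply]

theorem norm_fou (n : ℤ) : ‖fou n‖ = 1 := fourier_norm n

theorem norm_fou_apply (n : ℤ) (x : Torus) : ‖fou n x‖ = 1 := by
  rw [fou, fourier_apply]; exact Circle.norm_coe _

theorem fou_neg_apply (n : ℤ) (x : Torus) : fou (-n) x = conj (fou n x) := fourier_neg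

theorem fou_coe (n : ℤ) (x : ℝ) :
    fou n (x : Torus) = Complex.exp (2 * Real.pi * Complex.I * n * x) := by
  rw [fou, fourier_coe_apply]; simp

/-- The rank-one operator `f ↦ f̂(n) e^{2πinx}`. -/
def coefOp (n : ℤ) : C(Torus, ℂ) →L[ℂ] C(Torus, ℂ) := (coefC n).smulRight (fou n)

theorem coefOp_apply (n : ℤ) (f : C(Torus, ℂ)) : coefOp n f = coefC n f • fou n := rfl

/-- The trigonometric series with coefficients `c`. -/
def trigSum (c : ℤ → ℂ) : C(Torus, ℂ) := ∑' n, c n • fou n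

theorem hasSum_trigSum {c : ℤ → ℂ} (hc : Summable fun n => ‖c n‖) :
    HasSum (fun n => c n • fou n) (trigSum c) := by
  refine Summable.hasSum (Summable.of_norm ?_)
  simpa [norm_smul, norm_fou] using hc

theorem hasSum_trigSum_apply {c : ℤ → ℂ} (hc : Summable fun n => ‖c n‖) (x : Torus) :
    HasSum (fun n => c n * fou n x) (trigSum c x) := by
  have := (hasSum_trigSum hc).map (ContinuousMap.evalCLM ℂ x : C(Torus, ℂ) →L[ℂ] ℂ)
    (ContinuousLinearMap.continuous _)
  simpa [Function.comp_def] using this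

theorem coefC_trigSum {c : ℤ → ℂ} (hc : Summable fun n => ‖c n‖) (k : ℤ) :
    coefC k (trigSum c) = c k := by
  have := (hasSum_trigSum hc).map (coefC k) (ContinuousLinearMap.continuous _)
  refine this.unique ?_
  have h2 : (fun n => coefC k (c n • fou n)) = fun n =>
      if n = k then c k else 0 := by
    funext n
    simp only [map_smul, coefC_fou, smul_eq_mul]
    split_ifs with h1 h2 h2
    · simp [h1]
    · exact absurd h1.symm h2
    · exact absurd h2.symm h1
    · simp
  rw [Function.comp_def, h2]
  exact hasSum_ite_eq k (c k)

theorem norm_trigSum_le {c : ℤ → ℂ} (hc : Summable fun n => ‖c n‖) :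
    ‖trigSum c‖ ≤ ∑' n, ‖c n‖ := by
  refine (norm_tsum_le_tsum_norm ?_).trans_eq ?_
  · simpa [norm_smul, norm_fou] using hc
  · simp [norm_smul, norm_fou]

/-- The Fourier multiplier with symbol `m`. -/
def mulOp (m : ℤ → ℂ) : C(Torus, ℂ) →L[ℂ] C(Torus, ℂ) :=
  ∑' n, m n • coefOp n

theorem norm_coefOp_le (n : ℤ) : ‖coefOp n‖ ≤ 1 :=
  ContinuousLinearMap.opNorm_le_bound _ zero_le_one fun f => by
    rw [coefOp_apply, norm_smul, norm_fou, mul_one, one_mul]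
    exact norm_coefC_le n f

theorem norm_mulOp_term_le (m : ℤ → ℂ) (n : ℤ) :
    ‖m n • coefOp n‖ ≤ ‖m n‖ := by
  rw [norm_smul]
  exact mul_le_of_le_one_right (norm_nonneg _) (norm_coefOp_le n)

theorem hasSum_mulOp {m : ℤ → ℂ} (hm : Summable fun n => ‖m n‖) :
    HasSum (fun n => m n • coefOp n) (mulOp m) :=
  Summable.hasSum (Summable.of_norm (Summable.of_nonneg_of_le (fun _ => norm_nonneg _)
    (norm_mulOp_term_le m) hm))

theorem summable_norm_mul {m b : ℤ → ℂ} (hm : Summable fun n => ‖m n‖) {B : ℝ}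
    (hb : ∀ n, ‖b n‖ ≤ B) : Summable fun n => ‖m n * b n‖ := by
  refine Summable.of_nonneg_of_le (fun _ => norm_nonneg _) (fun n => ?_) (hm.mul_right B)
  rw [norm_mul]
  gcongr
  exact hb n

theorem summable_norm_mul_coefC {m : ℤ → ℂ} (hm : Summable fun n => ‖m n‖) (f : C(Torus, ℂ)) :
    Summable fun n => ‖m n * coefC n f‖ :=
  summable_norm_mul hm fun n => norm_coefC_le n f

theorem mulOp_eq {m : ℤ → ℂ} (hm : Summable fun n => ‖m n‖) (f : C(Torus, ℂ)) :
    mulOp m f = trigSum fun n => m n * coefC n f := by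
  have h1 := (hasSum_mulOp hm).map
    (ContinuousLinearMap.apply ℂ (C(Torus, ℂ)) f) (ContinuousLinearMap.continuous _)
  refine h1.unique ?_
  have h2 := hasSum_trigSum (summable_norm_mul_coefC hm f)
  simp only [mul_smul] at h2
  exact h2

theorem coefC_mulOp {m : ℤ → ℂ} (hm : Summable fun n => ‖m n‖) (f : C(Torus, ℂ)) (k : ℤ) :
    coefC k (mulOp m f) = m k * coefC k f := by
  rw [mulOp_eq hm, coefC_trigSum (summable_norm_mul_coefC hm f)]

theorem mulOp_trigSum {m c : ℤ → ℂ} (hm : Summable fun n => ‖m n‖)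
    (hc : Summable fun n => ‖c n‖) : mulOp m (trigSum c) = trigSum fun n => m n * c n := by
  rw [mulOp_eq hm]
  simp only [coefC_trigSum hc]

theorem norm_le_of_summable_norm {m : ℤ → ℂ} (hm : Summable fun n => ‖m n‖) (n : ℤ) :
    ‖m n‖ ≤ ∑' k, ‖m k‖ := hm.le_tsum n fun _ _ => norm_nonneg _

theorem mulOp_mulOp {m m' : ℤ → ℂ} (hm : Summable fun n => ‖m n‖)
    (hm' : Summable fun n => ‖m' n‖) (f : C(Torus, ℂ)) :
    mulOp m (mulOp m' f) = mulOp (fun n => m n * m' n) f := by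
  rw [mulOp_eq hm', mulOp_trigSum hm (summable_norm_mul_coefC hm' f),
    mulOp_eq (summable_norm_mul hm (norm_le_of_summable_norm hm'))]
  simp only [mul_assoc]

theorem mulOp_const_mul (c : ℂ) {m : ℤ → ℂ} (hm : Summable fun n => ‖m n‖) :
    mulOp (fun n => c * m n) = c • mulOp m := by
  refine HasSum.unique (hasSum_mulOp ?_) ?_
  · simpa [norm_mul] using hm.mul_left ‖c‖
  · simpa only [smul_smul] using (hasSum_mulOp hm).const_smul c

theorem mulOp_sum {ι : Type*} (s : Finset ι) {m : ι → ℤ → ℂ}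
    (hm : ∀ i, Summable fun n => ‖m i n‖) :
    mulOp (fun n => ∑ i ∈ s, m i n) = ∑ i ∈ s, mulOp (m i) := by
  refine HasSum.unique (hasSum_mulOp ?_) ?_
  · exact Summable.of_nonneg_of_le (fun _ => norm_nonneg _) (fun n => norm_sum_le _ _)
      (summable_sum fun i _ => hm i)
  · simpa only [Finset.sum_smul] using hasSum_sum fun i _ => hasSum_mulOp (hm i)

theorem summable_norm_of_support {m : ℤ → ℂ} (L : ℤ) (hm : ∀ n, L < |n| → m n = 0) :
    Summable fun n => ‖m n‖ := by
  refine summable_of_ne_finset_zero (s := Finset.Icc (-L) L) fun n hn => ?_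
  rw [hm n, norm_zero]
  by_contra h
  exact hn (Finset.mem_Icc.2 (abs_le.1 (not_lt.1 h)))

/-- The inclusion of real into complex continuous functions. -/
def toC : C(Torus, ℝ) →L[ℝ] C(Torus, ℂ) := Complex.ofRealCLM.compLeftContinuous ℝ Torus

/-- The real part of a complex continuous function. -/
def reC : C(Torus, ℂ) →L[ℝ] C(Torus, ℝ) := Complex.reCLM.compLeftContinuous ℝ Torus

@[simp] theorem toC_apply (f : C(Torus, ℝ)) (x : Torus) : toC f x = (f x : ℂ) := rfl

@[simp] theorem reC_apply (f : C(Torus, ℂ)) (x : Torus) : reC f x = (f x).re := rfl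

theorem norm_toC (f : C(Torus, ℝ)) : ‖toC f‖ = ‖f‖ := by
  refine le_antisymm ?_ ?_
  · refine (ContinuousMap.norm_le _ (norm_nonneg _)).2 fun x => ?_
    simpa using f.norm_coe_le_norm x
  · refine (ContinuousMap.norm_le _ (norm_nonneg _)).2 fun x => ?_
    simpa using (toC f).norm_coe_le_norm x

theorem norm_reC_le (f : C(Torus, ℂ)) : ‖reC f‖ ≤ ‖f‖ := by
  refine (ContinuousMap.norm_le _ (norm_nonneg _)).2 fun x => ?_
  exact (Complex.abs_re_le_norm _).trans (f.norm_coe_le_norm x)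

theorem reC_toC (f : C(Torus, ℝ)) : reC (toC f) = f := by ext x; simp

/-- Hermitian symmetry of a sequence, that is, reality of the corresponding function. -/
def Herm (m : ℤ → ℂ) : Prop := ∀ n, m (-n) = conj (m n)

theorem Herm.mul {m m' : ℤ → ℂ} (hm : Herm m) (hm' : Herm m') : Herm fun n => m n * m' n :=
  fun n => by
    change m (-n) * m' (-n) = _
    rw [hm n, hm' n, map_mul]

theorem herm_coefC (f : C(Torus, ℝ)) : Herm fun n => coefC n (toC f) := by
  intro n
  simp only [coefC_apply, fourierCoeff]
  rw [← integral_conj]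
  refine integral_congr_ae (ae_of_all _ fun t => ?_)
  have h : fourier n t = conj (fourier (-n) t) := by
    rw [← fourier_neg, neg_neg]
  simp only [neg_neg, h, smul_eq_mul, map_mul, toC_apply, Complex.conj_ofReal]

/-- Reindexing by n ↦ -n identifies the series with its conjugate. -/
theorem toC_reC_trigSum {c : ℤ → ℂ} (hc : Summable fun n => ‖c n‖) (h : Herm c) :
    toC (reC (trigSum c)) = trigSum c := by
  ext x
  simp only [toC_apply, reC_apply]
  rw [← Complex.conj_eq_iff_re]
  have h1 := hasSum_trigSum_apply hc x
  have h2 : HasSum (fun n => conj (c n * fou n x)) (conj (trigSum c x)) := h1.map (starRingEnd ℂ) Complex.continuous_conj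
  have h3 := (Equiv.neg ℤ).hasSum_iff.2 h1
  refine h2.unique (h3.congr_fun ?_)
  intro n
  simp [h n, fou_neg_apply]

/-- The Fourier multiplier with (Hermitian) symbol `m`, acting on real functions. -/
def mulR (m : ℤ → ℂ) : C(Torus, ℝ) →L[ℝ] C(Torus, ℝ) :=
  reC ∘L (mulOp m).restrictScalars ℝ ∘L toC

theorem mulR_apply (m : ℤ → ℂ) (f : C(Torus, ℝ)) : mulR m f = reC (mulOp m (toC f)) := rfl

theorem norm_mulR_le {m : ℤ → ℂ} {C : ℝ} (h : ∀ f, ‖mulOp m f‖ ≤ C * ‖f‖) (f : C(Torus, ℝ)) :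
    ‖mulR m f‖ ≤ C * ‖f‖ := by
  rw [mulR_apply, ← norm_toC f]
  exact (norm_reC_le _).trans (h _)

theorem toC_mulR {m : ℤ → ℂ} (hm : Summable fun n => ‖m n‖) (h : Herm m) (f : C(Torus, ℝ)) :
    toC (mulR m f) = mulOp m (toC f) := by
  rw [mulR_apply, mulOp_eq hm]
  exact toC_reC_trigSum (summable_norm_mul_coefC hm _) (h.mul (herm_coefC f))

theorem coefC_mulR {m : ℤ → ℂ} (hm : Summable fun n => ‖m n‖) (h : Herm m) (f : C(Torus, ℝ))
    (k : ℤ) : coefC k (toC (mulR m f)) = m k * coefC k (toC f) := by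
  rw [toC_mulR hm h, coefC_mulOp hm]

theorem mulR_mulR {m m' : ℤ → ℂ} (hm : Summable fun n => ‖m n‖)
    (hm' : Summable fun n => ‖m' n‖) (h' : Herm m') (f : C(Torus, ℝ)) :
    mulR m (mulR m' f) = mulR (fun n => m n * m' n) f := by
  rw [mulR_apply, toC_mulR hm' h', mulOp_mulOp hm hm', mulR_apply]

/-! ### Link with periodic distributions -/

theorem fourierCoef_add (u v : PeriodicDist) (n : ℤ) :
    fourierCoef (u + v) n = fourierCoef u n + fourierCoef v n := by
  simp [fourierCoef]; ring

theorem fourierCoef_sub (u v : PeriodicDist) (n : ℤ) :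
    fourierCoef (u - v) n = fourierCoef u n - fourierCoef v n := by
  simp [fourierCoef]; ring

theorem fourierCoef_smul (c : ℝ) (u : PeriodicDist) (n : ℤ) :
    fourierCoef (c • u) n = c * fourierCoef u n := by
  simp [fourierCoef]; ring

theorem coefC_toC (f : C(Torus, ℝ)) (n : ℤ) : coefC n (toC f) =
    ∫ x in (0 : ℝ)..1, Complex.exp (2 * Real.pi * Complex.I * (-n : ℤ) * x) * (f (x : Torus) : ℂ) := by
  rw [coefC_apply, fourierCoeff_eq_intervalIntegral _ _ 0]
  have h : ∀ x : ℝ, fourier (-n) (x : Torus) = _ := fou_coe (-n)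
  simp only [h]
  simp

theorem continuous_coe_torus {E : Type*} [TopologicalSpace E] (f : C(Torus, E)) :
    Continuous fun x : ℝ => f (x : Torus) :=
  f.continuous.comp (AddCircle.continuous_mk' 1)

theorem fourierCoef_toDist (f : C(Torus, ℝ)) (n : ℤ) :
    fourierCoef (toDist f) n = coefC n (toC f) := by
  rw [coefC_toC]
  have hf := continuous_coe_torus f
  have h1 : ((toDist f).1 (cosTest n) : ℂ) =
      ∫ x in (0 : ℝ)..1, (f (x : Torus) * Real.cos (2 * Real.pi * n * x) : ℂ) := by
    simp only [toDist, cosTest, LinearMap.coe_mk, AddHom.coe_mk, ← Complex.ofReal_mul]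
    rw [intervalIntegral.integral_ofReal]
  have h2 : ((toDist f).1 (sinTest n) : ℂ) =
      ∫ x in (0 : ℝ)..1, (f (x : Torus) * Real.sin (2 * Real.pi * n * x) : ℂ) := by
    simp only [toDist, sinTest, LinearMap.coe_mk, AddHom.coe_mk, ← Complex.ofReal_mul]
    rw [intervalIntegral.integral_ofReal]
  rw [fourierCoef, h1, h2, ← intervalIntegral.integral_const_mul,
    ← intervalIntegral.integral_sub]
  · refine intervalIntegral.integral_congr fun x _ => ?_
    have : (2 * Real.pi * Complex.I * (-n : ℤ) * x : ℂ) =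
        -((2 * Real.pi * n * x : ℝ) : ℂ) * Complex.I := by push_cast; ring
    simp only [this]
    rw [Complex.exp_mul_I, Complex.cos_neg, Complex.sin_neg, Complex.ofReal_cos,
      Complex.ofReal_sin]
    ring
  · exact Continuous.intervalIntegrable (by fun_prop) _ _
  · exact Continuous.intervalIntegrable (by fun_prop) _ _

theorem toDist_add (f g : C(Torus, ℝ)) : toDist (f + g) = toDist f + toDist g := by
  ext φ
  have h : ∀ f : C(Torus, ℝ), IntervalIntegrable
      (fun x : ℝ => f (x : Torus) * φ.1 x) volume 0 1 := fun f =>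
    ((continuous_coe_torus f).mul φ.2.1.continuous).intervalIntegrable _ _
  have := intervalIntegral.integral_add (h f) (h g)
  simpa [toDist, add_mul] using this

theorem toDist_sub (f g : C(Torus, ℝ)) : toDist (f - g) = toDist f - toDist g := by
  ext φ
  have h : ∀ f : C(Torus, ℝ), IntervalIntegrable
      (fun x : ℝ => f (x : Torus) * φ.1 x) volume 0 1 := fun f =>
    ((continuous_coe_torus f).mul φ.2.1.continuous).intervalIntegrable _ _
  have := intervalIntegral.integral_sub (h f) (h g)
  simpa [toDist, sub_mul] using this

theorem fourierCoef_distDeriv (u : PeriodicDist) (n : ℤ) :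
    fourierCoef (distDeriv u) n = 2 * Real.pi * Complex.I * n * fourierCoef u n := by
  have hc : derivTest (cosTest n) = (-(2 * Real.pi * n)) • sinTest n := by
    ext x
    have h1 : HasDerivAt (fun x : ℝ => 2 * Real.pi * n * x) (2 * Real.pi * n) x := by
      simpa using (hasDerivAt_id x).const_mul (2 * Real.pi * n)
    have : HasDerivAt (fun x => Real.cos (2 * Real.pi * n * x))
      (-(2 * Real.pi * n) * Real.sin (2 * Real.pi * n * x)) x := by
      convert h1.cos using 1
      ring
    simpa [derivTest, cosTest, sinTest] using this.deriv
  have hs : derivTest (sinTest n) = (2 * Real.pi * n) • cosTest n := by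
    ext x
    have h1 : HasDerivAt (fun x : ℝ => 2 * Real.pi * n * x) (2 * Real.pi * n) x := by
      simpa using (hasDerivAt_id x).const_mul (2 * Real.pi * n)
    have : HasDerivAt (fun x => Real.sin (2 * Real.pi * n * x))
      ((2 * Real.pi * n) * Real.cos (2 * Real.pi * n * x)) x := by
      convert h1.sin using 1
      ring
    simpa [derivTest, cosTest, sinTest] using this.deriv
  have h1 : (distDeriv u).1 (cosTest n) = 2 * Real.pi * n * u.1 (sinTest n) := by
    simp [distDeriv, hc]
  have h2 : (distDeriv u).1 (sinTest n) = -(2 * Real.pi * n * u.1 (cosTest n)) := by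
    simp [distDeriv, hs]
  rw [fourierCoef, fourierCoef, h1, h2]
  push_cast
  linear_combination (2 * Real.pi * n * (u.1 (sinTest n) : ℂ)) * Complex.I_sq

theorem herm_fourierCoef (u : PeriodicDist) : Herm (fourierCoef u) := by
  intro n
  have hc : cosTest (-n) = cosTest n := by
    ext x
    simp [cosTest]
  have hs : sinTest (-n) = -sinTest n := by
    ext x
    simp [sinTest]
  simp [fourierCoef, hc, hs]

/-! ### Littlewood--Paley symbols, blocks and Besov norms. -/

theorem cutoff_of_two_le {r : ℝ} (h : 2 ≤ |r|) : cutoff r = 0 :=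
  Real.smoothTransition.zero_of_nonpos (by linarith)

theorem cutoff_of_le_one {r : ℝ} (h : |r| ≤ 1) : cutoff r = 1 :=
  Real.smoothTransition.one_of_one_le (by linarith)

theorem dyadic_eq_zero_of_le {j : ℕ} {r : ℝ} (h : 2 ^ (j + 1) ≤ |r|) : dyadic j r = 0 := by
  cases j with
  | zero => exact cutoff_of_two_le (by simpa using h)
  | succ k =>
    have h2 : (0 : ℝ) < 2 ^ k := by positivity
    simp only [dyadic]
    rw [cutoff_of_two_le, cutoff_of_two_le, sub_zero]
    · rw [abs_div, abs_of_pos h2, le_div_iff₀ h2]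
      refine le_trans ?_ h
      rw [pow_succ, pow_succ]; linarith
    · rw [abs_div, abs_of_pos (by positivity : (0 : ℝ) < 2 ^ (k + 1)), le_div_iff₀ (by positivity)]
      refine le_trans (le_of_eq ?_) h
      rw [pow_succ _ (k + 1)]; ring

theorem dyadic_succ_eq_zero {k : ℕ} {r : ℝ} (h : |r| ≤ 2 ^ k) : dyadic (k + 1) r = 0 := by
  have h2 : (0 : ℝ) < 2 ^ k := by positivity
  simp only [dyadic]
  rw [cutoff_of_le_one, cutoff_of_le_one, sub_self]
  · rwa [abs_div, abs_of_pos h2, div_le_one h2]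
  · rw [abs_div, abs_of_pos (by positivity : (0 : ℝ) < 2 ^ (k + 1)), div_le_one (by positivity),
      pow_succ]
    linarith

/-- The symbol of the Littlewood--Paley block of index `j`. -/
def dy (j : ℕ) (n : ℤ) : ℂ := (dyadic j n : ℂ)

theorem dy_eq_zero {j : ℕ} {n : ℤ} (h : 2 ^ (j + 1) ≤ |n|) : dy j n = 0 := by
  rw [dy, dyadic_eq_zero_of_le, Complex.ofReal_zero]
  exact_mod_cast h

theorem dy_succ_eq_zero {k : ℕ} {n : ℤ} (h : |n| ≤ 2 ^ k) : dy (k + 1) n = 0 := by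
  rw [dy, dyadic_succ_eq_zero, Complex.ofReal_zero]
  exact_mod_cast h

theorem summable_dy_mul (j : ℕ) (b : ℤ → ℂ) : Summable fun n => ‖dy j n * b n‖ :=
  summable_norm_of_support (2 ^ (j + 1)) fun n hn => by rw [dy_eq_zero hn.le, zero_mul]

theorem summable_dy (j : ℕ) : Summable fun n => ‖dy j n‖ := by
  simpa using summable_dy_mul j 1

theorem cutoff_neg (r : ℝ) : cutoff (-r) = cutoff r := by simp [cutoff]

theorem dyadic_neg (j : ℕ) (r : ℝ) : dyadic j (-r) = dyadic j r := by
  cases j <;> simp [dyadic, cutoff_neg, neg_div]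

theorem herm_dy (j : ℕ) : Herm (dy j) := by
  intro n
  simp [dy, dyadic_neg]

theorem lpBlock_eq (j : ℕ) (u : PeriodicDist) (x : ℝ) :
    lpBlock j u x = trigSum (fun n => dy j n * fourierCoef u n) (x : Torus) := by
  refine HasSum.unique ?_ (hasSum_trigSum_apply (summable_dy_mul j _) _)
  simp only [fou_coe]
  refine hasSum_sum_of_ne_finset_zero fun n hn => ?_
  rw [dy_eq_zero, zero_mul, zero_mul]
  by_contra h
  exact hn (Finset.mem_Icc.2 (abs_le.1 (not_le.1 h).le))

theorem forall_torus {p : Torus → Prop} : (∀ x, p x) ↔ ∀ x : ℝ, p (x : Torus) :=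
  ⟨fun h x => h x, fun h x => by
    obtain ⟨y, rfl⟩ := QuotientAddGroup.mk_surjective x
    exact h y⟩

/-- The Littlewood--Paley block as an operator on continuous functions. -/
def blk (j : ℕ) : C(Torus, ℝ) →L[ℝ] C(Torus, ℝ) := mulR (dy j)

theorem toC_blk (j : ℕ) (f : C(Torus, ℝ)) :
    toC (blk j f) = trigSum fun n => dy j n * fourierCoef (toDist f) n := by
  rw [blk, toC_mulR (summable_dy j) (herm_dy j), mulOp_eq (summable_dy j)]
  simp only [fourierCoef_toDist]

/-- The Littlewood--Paley block of a distribution, as a continuous function. -/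
def dblk (j : ℕ) (u : PeriodicDist) : C(Torus, ℂ) := trigSum fun n => dy j n * fourierCoef u n

theorem dblk_toDist (j : ℕ) (f : C(Torus, ℝ)) : dblk j (toDist f) = toC (blk j f) :=
  (toC_blk j f).symm

theorem besovNorm_le_iff {β A : ℝ} (hA : 0 ≤ A) {u : PeriodicDist} :
    besovNorm β u ≤ ENNReal.ofReal A ↔
      ∀ j : ℕ, ‖dblk j u‖ ≤ A * 2 ^ (-(β * ((j : ℝ) - 1))) := by
  have h0 : ∀ (j : ℕ) (x y : ℝ), 2 ^ (β * ((j : ℝ) - 1)) * y ≤ x ↔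
      y ≤ x * 2 ^ (-(β * ((j : ℝ) - 1))) := fun j x y => by
    rw [Real.rpow_neg zero_le_two, ← div_eq_mul_inv, le_div_iff₀ (by positivity), mul_comm]
  simp only [besovNorm, iSup_le_iff]
  refine forall_congr' fun j => ?_
  rw [ContinuousMap.norm_le _ (by positivity), forall_torus]
  refine forall_congr' fun x => ?_
  rw [ENNReal.ofReal_le_ofReal_iff hA, h0, lpBlock_eq, dblk]

theorem norm_dblk_le {β : ℝ} {u : PeriodicDist} (h : besovNorm β u ≠ ⊤) (j : ℕ) :
    ‖dblk j u‖ ≤ (besovNorm β u).toReal * 2 ^ (-(β * ((j : ℝ) - 1))) :=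
  (besovNorm_le_iff ENNReal.toReal_nonneg).1 (ENNReal.ofReal_toReal h).symm.le j

theorem hbNorm_le_iff {β A : ℝ} (hA : 0 ≤ A) {f : C(Torus, ℝ)} :
    hbNorm β f ≤ ENNReal.ofReal A ↔
      ∀ j : ℕ, ‖blk j f‖ ≤ A * 2 ^ (-(β * ((j : ℝ) - 1))) := by
  rw [hbNorm, besovNorm_le_iff hA]
  simp only [dblk_toDist, norm_toC]

theorem besovNorm_add_le (β : ℝ) (u v : PeriodicDist) :
    besovNorm β (u + v) ≤ besovNorm β u + besovNorm β v := by
  refine iSup_le fun j => iSup_le fun x => ?_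
  have h1 : lpBlock j (u + v) x = lpBlock j u x + lpBlock j v x := by
    simp only [lpBlock, fourierCoef_add, ← Finset.sum_add_distrib]
    exact Finset.sum_congr rfl fun n _ => by ring
  have h : ∀ u : PeriodicDist,
      ENNReal.ofReal ((2 : ℝ) ^ (β * ((j : ℝ) - 1)) * ‖lpBlock j u x‖) ≤ besovNorm β u :=
    fun u => le_iSup₂ (f := fun (j : ℕ) (x : ℝ) =>
      ENNReal.ofReal ((2 : ℝ) ^ (β * ((j : ℝ) - 1)) * ‖lpBlock j u x‖)) j x
  refine le_trans ?_ (add_le_add (h u) (h v))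
  rw [← ENNReal.ofReal_add (by positivity) (by positivity), h1, ← mul_add]
  gcongr
  exact norm_add_le _ _

theorem hbNorm_add_le (β : ℝ) (f g : C(Torus, ℝ)) : hbNorm β (f + g) ≤ hbNorm β f + hbNorm β g := by
  rw [hbNorm, toDist_add]
  exact besovNorm_add_le _ _ _

/-- A distribution has finite order N, and k derivatives of the trigonometric test functions cost
|2πn|^k. Polynomial growth is what makes the heat series converge at every positive time. -/
theorem exists_fourierCoef_bound (u : PeriodicDist) :
    ∃ (N : ℕ) (C : ℝ), 0 ≤ C ∧ ∀ n : ℤ, ‖fourierCoef u n‖ ≤ C * (1 + |(n : ℝ)|) ^ N := by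
  obtain ⟨N, C, h⟩ := u.2
  have hb : ∀ (n : ℤ) (φ : SmoothPeriodic) (g : ℝ → ℝ), ContDiff ℝ ∞ g →
      (∀ k x, |iteratedDeriv k g x| ≤ 1) → (φ.1 = fun x => g (2 * Real.pi * n * x)) →
      |u.1 φ| ≤ |C| * (2 * Real.pi + 1) ^ N * (1 + |(n : ℝ)|) ^ N := by
    intro n φ g hg hg1 hφ
    refine (h φ (((2 * Real.pi + 1) * (1 + |(n : ℝ)|)) ^ N) fun k hk x => ?_).trans ?_
    · rw [hφ, iteratedDeriv_comp_const_mul (hg.of_le (by exact_mod_cast le_top)), abs_mul, abs_pow]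
      have h1 : |2 * Real.pi * (n : ℝ)| ≤ (2 * Real.pi + 1) * (1 + |(n : ℝ)|) := by
        rw [abs_mul, abs_of_pos (by positivity : 0 < 2 * Real.pi)]
        have := abs_nonneg (n : ℝ)
        nlinarith [Real.pi_pos]
      have h2 : 1 ≤ (2 * Real.pi + 1) * (1 + |(n : ℝ)|) := by
        have := abs_nonneg (n : ℝ)
        nlinarith [Real.pi_pos, mul_nonneg Real.pi_pos.le this]
      calc |2 * Real.pi * (n : ℝ)| ^ k * |iteratedDeriv k g (2 * Real.pi * n * x)|
          ≤ ((2 * Real.pi + 1) * (1 + |(n : ℝ)|)) ^ k * 1 := by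
            gcongr
            exact hg1 _ _
        _ ≤ _ := by rw [mul_one]; exact pow_le_pow_right₀ h2 hk
    · rw [mul_pow, mul_assoc]
      gcongr
      exact le_abs_self C
  refine ⟨N, 2 * (|C| * (2 * Real.pi + 1) ^ N), by positivity, fun n => ?_⟩
  have h1 := hb n (cosTest n) Real.cos Real.contDiff_cos
    (fun k x => Real.abs_iteratedDeriv_cos_le_one k x) rfl
  have h2 := hb n (sinTest n) Real.sin Real.contDiff_sin
    (fun k x => Real.abs_iteratedDeriv_sin_le_one k x) rfl
  rw [fourierCoef]
  refine (norm_sub_le _ _).trans ?_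
  simp only [norm_mul, Complex.norm_I, one_mul, Complex.norm_real, Real.norm_eq_abs]
  linarith

/-! ### Norm bounds for multipliers -/

theorem integrable_torus {E : Type*} [NormedAddCommGroup E] {f : Torus → E} (hf : Continuous f) :
    Integrable f (haarAddCircle : Measure Torus) :=
  hf.integrable_of_hasCompactSupport (HasCompactSupport.of_compactSpace f)

theorem hasSum_sq_coefC (f : C(Torus, ℂ)) :
    HasSum (fun n => ‖coefC n f‖ ^ 2) (∫ t, ‖f t‖ ^ 2 ∂(haarAddCircle : Measure Torus)) := by
  have h := hasSum_sq_fourierCoeff (T := 1) (ContinuousMap.toLp 2 haarAddCircle ℂ f)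
  have h2 : ∀ n, fourierCoeff (ContinuousMap.toLp 2 haarAddCircle ℂ f) n = coefC n f :=
    fun n => fourierCoeff_toLp f n
  simp only [h2] at h
  convert h using 1
  refine integral_congr_ae ?_
  filter_upwards [ContinuousMap.coeFn_toLp (p := 2) (𝕜 := ℂ) (haarAddCircle : Measure Torus) f]
    with t ht
  rw [ht]

/-- The left-hand chord length is |e^{2πix} - 1| = 2 |sin πx|, which is at least 4|x| on the half
period by Jordan's inequality. -/
theorem sixteen_mul_sq_le {x : ℝ} (hx : |x| ≤ 1 / 2) :
    16 * x ^ 2 ≤ ‖fou 1 (x : Torus) - 1‖ ^ 2 := by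
  have h1 : fou 1 (x : Torus) - 1 = Complex.exp (Complex.I * ((2 * Real.pi * x : ℝ) : ℂ)) - 1 := by
    rw [fou_coe]; congr 2; push_cast; ring
  rw [h1, Complex.norm_exp_I_mul_ofReal_sub_one, Real.norm_eq_abs, sq_abs]
  have h2 : 2 * Real.pi * x / 2 = Real.pi * x := by ring
  rw [h2]
  have h3 : 2 / Real.pi * |Real.pi * x| ≤ |Real.sin (Real.pi * x)| := by
    apply Real.mul_abs_le_abs_sin
    rw [abs_mul, abs_of_pos Real.pi_pos]
    nlinarith [Real.pi_pos]
  rw [abs_mul, abs_of_pos Real.pi_pos, ← mul_assoc, div_mul_cancel₀ _ Real.pi_ne_zero] at h3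
  have h4 : (2 * |x|) ^ 2 ≤ |Real.sin (Real.pi * x)| ^ 2 :=
    pow_le_pow_left₀ (by positivity) h3 2
  rw [mul_pow, sq_abs, sq_abs] at h4
  nlinarith

/-- The integrand lives on |x| ≲ 1/N; after the chord bound it becomes an arctangent integral. -/
theorem integral_inv_weight_le {N : ℝ} (hN : 0 < N) :
    ∫ t, (1 + N ^ 2 * ‖fou 1 t - 1‖ ^ 2)⁻¹ ∂(haarAddCircle : Measure Torus) ≤ 1 / N := by
  have hpos : ∀ t : Torus, 0 < 1 + N ^ 2 * ‖fou 1 t - 1‖ ^ 2 := fun t => by positivity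
  have hc : Continuous fun t : Torus => (1 + N ^ 2 * ‖fou 1 t - 1‖ ^ 2)⁻¹ :=
    Continuous.inv₀ (by fun_prop) fun t => (hpos t).ne'
  rw [integral_haarAddCircle, inv_one, one_smul, ← AddCircle.intervalIntegral_preimage 1 (-(1 / 2))]
  have h1 : (-(1 / 2) + 1 : ℝ) = 1 / 2 := by norm_num
  rw [h1]
  have hcr : Continuous fun x : ℝ => (1 + N ^ 2 * ‖fou 1 (x : Torus) - 1‖ ^ 2)⁻¹ :=
    hc.comp (AddCircle.continuous_mk' 1)
  have hc2 : Continuous fun x : ℝ => 1 / (1 + (4 * N * x) ^ 2) :=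
    continuous_const.div (by fun_prop) fun x => by positivity
  calc ∫ x in (-(1 / 2) : ℝ)..1 / 2, (1 + N ^ 2 * ‖fou 1 (x : Torus) - 1‖ ^ 2)⁻¹
      ≤ ∫ x in (-(1 / 2) : ℝ)..1 / 2, 1 / (1 + (4 * N * x) ^ 2) := by
        refine intervalIntegral.integral_mono_on (by norm_num) (hcr.intervalIntegrable _ _)
          (hc2.intervalIntegrable _ _) fun x hx => ?_
        rw [← one_div]
        have := sixteen_mul_sq_le (abs_le.2 hx)
        refine one_div_le_one_div_of_le (by positivity) ?_
        nlinarith [sq_nonneg N]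
    _ = (4 * N)⁻¹ * (2 * Real.arctan (2 * N)) := by
        rw [intervalIntegral.integral_comp_mul_left (fun y => 1 / (1 + y ^ 2))
          (by positivity : 4 * N ≠ 0), integral_one_div_one_add_sq, smul_eq_mul]
        have h2 : 4 * N * -(1 / 2) = -(2 * N) := by ring
        have h3 : 4 * N * (1 / 2) = 2 * N := by ring
        rw [h2, h3, Real.arctan_neg]
        ring
    _ ≤ (4 * N)⁻¹ * (2 * 2) := by
        have h2 := Real.arctan_lt_pi_div_two (2 * N)
        have h3 := Real.pi_lt_four
        have : Real.arctan (2 * N) ≤ 2 := by linarith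
        gcongr
    _ = 1 / N := by field_simp; norm_num

/-- Multiplying a kernel by e^{2πix} - 1 therefore takes the finite difference of its symbol, the
periodic substitute for multiplication by x. -/
theorem coefC_fou_mul (k : C(Torus, ℂ)) (n : ℤ) : coefC n (fou 1 * k) = coefC (n - 1) k := by
  simp only [coefC_apply, fourierCoeff]
  refine integral_congr_ae (ae_of_all _ fun t => ?_)
  have : fourier (-(n - 1)) t = fourier (-n) t * fourier 1 t := by
    rw [← fourier_add]; congr 1; ring_nf
  simp only [this, fou, ContinuousMap.mul_apply, smul_eq_mul]
  ring

/-- Weighted Cauchy--Schwarz: |k| is split with the weight 1 + N²|e^{2πit} - 1|², whose inverse has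
integral at most 1/N, and Parseval evaluates the two L² norms that remain. Each of the three terms
contributes P/2. -/
theorem integral_norm_trigSum_le {m : ℤ → ℂ} (hm : Summable fun n => ‖m n‖) {N P : ℝ}
    (hN : 0 < N) (hP : 0 < P) (h1 : ∑' n, ‖m n‖ ^ 2 ≤ N * P ^ 2)
    (h2 : ∑' n, ‖m (n + 1) - m n‖ ^ 2 ≤ P ^ 2 / N) :
    ∫ t, ‖trigSum m t‖ ∂(haarAddCircle : Measure Torus) ≤ 2 * P := by
  set k := trigSum m with hk
  have hpos : ∀ t : Torus, 0 < 1 + N ^ 2 * ‖fou 1 t - 1‖ ^ 2 := fun t => by positivity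
  have e1 : ∫ t, ‖k t‖ ^ 2 ∂(haarAddCircle : Measure Torus) ≤ N * P ^ 2 := by
    rw [← (hasSum_sq_coefC k).tsum_eq]
    simpa only [hk, coefC_trigSum hm] using h1
  have e2 : ∫ t, ‖(fou 1 * k - k) t‖ ^ 2 ∂(haarAddCircle : Measure Torus) ≤ P ^ 2 / N := by
    rw [← (hasSum_sq_coefC (fou 1 * k - k)).tsum_eq]
    refine le_trans (le_of_eq ?_) h2
    rw [← (Equiv.addRight (1 : ℤ)).tsum_eq]
    refine tsum_congr fun n => ?_
    rw [map_sub, coefC_fou_mul, hk, coefC_trigSum hm, coefC_trigSum hm, ← norm_neg]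
    simp
  have hc : Continuous fun t : Torus => (1 + N ^ 2 * ‖fou 1 t - 1‖ ^ 2)⁻¹ :=
    Continuous.inv₀ (by fun_prop) fun t => (hpos t).ne'
  have i1 : Integrable (fun t : Torus => P * N / 2 * (1 + N ^ 2 * ‖fou 1 t - 1‖ ^ 2)⁻¹)
    haarAddCircle := integrable_torus (by fun_prop)
  have i2 : Integrable (fun t : Torus => (2 * (P * N))⁻¹ * ‖k t‖ ^ 2) haarAddCircle :=
    integrable_torus (by fun_prop)
  have i3 : Integrable (fun t : Torus => N / (2 * P) * ‖(fou 1 * k - k) t‖ ^ 2) haarAddCircle :=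
    integrable_torus (by fun_prop)
  calc ∫ t, ‖k t‖ ∂(haarAddCircle : Measure Torus)
      ≤ ∫ t, (P * N / 2 * (1 + N ^ 2 * ‖fou 1 t - 1‖ ^ 2)⁻¹ + (2 * (P * N))⁻¹ * ‖k t‖ ^ 2 +
          N / (2 * P) * ‖(fou 1 * k - k) t‖ ^ 2) ∂(haarAddCircle : Measure Torus) := by
        refine integral_mono (integrable_torus (by fun_prop)) ((i1.add i2).add i3) fun t => ?_
        have h3 : ‖(fou 1 * k - k) t‖ = ‖fou 1 t - 1‖ * ‖k t‖ := by
          rw [← norm_mul]; congr 1; simp; ring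
        simp only [h3]
        set q := ‖fou 1 t - 1‖
        set y := ‖k t‖
        have hs : 0 < 1 + N ^ 2 * q ^ 2 := hpos t
        -- The Young inequality in exact form: the defect is a perfect square.
        have key : P * N / 2 * (1 + N ^ 2 * q ^ 2)⁻¹ + (2 * (P * N))⁻¹ * y ^ 2 +
            N / (2 * P) * (q * y) ^ 2 - y =
            (2 * (P * N) * (1 + N ^ 2 * q ^ 2))⁻¹ * (P * N - (1 + N ^ 2 * q ^ 2) * y) ^ 2 := by
          field_simp
          ring
        have : 0 ≤ (2 * (P * N) * (1 + N ^ 2 * q ^ 2))⁻¹ *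
          (P * N - (1 + N ^ 2 * q ^ 2) * y) ^ 2 := by positivity
        linarith
    _ = P * N / 2 * ∫ t, (1 + N ^ 2 * ‖fou 1 t - 1‖ ^ 2)⁻¹ ∂(haarAddCircle : Measure Torus) +
        (2 * (P * N))⁻¹ * ∫ t, ‖k t‖ ^ 2 ∂(haarAddCircle : Measure Torus) +
        N / (2 * P) * ∫ t, ‖(fou 1 * k - k) t‖ ^ 2 ∂(haarAddCircle : Measure Torus) := by
        have i12 : Integrable (fun t : Torus => P * N / 2 * (1 + N ^ 2 * ‖fou 1 t - 1‖ ^ 2)⁻¹ +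
          (2 * (P * N))⁻¹ * ‖k t‖ ^ 2) haarAddCircle := i1.add i2
        rw [integral_add i12 i3, integral_add i1 i2, integral_const_mul,
          integral_const_mul, integral_const_mul]
    _ ≤ P * N / 2 * (1 / N) + (2 * (P * N))⁻¹ * (N * P ^ 2) + N / (2 * P) * (P ^ 2 / N) := by
        gcongr
        exact integral_inv_weight_le hN
    _ ≤ 2 * P := by
        have : P * N / 2 * (1 / N) + (2 * (P * N))⁻¹ * (N * P ^ 2) + N / (2 * P) * (P ^ 2 / N)
          = 3 / 2 * P := by field_simp; norm_num
        linarith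

theorem mulOp_apply_eq_integral {m : ℤ → ℂ} (hm : Summable fun n => ‖m n‖) (f : C(Torus, ℂ))
    (x : Torus) :
    mulOp m f x = ∫ t, trigSum m (x - t) * f t ∂(haarAddCircle : Measure Torus) := by
  have h1 := hasSum_trigSum_apply (summable_norm_mul_coefC hm f) x
  rw [← mulOp_eq hm] at h1
  have h2 : HasSum (fun n => ∫ t, m n * fou n (x - t) * f t ∂(haarAddCircle : Measure Torus))
      (∫ t, ∑' n, m n * fou n (x - t) * f t ∂(haarAddCircle : Measure Torus)) := by
    refine hasSum_integral_of_summable_integral_norm (fun n => integrable_torus (by fun_prop)) ?_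
    refine Summable.of_nonneg_of_le (fun n => integral_nonneg fun t => norm_nonneg _) (fun n => ?_)
      (hm.mul_right ‖f‖)
    have : ∀ t : Torus, ‖m n * fou n (x - t) * f t‖ ≤ ‖m n‖ * ‖f‖ := fun t => by
      rw [norm_mul, norm_mul, norm_fou_apply, mul_one]
      gcongr
      exact f.norm_coe_le_norm t
    refine (integral_mono (integrable_torus (by fun_prop)) (integrable_const _) this).trans ?_
    simp
  have h3 : (fun n => ∫ t, m n * fou n (x - t) * f t ∂(haarAddCircle : Measure Torus)) =
      fun n => m n * coefC n f * fou n x := by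
    funext n
    rw [coefC_apply, fourierCoeff, ← integral_const_mul, ← integral_mul_const]
    refine integral_congr_ae (ae_of_all _ fun t => ?_)
    have : fou n (x - t) = fou n x * fou (-n) t := by
      simp only [fou, fourier_apply, sub_eq_add_neg, zsmul_add, smul_neg, neg_smul,
        AddCircle.toCircle_add, Circle.coe_mul]
    change m n * fou n (x - t) * f t = m n * (fou (-n) t * f t) * fou n x
    rw [this]
    ring
  rw [h3] at h2
  rw [h1.unique h2]
  refine integral_congr_ae (ae_of_all _ fun t => ?_)
  simp only [tsum_mul_right, (hasSum_trigSum_apply hm (x - t)).tsum_eq]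

/-- The operator is convolution with `trigSum m`, so its norm on sup norms is at most the L¹ norm of
the kernel. -/
theorem norm_mulOp_le_of_sq {m : ℤ → ℂ} (hm : Summable fun n => ‖m n‖) {N P : ℝ}
    (hN : 0 < N) (hP : 0 < P) (h1 : ∑' n, ‖m n‖ ^ 2 ≤ N * P ^ 2)
    (h2 : ∑' n, ‖m (n + 1) - m n‖ ^ 2 ≤ P ^ 2 / N) (f : C(Torus, ℂ)) :
    ‖mulOp m f‖ ≤ 2 * P * ‖f‖ := by
  refine (ContinuousMap.norm_le _ (by positivity)).2 fun x => ?_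
  rw [mulOp_apply_eq_integral hm]
  calc ‖∫ t, trigSum m (x - t) * f t ∂(haarAddCircle : Measure Torus)‖
      ≤ ∫ t, ‖trigSum m (x - t)‖ * ‖f‖ ∂(haarAddCircle : Measure Torus) := by
        refine norm_integral_le_of_norm_le (integrable_torus (by fun_prop))
          (ae_of_all _ fun t => ?_)
        rw [norm_mul]
        gcongr
        exact f.norm_coe_le_norm t
    _ = (∫ t, ‖trigSum m t‖ ∂(haarAddCircle : Measure Torus)) * ‖f‖ := by
        rw [integral_mul_const, integral_sub_left_eq_self (fun t => ‖trigSum m t‖) _ x]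
    _ ≤ 2 * P * ‖f‖ := by
        gcongr
        exact integral_norm_trigSum_le hm hN hP h1 h2

/-- A finitely supported symbol at scale `2^j` which is bounded by `A` and varies slowly defines
an operator of norm `O(A)`. -/
theorem norm_mulOp_le_of_scale {m : ℤ → ℂ} {j : ℕ} {A : ℝ} (hA : 0 ≤ A)
    (h0 : ∀ n : ℤ, 2 ^ (j + 1) ≤ |n| → m n = 0) (h1 : ∀ n, ‖m n‖ ≤ A)
    (h2 : ∀ n, ‖m (n + 1) - m n‖ ≤ A / 2 ^ j) (f : C(Torus, ℂ)) :
    ‖mulOp m f‖ ≤ 4 * A * ‖f‖ := by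
  have hm := summable_norm_of_support (2 ^ (j + 1)) fun n hn => h0 n hn.le
  -- The kernel estimate needs P = 2A > 0, so A = 0 is treated apart.
  rcases hA.eq_or_lt with rfl | hA
  · have : m = fun n => 0 * (m n) := by
      funext n
      simpa using h1 n
    rw [this, mulOp_const_mul 0 hm]
    simp
  -- Half-open on purpose: at n = -2^(j+1) the symbol vanishes, but its value at n + 1 need not.
  -- With 4 · 2^j points, the choice N = 2^j and P = 2A fits both sums.
  set s := Finset.Ico (-(2 : ℤ) ^ (j + 1)) (2 ^ (j + 1)) with hs
  have hcard : (s.card : ℝ) = 4 * 2 ^ j := by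
    rw [hs, Int.card_Ico, sub_neg_eq_add]
    have : ((2 : ℤ) ^ (j + 1) + 2 ^ (j + 1)).toNat = 4 * 2 ^ j := by
      zify
      rw [Int.toNat_of_nonneg (by positivity), pow_succ]
      ring
    rw [this]; push_cast; ring
  have hz : ∀ n ∉ s, m n = 0 := fun n hn => h0 n <| by
    by_contra h
    rw [not_le, abs_lt] at h
    exact hn (Finset.mem_Ico.2 ⟨h.1.le, h.2⟩)
  have hz2 : ∀ n ∉ s, m (n + 1) = 0 := fun n hn => h0 _ <| by
    have hp : (0 : ℤ) < 2 ^ (j + 1) := by positivity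
    simp only [hs, Finset.mem_Ico, not_and_or, not_le, not_lt] at hn
    rcases hn with hn | hn
    · rw [abs_of_nonpos (by omega)]; omega
    · rw [abs_of_nonneg (by omega)]; omega
  have e1 : ∑' n, ‖m n‖ ^ 2 ≤ 2 ^ j * (2 * A) ^ 2 := by
    rw [tsum_eq_sum (s := s) fun n hn => by rw [hz n hn]; simp]
    calc ∑ n ∈ s, ‖m n‖ ^ 2 ≤ ∑ n ∈ s, A ^ 2 := Finset.sum_le_sum fun n _ =>
          pow_le_pow_left₀ (norm_nonneg _) (h1 n) 2
      _ = 2 ^ j * (2 * A) ^ 2 := by rw [Finset.sum_const, nsmul_eq_mul, hcard]; ring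
  have e2 : ∑' n, ‖m (n + 1) - m n‖ ^ 2 ≤ (2 * A) ^ 2 / 2 ^ j := by
    rw [tsum_eq_sum (s := s) fun n hn => by rw [hz n hn, hz2 n hn]; simp]
    calc ∑ n ∈ s, ‖m (n + 1) - m n‖ ^ 2 ≤ ∑ n ∈ s, (A / 2 ^ j) ^ 2 :=
          Finset.sum_le_sum fun n _ => pow_le_pow_left₀ (norm_nonneg _) (h2 n) 2
      _ = (2 * A) ^ 2 / 2 ^ j := by
          rw [Finset.sum_const, nsmul_eq_mul, hcard]; field_simp; norm_num
  refine (norm_mulOp_le_of_sq hm (by positivity) (by positivity) e1 e2 f).trans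
    (le_of_eq (by ring))

/-! ### Littlewood--Paley theory -/

/-- The transition function is C¹ on the compact [0,1] and constant on either side, so it factors
through the 1-Lipschitz projection onto [0,1]. -/
theorem exists_cutoff_lipschitz :
    ∃ L : ℝ, 1 ≤ L ∧ ∀ r s : ℝ, |cutoff r - cutoff s| ≤ L * |r - s| := by
  have hc : ContDiff ℝ 1 Real.smoothTransition := Real.smoothTransition.contDiff
  obtain ⟨C, hC⟩ := (isCompact_Icc (a := (0 : ℝ)) (b := 1)).exists_bound_of_continuousOn
    (hc.continuous_deriv le_rfl).continuousOn
  have h1 : ∀ x ∈ Icc (0 : ℝ) 1, ∀ y ∈ Icc (0 : ℝ) 1,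
      |Real.smoothTransition y - Real.smoothTransition x| ≤ C * |y - x| := fun x hx y hy =>
    (convex_Icc 0 1).norm_image_sub_le_of_norm_deriv_le
      (fun z _ => (hc.differentiable one_ne_zero).differentiableAt) hC hx hy
  have h2 : ∀ x y : ℝ,
      |Real.smoothTransition y - Real.smoothTransition x| ≤ max 1 C * |y - x| := fun x y => by
    rw [← Real.smoothTransition.projIcc (x := x), ← Real.smoothTransition.projIcc (x := y)]
    refine (h1 _ (projIcc 0 1 zero_le_one x).2 _ (projIcc 0 1 zero_le_one y).2).trans ?_
    have h3 : |((projIcc (0 : ℝ) 1 zero_le_one y : Icc (0 : ℝ) 1) : ℝ) -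
        (projIcc (0 : ℝ) 1 zero_le_one x : Icc (0 : ℝ) 1)| ≤ |y - x| := by
      simpa using abs_projIcc_sub_projIcc (zero_le_one' ℝ) (c := y) (d := x)
    calc _ ≤ max 1 C * _ := mul_le_mul_of_nonneg_right (le_max_right _ _) (abs_nonneg _)
      _ ≤ _ := mul_le_mul_of_nonneg_left h3 (zero_le_one.trans (le_max_left _ _))
  refine ⟨max 1 C, le_max_left _ _, fun r s => (h2 _ _).trans ?_⟩
  have h3 : |2 - |r| - (2 - |s|)| ≤ |r - s| := by
    rw [show 2 - |r| - (2 - |s|) = |s| - |r| by ring, abs_sub_comm r s]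
    exact abs_abs_sub_abs_le_abs_sub s r
  exact mul_le_mul_of_nonneg_left h3 (zero_le_one.trans (le_max_left _ _))

/-- A Lipschitz constant of the cut-off. -/
def lipC : ℝ := exists_cutoff_lipschitz.choose

theorem one_le_lipC : 1 ≤ lipC := exists_cutoff_lipschitz.choose_spec.1

theorem cutoff_lipschitz (r s : ℝ) : |cutoff r - cutoff s| ≤ lipC * |r - s| :=
  exists_cutoff_lipschitz.choose_spec.2 r s

theorem cutoff_div_lipschitz (j : ℕ) (r s : ℝ) :
    |cutoff (r / 2 ^ j) - cutoff (s / 2 ^ j)| ≤ lipC / 2 ^ j * |r - s| := by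
  refine (cutoff_lipschitz _ _).trans (le_of_eq ?_)
  rw [← sub_div, abs_div, abs_of_pos (by positivity : (0 : ℝ) < 2 ^ j)]
  ring

theorem dyadic_lipschitz (j : ℕ) (r s : ℝ) :
    |dyadic j r - dyadic j s| ≤ 3 * lipC / 2 ^ j * |r - s| := by
  have hL := one_le_lipC
  cases j with
  | zero =>
    refine (cutoff_lipschitz r s).trans ?_
    gcongr
    rw [pow_zero, div_one]; linarith
  | succ k =>
    have h1 := cutoff_div_lipschitz (k + 1) r s
    have h2 := cutoff_div_lipschitz k r s
    simp only [dyadic]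
    have h3 : cutoff (r / 2 ^ (k + 1)) - cutoff (r / 2 ^ k) -
        (cutoff (s / 2 ^ (k + 1)) - cutoff (s / 2 ^ k)) =
        (cutoff (r / 2 ^ (k + 1)) - cutoff (s / 2 ^ (k + 1))) -
        (cutoff (r / 2 ^ k) - cutoff (s / 2 ^ k)) := by ring
    rw [h3]
    refine (abs_sub _ _).trans ((add_le_add h1 h2).trans (le_of_eq ?_))
    rw [pow_succ]
    field_simp
    ring

theorem cutoff_nonneg (r : ℝ) : 0 ≤ cutoff r := Real.smoothTransition.nonneg _

theorem cutoff_le_one (r : ℝ) : cutoff r ≤ 1 := Real.smoothTransition.le_one _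

theorem norm_dy_le (j : ℕ) (n : ℤ) : ‖dy j n‖ ≤ 1 := by
  rw [dy, Complex.norm_real, Real.norm_eq_abs]
  cases j with
  | zero => exact abs_le.2 ⟨by linarith [cutoff_nonneg n, show dyadic 0 (n : ℝ) = cutoff n from rfl],
      cutoff_le_one _⟩
  | succ k =>
    simp only [dyadic]
    exact abs_le.2 ⟨by linarith [cutoff_nonneg ((n : ℝ) / 2 ^ (k + 1)), cutoff_le_one ((n : ℝ) / 2 ^ k)],
      by linarith [cutoff_nonneg ((n : ℝ) / 2 ^ k), cutoff_le_one ((n : ℝ) / 2 ^ (k + 1))]⟩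

theorem norm_dy_sub_le (j : ℕ) (n : ℤ) : ‖dy j (n + 1) - dy j n‖ ≤ 3 * lipC / 2 ^ j := by
  rw [dy, dy, ← Complex.ofReal_sub, Complex.norm_real, Real.norm_eq_abs]
  refine (dyadic_lipschitz j _ _).trans (le_of_eq ?_)
  simp

/-- The frequencies of the dyadic annulus of index `j`. -/
def annulus (j : ℕ) : Set ℤ := {n | |n| ≤ 2 ^ (j + 1) ∧ 2 ^ j ≤ 2 * |n| + 1}

/-- The annulus is wide enough that a difference of consecutive values with one end in the support
of `dy j` has both ends in it; symbol bounds are then needed on the annulus only. -/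
theorem mem_annulus_of_adj {j : ℕ} {n k : ℤ} (hn : dy j n ≠ 0) (h : |k - n| ≤ 1) :
    k ∈ annulus j := by
  have h1 : |n| < 2 ^ (j + 1) := by
    by_contra h
    exact hn (dy_eq_zero (not_lt.1 h))
  have h3 := abs_sub_abs_le_abs_sub k n
  have h4 := abs_sub_abs_le_abs_sub n k
  rw [abs_sub_comm n k] at h4
  refine ⟨by omega, ?_⟩
  cases j with
  | zero => have := abs_nonneg k; rw [pow_zero]; omega
  | succ i =>
    have h2 : 2 ^ i < |n| := by
      by_contra h
      exact hn (dy_succ_eq_zero (not_lt.1 h))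
    rw [pow_succ]; omega

theorem mem_annulus_of_ne_zero {j : ℕ} {n : ℤ} (hn : dy j n ≠ 0) : n ∈ annulus j :=
  mem_annulus_of_adj hn (by simp)

/-- The constant of the Bernstein-type bounds. -/
def bernC : ℝ := 4 * (1 + 3 * lipC)

theorem bernC_pos : 0 < bernC := by
  have := one_le_lipC
  unfold bernC; linarith

/-- Discrete product rule: either the cut-off or the symbol takes the difference, and each
difference gains a factor 2^{-j}. -/
theorem norm_mulOp_dy_le {m : ℤ → ℂ} {j : ℕ} {A : ℝ} (hA : 0 ≤ A)
    (h1 : ∀ n ∈ annulus j, ‖m n‖ ≤ A)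
    (h2 : ∀ n ∈ annulus j, n + 1 ∈ annulus j → ‖m (n + 1) - m n‖ ≤ A / 2 ^ j)
    (f : C(Torus, ℂ)) : ‖mulOp (fun n => dy j n * m n) f‖ ≤ bernC * A * ‖f‖ := by
  have hL := one_le_lipC
  have hA' : 0 ≤ (1 + 3 * lipC) * A := by positivity
  refine (norm_mulOp_le_of_scale (j := j) hA' ?_ ?_ ?_ f).trans (le_of_eq ?_)
  · intro n hn
    rw [dy_eq_zero hn, zero_mul]
  · intro n
    by_cases h : dy j n = 0
    · rw [h, zero_mul, norm_zero]; exact hA'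
    · rw [norm_mul]
      have := mul_le_mul (norm_dy_le j n) (h1 n (mem_annulus_of_ne_zero h)) (norm_nonneg _)
        zero_le_one
      nlinarith
  · intro n
    by_cases h : dy j n = 0 ∧ dy j (n + 1) = 0
    · rw [h.1, h.2, zero_mul, zero_mul, sub_zero, norm_zero]; positivity
    · have hm : n ∈ annulus j ∧ n + 1 ∈ annulus j := by
        rcases not_and_or.1 h with h | h
        · exact ⟨mem_annulus_of_ne_zero h, mem_annulus_of_adj h (by simp)⟩
        · exact ⟨mem_annulus_of_adj h (by simp), mem_annulus_of_ne_zero h⟩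
      have e : dy j (n + 1) * m (n + 1) - dy j n * m n =
          (dy j (n + 1) - dy j n) * m (n + 1) + dy j n * (m (n + 1) - m n) := by ring
      rw [e]
      refine (norm_add_le _ _).trans ?_
      rw [norm_mul, norm_mul]
      calc _ ≤ 3 * lipC / 2 ^ j * A + 1 * (A / 2 ^ j) :=
            add_le_add
              (mul_le_mul (norm_dy_sub_le j n) (h1 _ hm.2) (norm_nonneg _) (by positivity))
              (mul_le_mul (norm_dy_le j n) (h2 n hm.1 hm.2) (norm_nonneg _) zero_le_one)
        _ = (1 + 3 * lipC) * A / 2 ^ j := by ring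
  · unfold bernC; ring

theorem norm_blk_le (j : ℕ) (f : C(Torus, ℝ)) : ‖blk j f‖ ≤ bernC * ‖f‖ := by
  refine norm_mulR_le (fun f => ?_) f
  have := norm_mulOp_dy_le (m := fun _ => 1) (j := j) zero_le_one (by simp) (by simp) f
  simpa using this

/-- The symbol of the smooth frequency truncation at scale `2^J`. -/
def cu (J : ℕ) (n : ℤ) : ℂ := (cutoff (n / 2 ^ J) : ℂ)

theorem sum_dyadic (J : ℕ) (r : ℝ) : ∑ j ∈ Finset.range (J + 1), dyadic j r = cutoff (r / 2 ^ J) := by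
  induction J with
  | zero => simp [dyadic]
  | succ J ih => rw [Finset.sum_range_succ, ih, dyadic]; ring

theorem sum_dy (J : ℕ) (n : ℤ) : ∑ j ∈ Finset.range (J + 1), dy j n = cu J n := by
  simp only [dy, cu, ← sum_dyadic, Complex.ofReal_sum]

theorem cu_eq_one {J : ℕ} {n : ℤ} (h : |n| ≤ 2 ^ J) : cu J n = 1 := by
  rw [cu, cutoff_of_le_one, Complex.ofReal_one]
  rw [abs_div, abs_of_pos (by positivity : (0 : ℝ) < 2 ^ J), div_le_one (by positivity)]
  exact_mod_cast h

theorem cu_eq_zero {J : ℕ} {n : ℤ} (h : 2 ^ (J + 1) ≤ |n|) : cu J n = 0 := by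
  rw [cu, cutoff_of_two_le, Complex.ofReal_zero]
  rw [abs_div, abs_of_pos (by positivity : (0 : ℝ) < 2 ^ J), le_div_iff₀ (by positivity),
    ← pow_succ']
  exact_mod_cast h

theorem summable_cu_mul (J : ℕ) (b : ℤ → ℂ) : Summable fun n => ‖cu J n * b n‖ :=
  summable_norm_of_support (2 ^ (J + 1)) fun n hn => by rw [cu_eq_zero hn.le, zero_mul]

theorem summable_cu (J : ℕ) : Summable fun n => ‖cu J n‖ := by
  simpa using summable_cu_mul J 1

theorem herm_cu (J : ℕ) : Herm (cu J) := by
  intro n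
  simp [cu, neg_div, cutoff_neg]

theorem norm_cu_le (J : ℕ) (n : ℤ) : ‖cu J n‖ ≤ 1 := by
  rw [cu, Complex.norm_real, Real.norm_eq_abs, abs_of_nonneg (cutoff_nonneg _)]
  exact cutoff_le_one _

theorem norm_mulOp_cu_le (J : ℕ) (f : C(Torus, ℂ)) : ‖mulOp (cu J) f‖ ≤ 4 * lipC * ‖f‖ := by
  have hL := one_le_lipC
  refine norm_mulOp_le_of_scale (j := J) (by linarith) (fun n hn => cu_eq_zero hn)
    (fun n => (norm_cu_le J n).trans hL) (fun n => ?_) f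
  rw [cu, cu, ← Complex.ofReal_sub, Complex.norm_real, Real.norm_eq_abs]
  refine (cutoff_div_lipschitz J _ _).trans (le_of_eq ?_)
  simp

/-- The truncations are uniformly bounded on sup norms and are eventually the identity on each
trigonometric polynomial; density of these concludes. -/
theorem tendsto_mulOp_cu (f : C(Torus, ℂ)) :
    Tendsto (fun J => mulOp (cu J) f) atTop (𝓝 f) := by
  have hL := one_le_lipC
  have hspan : ∀ g ∈ Submodule.span ℂ (range fou),
      Tendsto (fun J => mulOp (cu J) g) atTop (𝓝 g) := by
    intro g hg
    induction hg using Submodule.span_induction with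
    | mem g h =>
      obtain ⟨n, rfl⟩ := h
      obtain ⟨J, hJ⟩ := pow_unbounded_of_one_lt (n.natAbs) (one_lt_two : (1 : ℕ) < 2)
      refine tendsto_const_nhds.congr' ?_
      filter_upwards [eventually_ge_atTop J] with K hK
      rw [mulOp_eq (summable_cu K)]
      have h1 : HasSum (fun k => (cu K k * coefC k (fou n)) • fou k) (fou n) := by
        have h2 : (fun k => (cu K k * coefC k (fou n)) • fou k) = fun k =>
            if k = n then fou n else 0 := by
          funext k
          rw [coefC_fou]
          split_ifs with h
          · subst h
            rw [cu_eq_one, mul_one, one_smul]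
            have h4 : (2 : ℕ) ^ J ≤ 2 ^ K := Nat.pow_le_pow_right two_pos hK
            rw [Int.abs_eq_natAbs]
            exact_mod_cast hJ.le.trans h4
          · simp
        rw [h2]
        exact hasSum_ite_eq n (fou n)
      exact h1.unique (hasSum_trigSum (summable_norm_mul_coefC (summable_cu K) _))
    | zero => simp
    | add g h _ _ hg hh => simpa using hg.add hh
    | smul c g _ hg => simpa using hg.const_smul c
  have hdense : f ∈ closure (Submodule.span ℂ (range fou) : Set C(Torus, ℂ)) := by
    have h := span_fourier_closure_eq_top (T := 1)
    have h2 : f ∈ (Submodule.span ℂ (range fou)).topologicalClosure := by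
      change f ∈ (Submodule.span ℂ (range (fourier (T := 1)))).topologicalClosure
      rw [h]; trivial
    exact h2
  rw [Metric.tendsto_atTop]
  intro ε hε
  obtain ⟨g, hg, hfg⟩ := Metric.mem_closure_iff.1 hdense (ε / (4 * lipC + 2)) (by positivity)
  obtain ⟨J, hJ⟩ := Metric.tendsto_atTop.1 (hspan g hg) (ε / (4 * lipC + 2)) (by positivity)
  refine ⟨J, fun K hK => ?_⟩
  have h1 := hJ K hK
  rw [dist_eq_norm] at *
  have h2 := norm_mulOp_cu_le K (f - g)
  have e : mulOp (cu K) f - f = mulOp (cu K) (f - g) + (mulOp (cu K) g - g) - (f - g) := by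
    rw [map_sub]; abel
  have h3 : 4 * lipC * ‖f - g‖ < 4 * lipC * (ε / (4 * lipC + 2)) :=
    mul_lt_mul_of_pos_left hfg (by linarith)
  have h4 : 4 * lipC * (ε / (4 * lipC + 2)) + (ε / (4 * lipC + 2)) + (ε / (4 * lipC + 2)) = ε := by
    field_simp; ring
  rw [e]
  have h5 := norm_sub_le (mulOp (cu K) (f - g) + (mulOp (cu K) g - g)) (f - g)
  have h6 := norm_add_le (mulOp (cu K) (f - g)) (mulOp (cu K) g - g)
  linarith

/-- The smooth frequency truncation at scale `2^J`. -/
def trunc (J : ℕ) : C(Torus, ℝ) →L[ℝ] C(Torus, ℝ) := mulR (cu J)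

theorem norm_trunc_le (J : ℕ) (f : C(Torus, ℝ)) : ‖trunc J f‖ ≤ 4 * lipC * ‖f‖ :=
  norm_mulR_le (norm_mulOp_cu_le J) f

theorem tendsto_trunc (f : C(Torus, ℝ)) : Tendsto (fun J => trunc J f) atTop (𝓝 f) := by
  have := (reC.continuous.tendsto _).comp (tendsto_mulOp_cu (toC f))
  rwa [reC_toC] at this

theorem trunc_eq_sum (J : ℕ) (f : C(Torus, ℝ)) :
    trunc J f = ∑ j ∈ Finset.range (J + 1), blk j f := by
  have h : cu J = fun n => ∑ j ∈ Finset.range (J + 1), dy j n := by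
    funext n; rw [sum_dy]
  rw [trunc, mulR_apply, h, mulOp_sum _ summable_dy]
  simp only [sum_apply, map_sum, blk, mulR_apply]

theorem norm_sub_trunc_le {δ : ℝ} (hδ : 0 < δ) {A : ℝ} {f : C(Torus, ℝ)}
    (h : ∀ j : ℕ, ‖blk j f‖ ≤ A * 2 ^ (-(δ * ((j : ℝ) - 1)))) (J : ℕ) :
    ‖f - trunc J f‖ ≤ A * (2 ^ (-(δ * J)) * (1 - 2 ^ (-δ))⁻¹) := by
  have hq : (2 : ℝ) ^ (-δ) < 1 := Real.rpow_lt_one_of_one_lt_of_neg one_lt_two (by linarith)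
  have hq0 : (0 : ℝ) < 2 ^ (-δ) := by positivity
  -- The bound of a single block already forces the constant to be nonnegative.
  have hA : 0 ≤ A := by
    by_contra hA
    have := (norm_nonneg _).trans (h 0)
    have h2 : (0 : ℝ) < 2 ^ (-(δ * (((0 : ℕ) : ℝ) - 1))) := by positivity
    nlinarith
  have hgeo := hasSum_geometric_of_lt_one hq0.le hq
  refine le_of_tendsto (((tendsto_trunc f).sub_const (trunc J f)).norm) ?_
  filter_upwards [eventually_ge_atTop J] with K hK
  obtain ⟨i, rfl⟩ := Nat.exists_eq_add_of_le hK
  rw [trunc_eq_sum, trunc_eq_sum, show J + i + 1 = J + 1 + i by ring, Finset.sum_range_add,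
    add_sub_cancel_left]
  refine (norm_sum_le _ _).trans ?_
  -- The block of index J+1+k has scale J+k, so the tail is geometric with first term 2^{-δJ}.
  have hterm : ∀ k ∈ Finset.range i, ‖blk (J + 1 + k) f‖ ≤
      A * 2 ^ (-(δ * J)) * (2 ^ (-δ)) ^ k := fun k _ => by
    refine (h _).trans (le_of_eq ?_)
    rw [mul_assoc, ← Real.rpow_natCast, ← Real.rpow_mul zero_le_two, ← Real.rpow_add two_pos]
    congr 2
    push_cast
    ring
  refine (Finset.sum_le_sum hterm).trans ?_
  rw [← Finset.mul_sum, ← mul_assoc]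
  gcongr
  exact (hgeo.summable.sum_le_tsum _ (fun _ _ => by positivity)).trans_eq hgeo.tsum_eq

/-- The embedding constant of `B^δ_{∞,∞}` into continuous functions. -/
def embC (δ : ℝ) : ℝ := 2 ^ δ + (1 - 2 ^ (-δ))⁻¹

theorem embC_pos {δ : ℝ} (hδ : 0 < δ) : 0 < embC δ := by
  have hq : (2 : ℝ) ^ (-δ) < 1 := Real.rpow_lt_one_of_one_lt_of_neg one_lt_two (by linarith)
  have : 0 < (1 - (2 : ℝ) ^ (-δ))⁻¹ := inv_pos.2 (by linarith)
  unfold embC; positivity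

/-- The block of index 0, of scale -1, contributes 2^δ; the geometric tail contributes the rest of
`embC δ`. -/
theorem norm_le_of_blk {δ : ℝ} (hδ : 0 < δ) {A : ℝ} {f : C(Torus, ℝ)}
    (h : ∀ j : ℕ, ‖blk j f‖ ≤ A * 2 ^ (-(δ * ((j : ℝ) - 1)))) : ‖f‖ ≤ embC δ * A := by
  have h1 := norm_sub_trunc_le hδ h 0
  have h2 := h 0
  have h3 : trunc 0 f = blk 0 f := by simp [trunc_eq_sum]
  rw [h3] at h1
  have h4 : ‖f‖ ≤ ‖f - blk 0 f‖ + ‖blk 0 f‖ := by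
    simpa using norm_add_le (f - blk 0 f) (blk 0 f)
  simp only [Nat.cast_zero, zero_sub, mul_neg, mul_one, neg_neg, mul_zero, neg_zero,
    Real.rpow_zero, one_mul] at h1 h2
  unfold embC
  linarith

theorem norm_le_of_hbNorm {δ : ℝ} (hδ : 0 < δ) {f : C(Torus, ℝ)} (hf : hbNorm δ f ≠ ⊤) :
    ‖f‖ ≤ embC δ * (hbNorm δ f).toReal :=
  norm_le_of_blk hδ ((hbNorm_le_iff ENNReal.toReal_nonneg).1 (ENNReal.ofReal_toReal hf).symm.le)

/-- Interpolation between the sup norm and the norm of `B^β_{∞,∞}`. -/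
theorem blk_interpolation {α β B b : ℝ} (hα : 0 < α) (hαβ : α < β) {f : C(Torus, ℝ)}
    (h : ∀ j : ℕ, ‖blk j f‖ ≤ B * 2 ^ (-(β * ((j : ℝ) - 1)))) (hb : ‖f‖ ≤ b) (j : ℕ) :
    ‖blk j f‖ ≤ B ^ (α / β) * (bernC * b) ^ (1 - α / β) * 2 ^ (-(α * ((j : ℝ) - 1))) := by
  have hβ : 0 < β := hα.trans hαβ
  have hB : 0 ≤ B := by
    by_contra hB
    have := (norm_nonneg _).trans (h 0)
    have h2 : (0 : ℝ) < 2 ^ (-(β * (((0 : ℕ) : ℝ) - 1))) := by positivity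
    nlinarith
  have h0 : 0 ≤ ‖blk j f‖ := norm_nonneg _
  have hθ : 0 < 1 - α / β := by rw [sub_pos, div_lt_one hβ]; exact hαβ
  -- One factor takes the decay from regularity β, the other the smallness of the sup norm.
  have e1 : ‖blk j f‖ = ‖blk j f‖ ^ (α / β) * ‖blk j f‖ ^ (1 - α / β) := by
    rw [← Real.rpow_add_of_nonneg h0 (by positivity) hθ.le]
    simp
  have e2 : (B * (2 : ℝ) ^ (-(β * ((j : ℝ) - 1)))) ^ (α / β) =
      B ^ (α / β) * 2 ^ (-(α * ((j : ℝ) - 1))) := by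
    rw [Real.mul_rpow hB (by positivity), ← Real.rpow_mul zero_le_two]
    congr 2
    field_simp
  have h2 : ‖blk j f‖ ≤ bernC * b := (norm_blk_le j f).trans (by
    have := bernC_pos; gcongr)
  rw [e1]
  calc _ ≤ (B * (2 : ℝ) ^ (-(β * ((j : ℝ) - 1)))) ^ (α / β) * (bernC * b) ^ (1 - α / β) := by
        gcongr
        exact h j
    _ = _ := by rw [e2]; ring

/-! ### The heat semigroup on dyadic blocks -/

/-- The real symbol of the heat semigroup. -/
def heR (t : ℝ) (n : ℤ) : ℝ := Real.exp (-4 * Real.pi ^ 2 * (n : ℝ) ^ 2 * t)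

/-- The symbol of the heat semigroup. -/
def he (t : ℝ) (n : ℤ) : ℂ := (heR t n : ℂ)

/-- The symbol of `∂ₓ`. -/
def dx (n : ℤ) : ℂ := 2 * Real.pi * Complex.I * n

theorem norm_dx (n : ℤ) : ‖dx n‖ = 2 * Real.pi * |(n : ℝ)| := by
  simp [dx, abs_of_pos Real.pi_pos]

theorem herm_he (t : ℝ) : Herm (he t) := by
  intro n
  rw [he, he, Complex.conj_ofReal]
  simp [heR]

theorem heR_pos (t : ℝ) (n : ℤ) : 0 < heR t n := Real.exp_pos _

theorem herm_dx : Herm dx := by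
  intro n
  simp only [dx, map_mul, Complex.conj_I, Complex.conj_ofReal, map_ofNat, map_intCast]
  push_cast
  ring

theorem heR_le_one {t : ℝ} (ht : 0 ≤ t) (n : ℤ) : heR t n ≤ 1 := by
  rw [heR, Real.exp_le_one_iff]
  have : 0 ≤ 4 * Real.pi ^ 2 * (n : ℝ) ^ 2 * t := by positivity
  linarith

theorem exp_neg_le_rpow {y κ : ℝ} (hy : 0 < y) (h0 : 0 ≤ κ) (h1 : κ ≤ 1) :
    Real.exp (-y) ≤ y ^ (-κ) := by
  rw [Real.exp_neg, Real.rpow_neg hy.le]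
  refine inv_anti₀ (by positivity) ?_
  have h2 := Real.add_one_le_exp y
  rcases le_total y 1 with h | h
  · linarith [Real.rpow_le_one hy.le h h0]
  · have : y ^ κ ≤ y ^ (1 : ℝ) := Real.rpow_le_rpow_of_exponent_le h h1
    rw [Real.rpow_one] at this
    linarith

/-- Half of the exponential absorbs the factor y, the other half gives the power. -/
theorem mul_exp_neg_le_rpow {y κ : ℝ} (hy : 0 < y) (h0 : 0 ≤ κ) (h1 : κ ≤ 1) :
    y * Real.exp (-y) ≤ 4 * y ^ (-κ) := by
  have e1 : Real.exp (-y) = Real.exp (-(y / 2)) * Real.exp (-(y / 2)) := by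
    rw [← Real.exp_add]; congr 1; ring
  have e2 : y * Real.exp (-(y / 2)) ≤ 2 := by
    have := Real.add_one_le_exp (y / 2)
    have h3 : Real.exp (y / 2) * Real.exp (-(y / 2)) = 1 := by rw [← Real.exp_add]; simp
    have h4 := Real.exp_pos (-(y / 2))
    nlinarith
  have e3 := exp_neg_le_rpow (half_pos hy) h0 h1
  have e4 : (y / 2) ^ (-κ) ≤ 2 * y ^ (-κ) := by
    rw [Real.div_rpow hy.le zero_le_two, Real.rpow_neg zero_le_two, div_inv_eq_mul, mul_comm]
    gcongr
    calc (2 : ℝ) ^ κ ≤ 2 ^ (1 : ℝ) := Real.rpow_le_rpow_of_exponent_le one_le_two h1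
      _ = 2 := Real.rpow_one 2
  rw [e1, ← mul_assoc]
  calc _ ≤ 2 * (2 * y ^ (-κ)) := by
        refine mul_le_mul e2 (e3.trans e4) (Real.exp_pos _).le zero_le_two
    _ = _ := by ring

/-- On the annulus |n| ≥ 2^{j-1}, hence 4π²n² ≥ 4^j. The index 0 is excluded because its annulus
contains the zero frequency, which does not decay. -/
theorem heR_le_exp {j : ℕ} {n : ℤ} (hj : j ≠ 0) (hn : n ∈ annulus j) {t : ℝ} (ht : 0 ≤ t) :
    heR t n ≤ Real.exp (-(4 ^ j * t)) := by
  obtain ⟨i, rfl⟩ := Nat.exists_eq_succ_of_ne_zero hj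
  have h1 : (2 : ℤ) ^ i ≤ |n| := by
    have := hn.2
    rw [Nat.succ_eq_add_one, pow_succ] at this
    omega
  have h2 : (2 : ℝ) ^ i ≤ |(n : ℝ)| := by exact_mod_cast h1
  have h3 : ((2 : ℝ) ^ i) ^ 2 ≤ (n : ℝ) ^ 2 := by
    rw [← sq_abs (n : ℝ)]
    exact pow_le_pow_left₀ (by positivity) h2 2
  have h4 : (4 : ℝ) ^ (i + 1) = 4 * ((2 : ℝ) ^ i) ^ 2 := by
    rw [pow_succ, ← pow_mul, mul_comm i 2, pow_mul]; norm_num; ring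
  rw [heR, Real.exp_le_exp, Nat.succ_eq_add_one, h4]
  have h5 : 1 ≤ Real.pi ^ 2 := by nlinarith [Real.pi_gt_three]
  have h6 : ((2 : ℝ) ^ i) ^ 2 * t ≤ Real.pi ^ 2 * (n : ℝ) ^ 2 * t := by
    gcongr
    nlinarith [sq_nonneg (n : ℝ)]
  nlinarith

theorem abs_exp_neg_sub_le {a b : ℝ} {E : ℝ} (ha : Real.exp (-a) ≤ E) (hb : Real.exp (-b) ≤ E) :
    |Real.exp (-a) - Real.exp (-b)| ≤ |a - b| * E := by
  wlog h : a ≤ b generalizing a b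
  · rw [abs_sub_comm, abs_sub_comm a b]
    exact this hb ha (not_le.1 h).le
  have h1 : Real.exp (-b) = Real.exp (-a) * Real.exp (-(b - a)) := by
    rw [← Real.exp_add]; congr 1; ring
  have h2 := Real.add_one_le_exp (-(b - a))
  have h3 : Real.exp (-b) ≤ Real.exp (-a) := Real.exp_le_exp.2 (by linarith)
  rw [abs_of_nonneg (by linarith), abs_sub_comm, abs_of_nonneg (by linarith), h1]
  have h4 := Real.exp_pos (-a)
  nlinarith [mul_le_mul_of_nonneg_right ha (sub_nonneg.2 h)]

/-- The size of the heat symbol on the annulus of index `j`. -/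
def hB (T κ : ℝ) (j : ℕ) (t : ℝ) : ℝ := 1024 * (1 + T) * (4 ^ j * t) ^ (-κ)

theorem hB_pos {T κ t : ℝ} (hT : 0 ≤ T) (ht : 0 < t) (j : ℕ) : 0 < hB T κ j t := by
  unfold hB; positivity

/-- Serves the block of index 0, where the symbol is only bounded by 1 while t^{-κ} is small for
large t. This is the origin of the factor 1 + T in `hB`. -/
theorem one_le_rpow_bound {T κ t : ℝ} (ht : 0 < t) (htT : t ≤ T) (h0 : 0 ≤ κ) (h1 : κ ≤ 1) :
    1 ≤ (1 + T) * t ^ (-κ) := by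
  have h2 : t ^ κ ≤ 1 + T := by
    rcases le_total t 1 with h | h
    · linarith [Real.rpow_le_one ht.le h h0]
    · have : t ^ κ ≤ t ^ (1 : ℝ) := Real.rpow_le_rpow_of_exponent_le h h1
      rw [Real.rpow_one] at this
      linarith
  rw [Real.rpow_neg ht.le, ← div_eq_mul_inv, le_div_iff₀ (by positivity)]
  linarith

theorem norm_he_le {T κ t : ℝ} (ht : 0 < t) (htT : t ≤ T) (h0 : 0 ≤ κ) (h1 : κ ≤ 1) {j : ℕ} {n : ℤ}
    (hn : n ∈ annulus j) : ‖he t n‖ ≤ hB T κ j t := by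
  rw [he, Complex.norm_real, Real.norm_eq_abs, abs_of_pos (heR_pos t n), hB]
  rcases eq_or_ne j 0 with rfl | hj
  · have := heR_le_one ht.le n
    have h2 := one_le_rpow_bound ht htT h0 h1
    rw [pow_zero, one_mul]
    linarith
  · have h2 := heR_le_exp hj hn ht.le
    have h3 := exp_neg_le_rpow (by positivity : 0 < 4 ^ j * t) h0 h1
    have h4 : 0 < (4 ^ j * t) ^ (-κ) := by positivity
    have : 0 < T := ht.trans_le htT
    have h5 : (4 ^ j * t) ^ (-κ) ≤ 1024 * (1 + T) * (4 ^ j * t) ^ (-κ) :=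
      le_mul_of_one_le_left h4.le (by linarith)
    linarith

/-- Consecutive exponents differ by 4π²t(2n+1), at most 256 · 4^j t / 2^j on the annulus, and y
e^{-y} ≤ 4y^{-κ} with y = 4^j t; this explains 1024. -/
theorem norm_he_sub_le {T κ t : ℝ} (ht : 0 < t) (htT : t ≤ T) (h0 : 0 ≤ κ) (h1 : κ ≤ 1) {j : ℕ}
    {n : ℤ} (hn : n ∈ annulus j) (hn' : n + 1 ∈ annulus j) :
    ‖he t (n + 1) - he t n‖ ≤ hB T κ j t / 2 ^ j := by
  have hT : 0 < T := ht.trans_le htT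
  rw [he, he, ← Complex.ofReal_sub, Complex.norm_real, Real.norm_eq_abs, hB]
  rcases eq_or_ne j 0 with rfl | hj
  · have a1 := heR_le_one ht.le n
    have a2 := heR_le_one ht.le (n + 1)
    have a3 : 0 < heR t n := Real.exp_pos _
    have a4 : 0 < heR t (n + 1) := Real.exp_pos _
    have h2 := one_le_rpow_bound ht htT h0 h1
    rw [pow_zero, one_mul, pow_zero, div_one]
    rw [abs_le]
    constructor <;> linarith
  · have a1 := heR_le_exp hj hn ht.le
    have a2 := heR_le_exp hj hn' ht.le
    have e : ∀ k : ℤ, heR t k = Real.exp (-(4 * Real.pi ^ 2 * (k : ℝ) ^ 2 * t)) := fun k => by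
      rw [heR]; congr 1; ring
    rw [e] at a1 a2
    rw [e, e]
    refine (abs_exp_neg_sub_le a2 a1).trans ?_
    have h3 := mul_exp_neg_le_rpow (by positivity : 0 < 4 ^ j * t) h0 h1
    have h4 : 0 < (4 ^ j * t) ^ (-κ) := by positivity
    have h5 : |2 * (n : ℝ) + 1| ≤ 4 * 2 ^ j := by
      have b1 : |(n : ℝ)| ≤ 2 ^ (j + 1) := by exact_mod_cast hn.1
      have b2 : |(n : ℝ) + 1| ≤ 2 ^ (j + 1) := by exact_mod_cast hn'.1
      rw [show 2 * (n : ℝ) + 1 = n + (n + 1) by ring]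
      refine (abs_add_le _ _).trans ?_
      rw [pow_succ] at b1 b2
      linarith
    have h6 : 4 * Real.pi ^ 2 * (((n + 1 : ℤ) : ℝ)) ^ 2 * t - 4 * Real.pi ^ 2 * (n : ℝ) ^ 2 * t =
        4 * Real.pi ^ 2 * t * (2 * n + 1) := by push_cast; ring
    rw [h6, abs_mul, abs_of_pos (by positivity : 0 < 4 * Real.pi ^ 2 * t)]
    have h7 : Real.pi ^ 2 ≤ 16 := by nlinarith [Real.pi_lt_four, Real.pi_pos]
    have h8 : (4 : ℝ) ^ j = 2 ^ j * 2 ^ j := by rw [← mul_pow]; norm_num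
    rw [le_div_iff₀ (by positivity)]
    calc 4 * Real.pi ^ 2 * t * |2 * (n : ℝ) + 1| * Real.exp (-(4 ^ j * t)) * 2 ^ j
        ≤ 4 * 16 * t * (4 * 2 ^ j) * Real.exp (-(4 ^ j * t)) * 2 ^ j := by gcongr
      _ = 256 * ((4 ^ j * t) * Real.exp (-(4 ^ j * t))) := by rw [h8]; ring
      _ ≤ 256 * (4 * (4 ^ j * t) ^ (-κ)) := by gcongr
      _ ≤ 1024 * (1 + T) * (4 ^ j * t) ^ (-κ) := by nlinarith

theorem norm_mulOp_dy_he_le {T κ t : ℝ} (ht : 0 < t) (htT : t ≤ T) (h0 : 0 ≤ κ) (h1 : κ ≤ 1)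
    (j : ℕ) (f : C(Torus, ℂ)) :
    ‖mulOp (fun n => dy j n * he t n) f‖ ≤ bernC * hB T κ j t * ‖f‖ :=
  norm_mulOp_dy_le (hB_pos (ht.le.trans htT) ht j).le
    (fun _ hn => norm_he_le ht htT h0 h1 hn) (fun _ hn hn' => norm_he_sub_le ht htT h0 h1 hn hn') f

theorem norm_dx_le_of_mem {j : ℕ} {n : ℤ} (hn : n ∈ annulus j) :
    ‖dx n‖ ≤ 4 * Real.pi * 2 ^ j := by
  have b1 : |(n : ℝ)| ≤ 2 ^ (j + 1) := by exact_mod_cast hn.1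
  rw [norm_dx]
  calc _ ≤ 2 * Real.pi * 2 ^ (j + 1) := by gcongr
    _ = _ := by rw [pow_succ]; ring

/-- The derivative costs 2^j, and its symbol is linear in n, so the product rule keeps the gain
2^{-j} of each difference. -/
theorem norm_mulOp_dy_dx_he_le {T κ t : ℝ} (ht : 0 < t) (htT : t ≤ T) (h0 : 0 ≤ κ) (h1 : κ ≤ 1)
    (j : ℕ) (f : C(Torus, ℂ)) :
    ‖mulOp (fun n => dy j n * (dx n * he t n)) f‖ ≤
      bernC * (24 * 2 ^ j * hB T κ j t) * ‖f‖ := by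
  have hp := hB_pos (κ := κ) (ht.le.trans htT) ht j
  have hpi := Real.pi_lt_four
  refine norm_mulOp_dy_le (by positivity) (fun n hn => ?_) (fun n hn hn' => ?_) f
  · rw [norm_mul]
    calc _ ≤ 4 * Real.pi * 2 ^ j * hB T κ j t :=
          mul_le_mul (norm_dx_le_of_mem hn) (norm_he_le ht htT h0 h1 hn) (norm_nonneg _)
            (by positivity)
      _ ≤ 4 * 4 * 2 ^ j * hB T κ j t := by gcongr
      _ ≤ _ := by
        gcongr
        norm_num
  · have e : dx (n + 1) * he t (n + 1) - dx n * he t n =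
        dx (n + 1) * (he t (n + 1) - he t n) + dx 1 * he t n := by
      simp only [dx]; push_cast; ring
    rw [e]
    refine (norm_add_le _ _).trans ?_
    rw [norm_mul, norm_mul]
    have h3 : ‖dx 1‖ = 2 * Real.pi := by simp [norm_dx]
    calc _ ≤ 4 * Real.pi * 2 ^ j * (hB T κ j t / 2 ^ j) + 2 * Real.pi * hB T κ j t := by
          refine add_le_add (mul_le_mul (norm_dx_le_of_mem hn') (norm_he_sub_le ht htT h0 h1 hn hn')
            (norm_nonneg _) (by positivity)) ?_
          rw [h3]
          gcongr
          exact norm_he_le ht htT h0 h1 hn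
      _ = 6 * Real.pi * hB T κ j t := by field_simp; ring
      _ ≤ 6 * 4 * hB T κ j t := by gcongr
      _ = _ := by field_simp; norm_num

/-! ### The operator `e^{tΔ} ∂ₓ` -/

/-- The symbol of `e^{tΔ} ∂ₓ`. -/
def ker (t : ℝ) (n : ℤ) : ℂ := dx n * he t n

theorem herm_ker (t : ℝ) : Herm (ker t) := herm_dx.mul (herm_he t)

theorem summable_pow_mul_heR {t : ℝ} (ht : 0 < t) (N : ℕ) :
    Summable fun n : ℤ => (1 + |(n : ℝ)|) ^ N * heR t n := by
  have h1 : Summable fun n : ℕ => (1 + (n : ℝ)) ^ N * Real.exp (-4 * Real.pi ^ 2 * (n : ℝ) ^ 2 * t) := by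
    have h2 := Real.summable_pow_mul_exp_neg_nat_mul N (r := 4 * Real.pi ^ 2 * t) (by positivity)
    have h3 := (summable_nat_add_iff 1).2 h2
    refine Summable.of_nonneg_of_le (fun n => by positivity) (fun n => ?_)
      (h3.mul_left (Real.exp (4 * Real.pi ^ 2 * t)))
    rw [mul_left_comm, ← Real.exp_add]
    push_cast
    rw [add_comm (1 : ℝ)]
    refine mul_le_mul_of_nonneg_left (Real.exp_le_exp.2 ?_) (by positivity)
    have h4 : (n : ℝ) ≤ (n : ℝ) ^ 2 := by exact_mod_cast Nat.le_self_pow two_ne_zero n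
    have h5 : 4 * Real.pi ^ 2 * t * n ≤ 4 * Real.pi ^ 2 * t * (n : ℝ) ^ 2 := by gcongr
    linarith
  refine Summable.of_nat_of_neg ?_ ?_
  · simpa [heR] using h1
  · simpa [heR] using h1

theorem norm_he (t : ℝ) (n : ℤ) : ‖he t n‖ = heR t n := by
  rw [he, Complex.norm_real, Real.norm_eq_abs, abs_of_pos (heR_pos t n)]

theorem norm_ker_le (t : ℝ) (n : ℤ) : ‖ker t n‖ ≤ 2 * Real.pi * ((1 + |(n : ℝ)|) ^ 1 * heR t n) := by
  rw [ker, norm_mul, norm_dx, norm_he, pow_one, mul_assoc]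
  have : 0 < heR t n := Real.exp_pos _
  gcongr
  linarith

theorem summable_ker {t : ℝ} (ht : 0 < t) : Summable fun n => ‖ker t n‖ :=
  Summable.of_nonneg_of_le (fun _ => norm_nonneg _) (norm_ker_le t)
    ((summable_pow_mul_heR ht 1).mul_left _)

/-- The operator `e^{tΔ} ∂ₓ` on continuous functions. -/
def hk (t : ℝ) : C(Torus, ℝ) →L[ℝ] C(Torus, ℝ) := mulR (ker t)

theorem blk_hk {t : ℝ} (ht : 0 < t) (j : ℕ) (f : C(Torus, ℝ)) :
    blk j (hk t f) = mulR (fun n => dy j n * ker t n) f :=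
  mulR_mulR (summable_dy j) (summable_ker ht) (herm_ker t) f

/-- The constant of the smoothing estimates. -/
def smC (T : ℝ) : ℝ := bernC * (24 * (1024 * (1 + T))) * 16

theorem smC_pos {T : ℝ} (hT : 0 ≤ T) : 0 < smC T := by
  have := bernC_pos
  unfold smC; positivity

/-- Parabolic scaling: with κ = (c + β)/2 the heat factor pays for the loss of c derivatives and
leaves β derivatives of regularity. -/
theorem rpow_scale {t β : ℝ} (ht : 0 < t) (j : ℕ) (c : ℝ) :
    (2 : ℝ) ^ (c * j) * (4 ^ j * t) ^ (-((c + β) / 2)) =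
      t ^ (-((c + β) / 2)) * 2 ^ (-(β * j)) := by
  have h4 : (4 : ℝ) ^ j = 2 ^ ((2 : ℝ) * j) := by
    rw [Real.rpow_mul zero_le_two, Real.rpow_natCast]; norm_num
  rw [Real.mul_rpow (by positivity) ht.le, h4, ← Real.rpow_mul zero_le_two, ← mul_assoc,
    ← Real.rpow_add two_pos, mul_comm]
  congr 2
  ring

/-- Index j stands for scale j - 1; passing between the two normalisations costs a factor 2. -/
theorem two_rpow_shift {β : ℝ} (hβ : -1 ≤ β) (j : ℕ) :
    (2 : ℝ) ^ (-(β * j)) ≤ 2 * 2 ^ (-(β * ((j : ℝ) - 1))) := by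
  have : (2 : ℝ) * 2 ^ (-(β * ((j : ℝ) - 1))) = 2 ^ (1 + -(β * ((j : ℝ) - 1))) := by
    rw [Real.rpow_add two_pos, Real.rpow_one]
  rw [this]
  exact Real.rpow_le_rpow_of_exponent_le one_le_two (by linarith)

/-- Parabolic smoothing: one derivative and β units of regularity cost t^{-(1+β)/2}. The constant
`smC` has slack so that it serves the other smoothing estimates too. -/
theorem norm_blk_hk_le {T β t : ℝ} (ht : 0 < t) (htT : t ≤ T) (h0 : 0 ≤ β) (h1 : β ≤ 1)
    (j : ℕ) (f : C(Torus, ℝ)) :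
    ‖blk j (hk t f)‖ ≤ smC T * t ^ (-((1 + β) / 2)) * ‖f‖ * 2 ^ (-(β * ((j : ℝ) - 1))) := by
  have hb := bernC_pos
  have hT : 0 < T := ht.trans_le htT
  rw [blk_hk ht]
  refine (norm_mulR_le (norm_mulOp_dy_dx_he_le (κ := (1 + β) / 2) ht htT (by linarith)
    (by linarith) j) f).trans ?_
  have e := rpow_scale (β := β) ht j 1
  have e2 := two_rpow_shift (by linarith : -1 ≤ β) j
  rw [one_mul, Real.rpow_natCast] at e
  calc bernC * (24 * 2 ^ j * hB T ((1 + β) / 2) j t) * ‖f‖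
      = bernC * (24 * (1024 * (1 + T))) * (2 ^ j * (4 ^ j * t) ^ (-((1 + β) / 2))) * ‖f‖ := by
        rw [hB]; ring
    _ = bernC * (24 * (1024 * (1 + T))) * (t ^ (-((1 + β) / 2)) * 2 ^ (-(β * j))) * ‖f‖ := by
        rw [e]
    _ ≤ bernC * (24 * (1024 * (1 + T))) *
        (t ^ (-((1 + β) / 2)) * (2 * 2 ^ (-(β * ((j : ℝ) - 1))))) * ‖f‖ := by gcongr
    _ ≤ bernC * (24 * (1024 * (1 + T))) *
        (t ^ (-((1 + β) / 2)) * (16 * 2 ^ (-(β * ((j : ℝ) - 1))))) * ‖f‖ := by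
        gcongr; norm_num
    _ = _ := by rw [smC]; ring

theorem norm_hk_le {T δ t : ℝ} (ht : 0 < t) (htT : t ≤ T) (h0 : 0 < δ) (h1 : δ ≤ 1)
    (f : C(Torus, ℝ)) : ‖hk t f‖ ≤ embC δ * smC T * t ^ (-((1 + δ) / 2)) * ‖f‖ := by
  refine (norm_le_of_blk h0 (norm_blk_hk_le ht htT h0.le h1 · f)).trans (le_of_eq ?_)
  ring

/-! ### The `L²` norm -/

/-- The square of the `L²` norm. -/
def l2sq (f : C(Torus, ℝ)) : ℝ := ∫ t, f t ^ 2 ∂(haarAddCircle : Measure Torus)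

theorem l2sq_nonneg (f : C(Torus, ℝ)) : 0 ≤ l2sq f := integral_nonneg fun _ => sq_nonneg _

theorem sum_sq_coefC_le (f : C(Torus, ℝ)) (s : Finset ℤ) :
    ∑ n ∈ s, ‖coefC n (toC f)‖ ^ 2 ≤ l2sq f := by
  have h := hasSum_sq_coefC (toC f)
  have h2 : ∫ t, ‖toC f t‖ ^ 2 ∂(haarAddCircle : Measure Torus) = l2sq f := by
    simp [l2sq]
  rw [h2] at h
  exact sum_le_hasSum s (fun _ _ => sq_nonneg _) h

/-- Instead of a kernel bound, Cauchy--Schwarz over the 4 · 2^j active modes and Parseval: passing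
from L² to L^∞ costs 2^{j/2}, hence 3/2 in place of 1 in the time singularity. -/
theorem norm_blk_hk_le_l2 {T δ t : ℝ} (ht : 0 < t) (htT : t ≤ T) (h0 : 0 ≤ δ) (h1 : δ ≤ 1 / 2)
    (j : ℕ) (f : C(Torus, ℝ)) :
    ‖blk j (hk t f)‖ ≤
      smC T * t ^ (-((3 / 2 + δ) / 2)) * √(l2sq f) * 2 ^ (-(δ * ((j : ℝ) - 1))) := by
  have hb := bernC_pos
  have hT : 0 < T := ht.trans_le htT
  set κ := (3 / 2 + δ) / 2 with hκ
  have hp := hB_pos (κ := κ) hT.le ht j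
  rw [blk_hk ht, mulR_apply]
  have hs := summable_dy_mul j (ker t)
  set s := Finset.Ico (-(2 : ℤ) ^ (j + 1)) (2 ^ (j + 1)) with hsdef
  have hcard : (s.card : ℝ) = 4 * 2 ^ j := by
    rw [hsdef, Int.card_Ico, sub_neg_eq_add]
    have : ((2 : ℤ) ^ (j + 1) + 2 ^ (j + 1)).toNat = 4 * 2 ^ j := by
      zify
      rw [Int.toNat_of_nonneg (by positivity), pow_succ]
      ring
    rw [this]; push_cast; ring
  have hz : ∀ n ∉ s, dy j n = 0 := fun n hn => dy_eq_zero <| by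
    by_contra h
    rw [not_le, abs_lt] at h
    exact hn (Finset.mem_Ico.2 ⟨h.1.le, h.2⟩)
  have hterm : ∀ n, ‖dy j n * ker t n * coefC n (toC f)‖ ≤
      (16 * 2 ^ j * hB T κ j t) * ‖coefC n (toC f)‖ := fun n => by
    rw [norm_mul]
    gcongr
    by_cases h : dy j n = 0
    · rw [h, zero_mul, norm_zero]; positivity
    · have hn := mem_annulus_of_ne_zero h
      rw [ker, norm_mul, norm_mul]
      have hpi := Real.pi_lt_four
      calc _ ≤ 1 * (4 * Real.pi * 2 ^ j * hB T κ j t) := by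
            refine mul_le_mul (norm_dy_le j n) ?_ (by positivity) zero_le_one
            exact mul_le_mul (norm_dx_le_of_mem hn) (norm_he_le ht htT (by linarith)
              (by linarith) hn) (norm_nonneg _) (by positivity)
        _ ≤ 1 * (4 * 4 * 2 ^ j * hB T κ j t) := by gcongr
        _ = _ := by ring
  have hcs : ∑ n ∈ s, ‖coefC n (toC f)‖ ≤ 2 * 2 ^ ((1 / 2 : ℝ) * j) * √(l2sq f) := by
    have h2 := sq_sum_le_card_mul_sum_sq (s := s) (f := fun n => ‖coefC n (toC f)‖)
    have h3 := sum_sq_coefC_le f s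
    refine abs_le_of_sq_le_sq' ?_ (by positivity) |>.2
    refine h2.trans ?_
    rw [mul_pow, mul_pow, Real.sq_sqrt (l2sq_nonneg f), hcard, ← Real.rpow_natCast (2 ^ _) 2,
      ← Real.rpow_mul zero_le_two]
    have e : (1 / 2 : ℝ) * j * (2 : ℕ) = j := by push_cast; ring
    rw [e, Real.rpow_natCast]
    norm_num
    gcongr
  rw [mulOp_eq hs]
  have hts := norm_trigSum_le (summable_norm_mul_coefC hs (toC f))
  rw [tsum_eq_sum (s := s) fun n hn => by rw [hz n hn]; simp] at hts
  refine (norm_reC_le _).trans (hts.trans ?_)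
  refine (Finset.sum_le_sum fun n _ => hterm n).trans ?_
  rw [← Finset.mul_sum]
  have e := rpow_scale (β := δ) ht j (3 / 2)
  have e2 := two_rpow_shift (by linarith : -1 ≤ δ) j
  have e3 : (2 : ℝ) ^ j * 2 ^ ((1 / 2 : ℝ) * j) = 2 ^ ((3 / 2 : ℝ) * j) := by
    rw [← Real.rpow_natCast, ← Real.rpow_add two_pos]; congr 1; ring
  have hbern : 4 ≤ bernC := by
    have := one_le_lipC
    unfold bernC; linarith
  calc 16 * 2 ^ j * hB T κ j t * ∑ n ∈ s, ‖coefC n (toC f)‖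
      ≤ 16 * 2 ^ j * hB T κ j t * (2 * 2 ^ ((1 / 2 : ℝ) * j) * √(l2sq f)) := by gcongr
    _ = 32 * (1024 * (1 + T)) * ((2 ^ j * 2 ^ ((1 / 2 : ℝ) * j)) * (4 ^ j * t) ^ (-κ)) *
        √(l2sq f) := by rw [hB]; ring
    _ = 32 * (1024 * (1 + T)) * (t ^ (-κ) * 2 ^ (-(δ * j))) * √(l2sq f) := by rw [e3, hκ, e]
    _ ≤ 32 * (1024 * (1 + T)) * (t ^ (-κ) * (2 * 2 ^ (-(δ * ((j : ℝ) - 1))))) * √(l2sq f) := by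
        gcongr
    _ = 4 * (24 * (1024 * (1 + T))) * (2 / 3) * t ^ (-κ) * √(l2sq f) *
        2 ^ (-(δ * ((j : ℝ) - 1))) := by ring
    _ ≤ bernC * (24 * (1024 * (1 + T))) * 16 * t ^ (-κ) * √(l2sq f) *
        2 ^ (-(δ * ((j : ℝ) - 1))) := by
        gcongr
        norm_num
    _ = _ := by rw [smC]

theorem norm_hk_le_l2 {T δ t : ℝ} (ht : 0 < t) (htT : t ≤ T) (h0 : 0 < δ) (h1 : δ ≤ 1 / 2)
    (f : C(Torus, ℝ)) : ‖hk t f‖ ≤ embC δ * smC T * t ^ (-((3 / 2 + δ) / 2)) * √(l2sq f) := by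
  refine (norm_le_of_blk h0 (norm_blk_hk_le_l2 ht htT h0.le h1 · f)).trans (le_of_eq ?_)
  ring

/-! ### The heat flow of a distribution -/

theorem summable_he_mul (u : PeriodicDist) {t : ℝ} (ht : 0 < t) :
    Summable fun n => ‖he t n * fourierCoef u n‖ := by
  obtain ⟨N, C, hC, h⟩ := exists_fourierCoef_bound u
  refine Summable.of_nonneg_of_le (fun _ => norm_nonneg _) (fun n => ?_)
    ((summable_pow_mul_heR ht N).mul_left C)
  rw [norm_mul, norm_he]
  have h1 : 0 < heR t n := Real.exp_pos _
  calc _ ≤ heR t n * (C * (1 + |(n : ℝ)|) ^ N) := by gcongr; exact h n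
    _ = _ := by ring

/-- The heat flow started from a distribution, as a continuous function. -/
def heatC (t : ℝ) (u : PeriodicDist) : C(Torus, ℝ) :=
  reC (trigSum fun n => he t n * fourierCoef u n)

theorem toC_heatC {t : ℝ} (ht : 0 < t) (u : PeriodicDist) :
    toC (heatC t u) = trigSum fun n => he t n * fourierCoef u n :=
  toC_reC_trigSum (summable_he_mul u ht) ((herm_he t).mul (herm_fourierCoef u))

theorem heat_eq {t : ℝ} (ht : 0 < t) (u : PeriodicDist) (x : ℝ) :
    heat t u x = heatC t u (x : Torus) := by
  have h := hasSum_trigSum_apply (summable_he_mul u ht) (x : Torus)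
  rw [heat, heatC, reC_apply, ← h.tsum_eq]
  simp only [fou_coe, he, heR]

/-- Replaces the scalar integrand in the definition of a mild solution by a bounded operator on
continuous functions. -/
theorem heat_distDeriv_eq {t : ℝ} (ht : 0 < t) (c : ℝ) (f : C(Torus, ℝ)) (x : ℝ) :
    heat t (c • distDeriv (toDist f)) x = hk t (c • f) (x : Torus) := by
  rw [heat_eq ht, heatC, hk, mulR_apply, mulOp_eq (summable_ker ht)]
  congr 3
  funext n
  rw [fourierCoef_smul, fourierCoef_distDeriv, fourierCoef_toDist, ker, dx]
  have : toC (c • f) = (c : ℂ) • toC f := by ext x; simp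
  rw [this, map_smul, smul_eq_mul]
  ring

theorem heatC_sub {t : ℝ} (ht : 0 < t) (u v : PeriodicDist) :
    heatC t (u - v) = heatC t u - heatC t v := by
  rw [heatC, heatC, heatC, ← map_sub]
  congr 1
  refine HasSum.unique (f := fun n => (he t n * fourierCoef (u - v) n) • fou n)
    (hasSum_trigSum (summable_he_mul _ ht)) ?_
  simp only [fourierCoef_sub, mul_sub, sub_smul]
  exact (hasSum_trigSum (summable_he_mul u ht)).sub (hasSum_trigSum (summable_he_mul v ht))

theorem dy_mul_dy_eq_zero {i j : ℕ} (h : i + 2 ≤ j) (n : ℤ) : dy i n * dy j n = 0 := by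
  obtain ⟨k, rfl⟩ : ∃ k, j = k + 1 := ⟨j - 1, by omega⟩
  by_cases hn : |n| ≤ 2 ^ k
  · rw [dy_succ_eq_zero hn, mul_zero]
  · rw [dy_eq_zero, zero_mul]
    refine le_trans (pow_le_pow_right₀ (by norm_num) (by omega)) (not_le.1 hn).le

/-- Almost orthogonality: only adjacent indices overlap. For j = 0 the truncated subtraction just
drops the missing neighbour. -/
theorem dy_eq_sum_dy_mul (j : ℕ) (n : ℤ) :
    dy j n = ∑ i ∈ Finset.Ico (j - 1) (j + 2), dy i n * dy j n := by
  have h1 : dy j n = ∑ i ∈ Finset.range (j + 2), dy i n * dy j n := by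
    rw [← Finset.sum_mul, sum_dy (j + 1)]
    by_cases h : dy j n = 0
    · rw [h, mul_zero]
    · rw [cu_eq_one (mem_annulus_of_ne_zero h).1, one_mul]
  conv_lhs => rw [h1]
  symm
  refine Finset.sum_subset (fun i hi => ?_) fun i hi hi' => ?_
  · rw [Finset.mem_Ico] at hi; exact Finset.mem_range.2 hi.2
  · rw [Finset.mem_range] at hi
    rw [Finset.mem_Ico] at hi'
    exact dy_mul_dy_eq_zero (by omega) n

/-- A distribution is known only through its blocks, so the heat symbol has to act on `dblk j u`
itself. The three neighbouring cut-offs localise it there without changing the result. -/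
theorem norm_blk_heatC_le {T κ t : ℝ} (ht : 0 < t) (htT : t ≤ T) (h0 : 0 ≤ κ) (h1 : κ ≤ 1)
    (u : PeriodicDist) (j : ℕ) :
    ‖blk j (heatC t u)‖ ≤ 12 * (bernC * (1024 * (1 + T))) * (4 ^ j * t) ^ (-κ) * ‖dblk j u‖ := by
  have hb := bernC_pos
  have hT : 0 < T := ht.trans_le htT
  have e1 : toC (blk j (heatC t u)) =
      ∑ i ∈ Finset.Ico (j - 1) (j + 2), mulOp (fun n => dy i n * he t n) (dblk j u) := by
    rw [blk, toC_mulR (summable_dy j) (herm_dy j), toC_heatC ht,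
      mulOp_trigSum (summable_dy j) (summable_he_mul u ht)]
    rw [← sum_apply, ← mulOp_sum _ (fun i => summable_dy_mul i (he t)), dblk,
      mulOp_trigSum _ (summable_dy_mul j _)]
    · congr 1
      funext n
      conv_lhs => rw [dy_eq_sum_dy_mul j n]
      rw [Finset.sum_mul, Finset.sum_mul]
      exact Finset.sum_congr rfl fun i _ => by ring
    · refine Summable.of_nonneg_of_le (fun _ => norm_nonneg _) (fun n => norm_sum_le _ _)
        (summable_sum fun i _ => summable_dy_mul i (he t))
  rw [← norm_toC, e1]
  refine (norm_sum_le _ _).trans ?_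
  have hterm : ∀ i ∈ Finset.Ico (j - 1) (j + 2),
      ‖mulOp (fun n => dy i n * he t n) (dblk j u)‖ ≤
        4 * (bernC * (1024 * (1 + T))) * (4 ^ j * t) ^ (-κ) * ‖dblk j u‖ := fun i hi => by
    refine (norm_mulOp_dy_he_le (κ := κ) ht htT h0 h1 i _).trans ?_
    rw [hB]
    have h3 : (4 ^ i * t) ^ (-κ) ≤ 4 * (4 ^ j * t) ^ (-κ) := by
      rw [Finset.mem_Ico] at hi
      have h4 : (4 : ℝ) ^ j ≤ 4 ^ i * 4 := by
        rw [← pow_succ]; exact pow_le_pow_right₀ (by norm_num) (by omega)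
      have h5 : 4 ^ j * t / 4 ≤ 4 ^ i * t := by
        rw [div_le_iff₀ (by norm_num)]; nlinarith
      calc (4 ^ i * t) ^ (-κ) ≤ (4 ^ j * t / 4) ^ (-κ) :=
            Real.rpow_le_rpow_of_nonpos (by positivity) h5 (by linarith)
        _ = 4 ^ κ * (4 ^ j * t) ^ (-κ) := by
            rw [Real.div_rpow (by positivity) (by norm_num), Real.rpow_neg (by norm_num : (0:ℝ) ≤ 4),
              div_inv_eq_mul, mul_comm]
        _ ≤ _ := by
            gcongr
            calc (4 : ℝ) ^ κ ≤ 4 ^ (1 : ℝ) :=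
                  Real.rpow_le_rpow_of_exponent_le (by norm_num) h1
              _ = 4 := Real.rpow_one 4
    calc bernC * (1024 * (1 + T) * (4 ^ i * t) ^ (-κ)) * ‖dblk j u‖
        ≤ bernC * (1024 * (1 + T) * (4 * (4 ^ j * t) ^ (-κ))) * ‖dblk j u‖ := by gcongr
      _ = _ := by ring
  refine (Finset.sum_le_card_nsmul _ _ _ hterm).trans ?_
  have hcard : ((Finset.Ico (j - 1) (j + 2)).card : ℝ) ≤ 3 := by
    rw [Nat.card_Ico]; exact_mod_cast (by omega : j + 2 - (j - 1) ≤ 3)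
  rw [nsmul_eq_mul]
  calc _ ≤ 3 * (4 * (bernC * (1024 * (1 + T))) * (4 ^ j * t) ^ (-κ) * ‖dblk j u‖) := by gcongr
    _ = _ := by ring

theorem norm_blk_heatC_le_of_besov {T α₀ β t A : ℝ} (ht : 0 < t) (htT : t ≤ T) (hα : -1 ≤ α₀)
    (hα' : α₀ ≤ 0) (h0 : 0 ≤ β) (h1 : β ≤ 1) {u : PeriodicDist}
    (hu : ∀ j : ℕ, ‖dblk j u‖ ≤ A * 2 ^ (-(α₀ * ((j : ℝ) - 1)))) (j : ℕ) :
    ‖blk j (heatC t u)‖ ≤ smC T * t ^ (-((β - α₀) / 2)) * A * 2 ^ (-(β * ((j : ℝ) - 1))) := by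
  have hb := bernC_pos
  have hT : 0 < T := ht.trans_le htT
  have hA : 0 ≤ A := by
    by_contra hA
    have := (norm_nonneg _).trans (hu 0)
    have h2 : (0 : ℝ) < 2 ^ (-(α₀ * (((0 : ℕ) : ℝ) - 1))) := by positivity
    nlinarith
  refine (norm_blk_heatC_le (κ := (β - α₀) / 2) ht htT (by linarith) (by linarith) u j).trans ?_
  have e := rpow_scale (β := β) ht j (-α₀)
  have e2 := two_rpow_shift (by linarith : -1 ≤ β) j
  -- For α₀ ≤ 0 the shift from index to scale goes in the favourable direction.
  have e3 : (2 : ℝ) ^ (-(α₀ * ((j : ℝ) - 1))) ≤ 2 ^ (-α₀ * j) :=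
    Real.rpow_le_rpow_of_exponent_le one_le_two (by nlinarith)
  have e4 : (-α₀ + β) / 2 = (β - α₀) / 2 := by ring
  rw [e4] at e
  calc 12 * (bernC * (1024 * (1 + T))) * (4 ^ j * t) ^ (-((β - α₀) / 2)) * ‖dblk j u‖
      ≤ 12 * (bernC * (1024 * (1 + T))) * (4 ^ j * t) ^ (-((β - α₀) / 2)) *
        (A * 2 ^ (-α₀ * j)) := by gcongr; exact (hu j).trans (by gcongr)
    _ = 12 * (bernC * (1024 * (1 + T))) * A *
        (2 ^ (-α₀ * j) * (4 ^ j * t) ^ (-((β - α₀) / 2))) := by ring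
    _ ≤ 12 * (bernC * (1024 * (1 + T))) * A *
        (t ^ (-((β - α₀) / 2)) * (2 * 2 ^ (-(β * ((j : ℝ) - 1))))) := by rw [e]; gcongr
    _ = bernC * (24 * (1024 * (1 + T))) * 1 * t ^ (-((β - α₀) / 2)) * A *
        2 ^ (-(β * ((j : ℝ) - 1))) := by ring
    _ ≤ bernC * (24 * (1024 * (1 + T))) * 16 * t ^ (-((β - α₀) / 2)) * A *
        2 ^ (-(β * ((j : ℝ) - 1))) := by gcongr; norm_num
    _ = _ := by rw [smC]

theorem norm_heatC_le {T α₀ δ t A : ℝ} (ht : 0 < t) (htT : t ≤ T) (hα : -1 ≤ α₀)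
    (hα' : α₀ ≤ 0) (h0 : 0 < δ) (h1 : δ ≤ 1) {u : PeriodicDist}
    (hu : ∀ j : ℕ, ‖dblk j u‖ ≤ A * 2 ^ (-(α₀ * ((j : ℝ) - 1)))) :
    ‖heatC t u‖ ≤ embC δ * smC T * t ^ (-((δ - α₀) / 2)) * A := by
  refine (norm_le_of_blk h0 (norm_blk_heatC_le_of_besov ht htT hα hα' h0.le h1 hu)).trans
    (le_of_eq ?_)
  ring

/-! ### Continuity in time of the heat flow -/

theorem heR_antitone {s t : ℝ} (h : s ≤ t) (n : ℤ) : heR t n ≤ heR s n := by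
  rw [heR, heR, Real.exp_le_exp]
  have : 0 ≤ 4 * Real.pi ^ 2 * (n : ℝ) ^ 2 := by positivity
  nlinarith

theorem continuous_he (n : ℤ) : Continuous fun t => he t n := by
  unfold he heR
  fun_prop

/-- Continuity in operator norm away from t = 0: on t > t₀/2 the series is dominated by its terms at
t₀/2, because the heat symbol decreases in time. -/
theorem continuousOn_mulOp_ker : ContinuousOn (fun t => mulOp (ker t)) (Ioi 0) := by
  intro t₀ ht₀
  have ht : 0 < t₀ / 2 := half_pos ht₀
  have h : ContinuousOn (fun t => mulOp (ker t)) (Ioi (t₀ / 2)) := by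
    refine continuousOn_tsum (u := fun n : ℤ => 2 * Real.pi * ((1 + |(n : ℝ)|) ^ 1 * heR (t₀ / 2) n))
      (fun n => ?_) ((summable_pow_mul_heR ht 1).mul_left _) (fun n t hs => ?_)
    · have : Continuous fun t => ker t n := continuous_const.mul (continuous_he n)
      exact (this.smul continuous_const).continuousOn
    · refine (norm_mulOp_term_le _ n).trans ((norm_ker_le t n).trans ?_)
      gcongr
      exact heR_antitone (le_of_lt hs) n
  exact (h.continuousAt (Ioi_mem_nhds (half_lt_self ht₀))).continuousWithinAt

theorem ContinuousOn.hk_apply {S : Set ℝ} {r : ℝ → ℝ} {F : ℝ → C(Torus, ℝ)}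
    (hr : ContinuousOn r S) (hF : ContinuousOn F S) (hpos : ∀ s ∈ S, 0 < r s) :
    ContinuousOn (fun s => hk (r s) (F s)) S := by
  have h1 : ContinuousOn (fun s => mulOp (ker (r s))) S :=
    continuousOn_mulOp_ker.comp hr hpos
  have h2 : ContinuousOn (fun s => toC (F s)) S := toC.continuous.comp_continuousOn hF
  exact reC.continuous.comp_continuousOn (h1.clm_apply h2)

theorem continuousOn_heatC (u : PeriodicDist) : ContinuousOn (fun t => heatC t u) (Ioi 0) := by
  intro t₀ ht₀
  have ht : 0 < t₀ / 2 := half_pos ht₀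
  have h : ContinuousOn (fun t => trigSum fun n => he t n * fourierCoef u n) (Ioi (t₀ / 2)) := by
    refine continuousOn_tsum (u := fun n => ‖he (t₀ / 2) n * fourierCoef u n‖)
      (fun n => ?_) (summable_he_mul u ht) (fun n t hs => ?_)
    · exact (((continuous_he n).mul continuous_const).smul continuous_const).continuousOn
    · rw [norm_smul, norm_fou, mul_one, norm_mul, norm_mul, norm_he, norm_he]
      gcongr
      exact heR_antitone (le_of_lt hs) n
  exact reC.continuous.continuousAt.comp_continuousWithinAt
    (h.continuousAt (Ioi_mem_nhds (half_lt_self ht₀))).continuousWithinAt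

/-! ### Singular time integrals -/

/-- The constant in the bound of `∫₀ᵗ (t-s)^{-p} s^{-q} ds`. -/
def betaC (p q : ℝ) : ℝ := 2 ^ p / (1 - q) + 2 ^ q / (1 - p)

theorem betaC_pos {p q : ℝ} (hp : p < 1) (hq : q < 1) : 0 < betaC p q := by
  have h1 : 0 < 1 - p := by linarith
  have h2 : 0 < 1 - q := by linarith
  unfold betaC; positivity

/-- On each half of (0,t) one of the two singular factors is bounded by its value at t/2. -/
theorem beta_pointwise {p q t s : ℝ} (hp : 0 ≤ p) (hq : 0 ≤ q) (hs : 0 < s) (hst : s < t) :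
    (t - s) ^ (-p) * s ^ (-q) ≤
      (t / 2) ^ (-p) * s ^ (-q) + (t / 2) ^ (-q) * (t - s) ^ (-p) := by
  have h1 : 0 < t - s := by linarith
  have ht : 0 < t / 2 := by linarith
  have hS : 0 < s ^ (-q) := by positivity
  have hS' : 0 < (t - s) ^ (-p) := by positivity
  have hT : 0 < (t / 2) ^ (-p) := by positivity
  have hT' : 0 < (t / 2) ^ (-q) := by positivity
  rcases le_total s (t / 2) with h | h
  · have : (t - s) ^ (-p) ≤ (t / 2) ^ (-p) :=
      Real.rpow_le_rpow_of_nonpos ht (by linarith) (by linarith)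
    nlinarith [mul_pos hT' hS']
  · have : s ^ (-q) ≤ (t / 2) ^ (-q) := Real.rpow_le_rpow_of_nonpos ht h (by linarith)
    nlinarith [mul_pos hT hS]

theorem ae_mem_Ioo_of_mem_Ioc (t : ℝ) {P : ℝ → Prop} (h : ∀ s, 0 < s → s < t → P s) :
    ∀ᵐ s ∂(volume : Measure ℝ), s ∈ Ioc 0 t → P s := by
  have : ∀ᵐ s ∂(volume : Measure ℝ), s ≠ t := by simp [ae_iff]
  filter_upwards [this] with s hs hs'
  exact h s hs'.1 (lt_of_le_of_ne hs'.2 hs)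

theorem intervalIntegrable_sub_rpow {p : ℝ} (hp : p < 1) (t : ℝ) :
    IntervalIntegrable (fun s => (t - s) ^ (-p)) volume 0 t := by
  have := (intervalIntegral.intervalIntegrable_rpow' (a := t) (b := 0) (r := -p)
    (by linarith)).comp_sub_left t
  simpa using this

theorem measurable_beta (p q t : ℝ) : Measurable fun s : ℝ => (t - s) ^ (-p) * s ^ (-q) := by
  fun_prop

theorem intervalIntegrable_of_le {f g : ℝ → ℝ} {t : ℝ} (ht : 0 ≤ t)
    (hf : AEStronglyMeasurable f (volume.restrict (Ioc 0 t)))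
    (hg : IntervalIntegrable g volume 0 t) (h : ∀ s, 0 < s → s < t → |f s| ≤ g s) :
    IntervalIntegrable f volume 0 t := by
  rw [intervalIntegrable_iff_integrableOn_Ioc_of_le ht] at hg ⊢
  refine Integrable.mono' hg hf ?_
  rw [ae_restrict_iff' measurableSet_Ioc]
  exact ae_mem_Ioo_of_mem_Ioc t h

theorem intervalIntegrable_beta {p q t : ℝ} (hp : 0 ≤ p) (hp' : p < 1) (hq : 0 ≤ q) (hq' : q < 1)
    (ht : 0 ≤ t) : IntervalIntegrable (fun s => (t - s) ^ (-p) * s ^ (-q)) volume 0 t := by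
  have h1 : IntervalIntegrable (fun s : ℝ => s ^ (-q)) volume 0 t :=
    intervalIntegral.intervalIntegrable_rpow' (by linarith)
  refine intervalIntegrable_of_le ht (measurable_beta p q t).aestronglyMeasurable
    ((h1.const_mul ((t / 2) ^ (-p))).add
      ((intervalIntegrable_sub_rpow hp' t).const_mul ((t / 2) ^ (-q)))) fun s hs hst => ?_
  have : 0 < t - s := by linarith
  rw [abs_of_nonneg (by positivity)]
  exact beta_pointwise hp hq hs hst

theorem integral_beta_le {p q t : ℝ} (hp : 0 ≤ p) (hp' : p < 1) (hq : 0 ≤ q) (hq' : q < 1)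
    (ht : 0 < t) :
    ∫ s in (0 : ℝ)..t, (t - s) ^ (-p) * s ^ (-q) ≤ betaC p q * t ^ (1 - p - q) := by
  have h1 : IntervalIntegrable (fun s : ℝ => s ^ (-q)) volume 0 t :=
    intervalIntegral.intervalIntegrable_rpow' (by linarith)
  have h2 := intervalIntegrable_sub_rpow hp' t
  have hint := (h1.const_mul ((t / 2) ^ (-p))).add (h2.const_mul ((t / 2) ^ (-q)))
  have e1 : ∫ s in (0 : ℝ)..t, s ^ (-q) = t ^ (1 - q) / (1 - q) := by
    rw [integral_rpow (Or.inl (by linarith)), Real.zero_rpow (by linarith)]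
    rw [sub_zero, neg_add_eq_sub]
  have e2 : ∫ s in (0 : ℝ)..t, (t - s) ^ (-p) = t ^ (1 - p) / (1 - p) := by
    rw [intervalIntegral.integral_comp_sub_left (fun s => s ^ (-p)), sub_self, sub_zero,
      integral_rpow (Or.inl (by linarith)), Real.zero_rpow (by linarith)]
    rw [sub_zero, neg_add_eq_sub]
  have e3 : ∀ a b : ℝ, (t / 2) ^ (-a) * t ^ (1 - b) = 2 ^ a * t ^ (1 - a - b) := fun a b => by
    rw [Real.div_rpow ht.le zero_le_two, Real.rpow_neg zero_le_two, div_inv_eq_mul,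
      mul_right_comm, ← Real.rpow_add ht, mul_comm]
    congr 2; ring
  calc ∫ s in (0 : ℝ)..t, (t - s) ^ (-p) * s ^ (-q)
      ≤ ∫ s in (0 : ℝ)..t, ((t / 2) ^ (-p) * s ^ (-q) + (t / 2) ^ (-q) * (t - s) ^ (-p)) := by
        refine intervalIntegral.integral_mono_on_of_le_Ioo ht.le
          (intervalIntegrable_beta hp hp' hq hq' ht.le) hint fun s hs => ?_
        exact beta_pointwise hp hq hs.1 hs.2
    _ = (t / 2) ^ (-p) * (t ^ (1 - q) / (1 - q)) + (t / 2) ^ (-q) * (t ^ (1 - p) / (1 - p)) := by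
        rw [intervalIntegral.integral_add (h1.const_mul _) (h2.const_mul _),
          intervalIntegral.integral_const_mul, intervalIntegral.integral_const_mul, e1, e2]
    _ = betaC p q * t ^ (1 - p - q) := by
        rw [← mul_div_assoc, ← mul_div_assoc, e3, e3, betaC, show 1 - q - p = 1 - p - q by ring]
        ring

/-- The integrand of the exponentially weighted singular integrals. -/
def wker (p q l t s : ℝ) : ℝ := (t - s) ^ (-p) * s ^ (-q) * Real.exp (l * s)

theorem wker_nonneg {p q l t s : ℝ} (hs : 0 ≤ s) (hst : s ≤ t) : 0 ≤ wker p q l t s := by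
  have : 0 ≤ t - s := by linarith
  unfold wker; positivity

/-- Writing e^{ls} = e^{lt} e^{-l(t-s)} and bounding the last factor by (l(t-s))^{-κ} gains l^{-κ}
at the price of a stronger singularity at s = t. -/
theorem wker_le {p q l t s κ : ℝ} (hκ : 0 ≤ κ) (hκ' : κ ≤ 1) (hl : 0 < l) (hs : 0 < s)
    (hst : s < t) : wker p q l t s ≤
      Real.exp (l * t) * l ^ (-κ) * ((t - s) ^ (-(p + κ)) * s ^ (-q)) := by
  have h1 : 0 < t - s := by linarith
  have h2 := exp_neg_le_rpow (by positivity : 0 < l * (t - s)) hκ hκ'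
  have e1 : Real.exp (l * s) = Real.exp (l * t) * Real.exp (-(l * (t - s))) := by
    rw [← Real.exp_add]; congr 1; ring
  have e2 : (t - s) ^ (-(p + κ)) = (t - s) ^ (-p) * (t - s) ^ (-κ) := by
    rw [← Real.rpow_add h1]; congr 1; ring
  rw [Real.mul_rpow hl.le h1.le] at h2
  rw [wker, e1, e2]
  calc _ ≤ (t - s) ^ (-p) * s ^ (-q) * (Real.exp (l * t) * (l ^ (-κ) * (t - s) ^ (-κ))) := by
        gcongr
    _ = _ := by ring

theorem intervalIntegrable_wker {p q l t : ℝ} (hp : 0 ≤ p) (hp' : p < 1) (hq : 0 ≤ q)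
    (hq' : q < 1) (hl : 0 < l) (ht : 0 ≤ t) : IntervalIntegrable (wker p q l t) volume 0 t := by
  refine intervalIntegrable_of_le ht
    (Measurable.aestronglyMeasurable (by unfold wker; fun_prop))
    ((intervalIntegrable_beta hp hp' hq hq' ht).const_mul (Real.exp (l * t) * l ^ (-0 : ℝ)))
    fun s hs hst => ?_
  rw [abs_of_nonneg (wker_nonneg hs.le hst.le)]
  have := wker_le (p := p) (q := q) le_rfl zero_le_one hl hs hst
  simpa only [add_zero] using this

theorem integral_wker_le {p q l t κ : ℝ} (hp : 0 ≤ p) (hκ : 0 ≤ κ) (hp' : p + κ < 1) (hq : 0 ≤ q)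
    (hq' : q < 1) (hl : 0 < l) (ht : 0 < t) :
    ∫ s in (0 : ℝ)..t, wker p q l t s ≤
      Real.exp (l * t) * l ^ (-κ) * (betaC (p + κ) q * t ^ (1 - (p + κ) - q)) := by
  have h1 := intervalIntegrable_beta (by linarith : 0 ≤ p + κ) hp' hq hq' ht.le
  calc _ ≤ ∫ s in (0 : ℝ)..t,
        Real.exp (l * t) * l ^ (-κ) * ((t - s) ^ (-(p + κ)) * s ^ (-q)) := by
        refine intervalIntegral.integral_mono_on_of_le_Ioo ht.le
          (intervalIntegrable_wker hp (by linarith) hq hq' hl ht.le) (h1.const_mul _)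
          fun s hs => ?_
        exact wker_le hκ (by linarith) hl hs.1 hs.2
    _ ≤ _ := by
        rw [intervalIntegral.integral_const_mul]
        gcongr
        exact integral_beta_le (by linarith) hp' hq hq' ht

/-- For a large exponential weight the singular integral operator is a contraction. -/
theorem exists_weight {p b γ T B : ℝ} (hp : 0 ≤ p) (hb : 0 ≤ b) (hγ : 0 ≤ γ) (hpb : p + b < 1)
    (hbγ : b + γ < 1) (hT : 0 < T) (hB : 0 ≤ B) :
    ∃ l : ℝ, 0 < l ∧ ∀ t ∈ Ioc 0 T, B * ∫ s in (0 : ℝ)..t, wker p (b + γ) l t s ≤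
      1 / 2 * (t ^ (-γ) * Real.exp (l * t)) := by
  -- Half of the spare integrability goes to the gain in l; the other half is the factor t^κ, since
  -- 1 - (p+κ) - (b+γ) = κ - γ.
  set κ := (1 - p - b) / 2 with hκ
  have hκ0 : 0 < κ := by rw [hκ]; linarith
  have hbC : 0 < betaC (p + κ) (b + γ) := betaC_pos (by rw [hκ]; linarith) hbγ
  -- With l = Q^{1/κ} the gain l^{-κ} equals 1/Q, and Q exceeds twice the constant to be beaten.
  set Q := 2 * B * (betaC (p + κ) (b + γ) * T ^ κ) + 1 with hQ
  have hQ1 : 0 < Q := by positivity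
  refine ⟨Q ^ (1 / κ), by positivity, fun t ht => ?_⟩
  have hl : 0 < Q ^ (1 / κ) := by positivity
  have h1 := integral_wker_le hp hκ0.le (by rw [hκ]; linarith : p + κ < 1)
    (by linarith : 0 ≤ b + γ) hbγ hl ht.1
  set l := Q ^ (1 / κ) with hldef
  have e1 : l ^ (-κ) = Q⁻¹ := by
    rw [hldef, ← Real.rpow_mul hQ1.le]
    have : 1 / κ * -κ = -1 := by field_simp
    rw [this, Real.rpow_neg_one]
  have e2 : t ^ (1 - (p + κ) - (b + γ)) = t ^ κ * t ^ (-γ) := by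
    rw [← Real.rpow_add ht.1]; congr 1; rw [hκ]; ring
  have e3 : t ^ κ ≤ T ^ κ := Real.rpow_le_rpow ht.1.le ht.2 hκ0.le
  have htγ : 0 < t ^ (-γ) := Real.rpow_pos_of_pos ht.1 _
  calc B * ∫ s in (0 : ℝ)..t, wker p (b + γ) l t s
      ≤ B * (Real.exp (l * t) * Q⁻¹ * (betaC (p + κ) (b + γ) * (T ^ κ * t ^ (-γ)))) := by
        rw [e1, e2] at h1
        refine mul_le_mul_of_nonneg_left (h1.trans ?_) hB
        gcongr
    _ = (B * (betaC (p + κ) (b + γ) * T ^ κ)) / Q * (t ^ (-γ) * Real.exp (l * t)) := by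
        field_simp
    _ ≤ 1 / 2 * (t ^ (-γ) * Real.exp (l * t)) := by
        refine mul_le_mul_of_nonneg_right ?_ (by positivity)
        rw [div_le_iff₀ hQ1, hQ]
        linarith

/-- A Grönwall lemma for singular integral inequalities. -/
theorem exists_gronwall {p b γ T B : ℝ} (hp : 0 ≤ p) (hb : 0 ≤ b) (hγ : 0 ≤ γ) (hpb : p + b < 1)
    (hbγ : b + γ < 1) (hT : 0 < T) (hB : 0 ≤ B) :
    ∃ C : ℝ, 0 < C ∧ ∀ (d : ℝ → ℝ) (A D : ℝ), 0 ≤ A → (∀ t ∈ Ioc 0 T, d t ≤ D * t ^ (-γ)) →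
      (∀ t ∈ Ioc 0 T, ∀ l G : ℝ, 0 < l → 0 ≤ G →
        (∀ s ∈ Ioc 0 t, d s ≤ G * (s ^ (-γ) * Real.exp (l * s))) →
        d t ≤ A * t ^ (-γ) + B * (G * ∫ s in (0 : ℝ)..t, wker p (b + γ) l t s)) →
      ∀ t ∈ Ioc 0 T, d t ≤ C * A * t ^ (-γ) := by
  obtain ⟨l, hl, h⟩ := exists_weight hp hb hγ hpb hbγ hT hB
  refine ⟨2 * Real.exp (l * T), by positivity, fun d A D hA hD hd t ht => ?_⟩
  -- The hypothesis is iterated: a weighted bound G improves to A + G/2, with fixed point 2A. The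
  -- crude constant D is halved each time and vanishes in the limit, and no regularity of d is used.
  have key : ∀ n : ℕ, ∀ t ∈ Ioc 0 T,
      d t ≤ (2 * A + |D| / 2 ^ n) * (t ^ (-γ) * Real.exp (l * t)) := by
    intro n
    induction n with
    | zero =>
      intro t ht
      have h1 : 0 < t ^ (-γ) := Real.rpow_pos_of_pos ht.1 _
      have h2 : 1 ≤ Real.exp (l * t) := Real.one_le_exp (mul_pos hl ht.1).le
      refine (hD t ht).trans ?_
      rw [pow_zero, div_one]
      calc D * t ^ (-γ) ≤ (2 * A + |D|) * (t ^ (-γ) * 1) := by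
            have := le_abs_self D
            nlinarith
        _ ≤ _ := by gcongr
    | succ n ih =>
      intro t ht
      have h1 : 0 < t ^ (-γ) := Real.rpow_pos_of_pos ht.1 _
      have h2 : 1 ≤ Real.exp (l * t) := Real.one_le_exp (mul_pos hl ht.1).le
      have hG : 0 ≤ 2 * A + |D| / 2 ^ n := by positivity
      have h3 := hd t ht l _ hl hG fun s hs => ih s ⟨hs.1, hs.2.trans ht.2⟩
      have h4 := mul_le_mul_of_nonneg_left (h t ht) hG
      calc d t ≤ _ := h3
        _ = A * (t ^ (-γ) * 1) + (2 * A + |D| / 2 ^ n) *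
            (B * ∫ s in (0 : ℝ)..t, wker p (b + γ) l t s) := by ring
        _ ≤ A * (t ^ (-γ) * Real.exp (l * t)) +
            (2 * A + |D| / 2 ^ n) * (1 / 2 * (t ^ (-γ) * Real.exp (l * t))) := by gcongr
        _ = _ := by rw [pow_succ]; ring
  have hlim : Tendsto (fun n : ℕ => (2 * A + |D| / 2 ^ n) * (t ^ (-γ) * Real.exp (l * t))) atTop
      (𝓝 ((2 * A + 0) * (t ^ (-γ) * Real.exp (l * t)))) := by
    refine (tendsto_const_nhds.add ?_).mul_const _
    have := (tendsto_pow_atTop_nhds_zero_of_lt_one (r := (1 / 2 : ℝ)) (by norm_num)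
      (by norm_num)).const_mul |D|
    simpa [div_eq_mul_inv] using this
  have h1 := ge_of_tendsto' hlim fun n => key n t ht
  have h2 : Real.exp (l * t) ≤ Real.exp (l * T) :=
    Real.exp_le_exp.2 (mul_le_mul_of_nonneg_left ht.2 hl.le)
  have h3 : 0 < t ^ (-γ) := Real.rpow_pos_of_pos ht.1 _
  calc d t ≤ _ := h1
    _ ≤ (2 * A + 0) * (t ^ (-γ) * Real.exp (l * T)) := by gcongr
    _ = _ := by ring

/-! ### The Duhamel integral -/

/-- The Duhamel integral `∫₀ᵗ e^{(t-s)Δ} ∂ₓ F_s ds`. -/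
def duh (F : ℝ → C(Torus, ℝ)) (t : ℝ) : C(Torus, ℝ) := ∫ s in (0 : ℝ)..t, hk (t - s) (F s)

theorem intervalIntegrable_hk {F : ℝ → C(Torus, ℝ)} {t : ℝ} (ht : 0 ≤ t)
    (hF : ContinuousOn F (Ioc 0 t)) {g : ℝ → ℝ} (hg : IntervalIntegrable g volume 0 t)
    (h : ∀ s, 0 < s → s < t → ‖hk (t - s) (F s)‖ ≤ g s) :
    IntervalIntegrable (fun s => hk (t - s) (F s)) volume 0 t := by
  rw [intervalIntegrable_iff_integrableOn_Ioo_of_le ht] at hg ⊢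
  have hc : ContinuousOn (fun s => hk (t - s) (F s)) (Ioo 0 t) :=
    ContinuousOn.hk_apply (by fun_prop) (hF.mono Ioo_subset_Ioc_self) fun s hs => by
      have := hs.2; linarith
  refine Integrable.mono' hg (hc.aestronglyMeasurable measurableSet_Ioo) ?_
  rw [ae_restrict_iff' measurableSet_Ioo]
  exact ae_of_all _ fun s hs => h s hs.1 hs.2

theorem norm_duh_le {F : ℝ → C(Torus, ℝ)} {t : ℝ} (ht : 0 ≤ t) {g : ℝ → ℝ}
    (hg : IntervalIntegrable g volume 0 t)
    (h : ∀ s, 0 < s → s < t → ‖hk (t - s) (F s)‖ ≤ g s) :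
    ‖duh F t‖ ≤ ∫ s in (0 : ℝ)..t, g s :=
  intervalIntegral.norm_integral_le_of_norm_le ht (ae_mem_Ioo_of_mem_Ioc t h) hg

/-- The constant in the sup norm bound of `e^{tΔ} ∂ₓ`. -/
def hkC (T δ : ℝ) : ℝ := embC δ * smC T

theorem hkC_pos {T δ : ℝ} (hT : 0 ≤ T) (hδ : 0 < δ) : 0 < hkC T δ :=
  mul_pos (embC_pos hδ) (smC_pos hT)

theorem norm_hk_sub_le {T δ t s B q : ℝ} (hδ : 0 < δ) (hδ' : δ ≤ 1) (htT : t ≤ T) {f : C(Torus, ℝ)}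
    (hs : 0 < s) (hst : s < t) (hf : ‖f‖ ≤ B * s ^ (-q)) :
    ‖hk (t - s) f‖ ≤ hkC T δ * B * ((t - s) ^ (-((1 + δ) / 2)) * s ^ (-q)) := by
  have h1 := norm_hk_le (T := T) (by linarith : 0 < t - s) (by linarith) hδ hδ' f
  have h2 := hkC_pos (by linarith : 0 ≤ T) hδ
  refine h1.trans ?_
  have h3 : 0 < (t - s) ^ (-((1 + δ) / 2)) := Real.rpow_pos_of_pos (by linarith) _
  calc _ ≤ hkC T δ * (t - s) ^ (-((1 + δ) / 2)) * (B * s ^ (-q)) := by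
        rw [← hkC]; gcongr
    _ = _ := by ring

theorem intervalIntegrable_hk_of_bound {T δ t B q : ℝ} (hδ : 0 < δ) (hδ' : δ < 1) (hq : 0 ≤ q)
    (hq' : q < 1) (ht : t ∈ Ioc 0 T) {F : ℝ → C(Torus, ℝ)} (hF : ContinuousOn F (Ioc 0 T))
    (hB : ∀ s ∈ Ioc 0 T, ‖F s‖ ≤ B * s ^ (-q)) :
    IntervalIntegrable (fun s => hk (t - s) (F s)) volume 0 t :=
  intervalIntegrable_hk ht.1.le (hF.mono (Ioc_subset_Ioc_right ht.2))
    ((intervalIntegrable_beta (p := (1 + δ) / 2) (by linarith) (by linarith) hq hq' ht.1.le).const_mul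
      (hkC T δ * B))
    fun _ hs hst => norm_hk_sub_le hδ hδ'.le ht.2 hs hst (hB _ ⟨hs, hst.le.trans ht.2⟩)

theorem norm_duh_le_of_bound {T δ t B q : ℝ} (hδ : 0 < δ) (hδ' : δ < 1) (hq : 0 ≤ q)
    (hq' : q < 1) (hB0 : 0 ≤ B) (ht : t ∈ Ioc 0 T) {F : ℝ → C(Torus, ℝ)}
    (hB : ∀ s ∈ Ioc 0 t, ‖F s‖ ≤ B * s ^ (-q)) :
    ‖duh F t‖ ≤ hkC T δ * B * (betaC ((1 + δ) / 2) q * t ^ (1 - (1 + δ) / 2 - q)) := by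
  have hT : 0 < T := ht.1.trans_le ht.2
  refine (norm_duh_le ht.1.le ((intervalIntegrable_beta (p := (1 + δ) / 2) (by linarith)
    (by linarith) hq hq' ht.1.le).const_mul (hkC T δ * B))
    fun _ hs hst => norm_hk_sub_le hδ hδ'.le ht.2 hs hst (hB _ ⟨hs, hst.le⟩)).trans ?_
  rw [intervalIntegral.integral_const_mul]
  have := hkC_pos hT.le hδ
  gcongr
  exact integral_beta_le (by linarith) (by linarith) hq hq' ht.1

/-- The parameter δ only ensures that the Duhamel integral exists in the sup norm; the regularity β
< 1 keeps the smoothing exponent (1+β)/2 integrable. -/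
theorem norm_blk_duh_le_of_bound {T β δ t B q : ℝ} (hδ : 0 < δ) (hδ' : δ < 1) (hβ : 0 ≤ β)
    (hβ' : β < 1) (hq : 0 ≤ q) (hq' : q < 1) (hB0 : 0 ≤ B) (ht : t ∈ Ioc 0 T)
    {F : ℝ → C(Torus, ℝ)} (hF : ContinuousOn F (Ioc 0 T))
    (hB : ∀ s ∈ Ioc 0 T, ‖F s‖ ≤ B * s ^ (-q)) (j : ℕ) :
    ‖blk j (duh F t)‖ ≤ smC T * B * (betaC ((1 + β) / 2) q * t ^ (1 - (1 + β) / 2 - q)) *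
      2 ^ (-(β * ((j : ℝ) - 1))) := by
  have hT : 0 < T := ht.1.trans_le ht.2
  have hsm := smC_pos hT.le
  rw [duh, ← ContinuousLinearMap.intervalIntegral_comp_comm _
    (intervalIntegrable_hk_of_bound hδ hδ' hq hq' ht hF hB)]
  have hint := (intervalIntegrable_beta (p := (1 + β) / 2) (by linarith) (by linarith) hq hq'
    ht.1.le).const_mul (smC T * B * 2 ^ (-(β * ((j : ℝ) - 1))))
  refine (intervalIntegral.norm_integral_le_of_norm_le ht.1.le
    (ae_mem_Ioo_of_mem_Ioc t fun s hs hst => ?_) hint).trans ?_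
  · refine (norm_blk_hk_le (T := T) (by linarith : 0 < t - s) (by linarith [ht.2]) hβ hβ'.le j
      _).trans ?_
    have h3 : 0 < (t - s) ^ (-((1 + β) / 2)) := Real.rpow_pos_of_pos (by linarith) _
    calc _ ≤ smC T * (t - s) ^ (-((1 + β) / 2)) * (B * s ^ (-q)) *
          2 ^ (-(β * ((j : ℝ) - 1))) := by
          gcongr
          exact hB s ⟨hs, hst.le.trans ht.2⟩
      _ = _ := by ring
  · rw [intervalIntegral.integral_const_mul]
    calc _ ≤ smC T * B * 2 ^ (-(β * ((j : ℝ) - 1))) *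
          (betaC ((1 + β) / 2) q * t ^ (1 - (1 + β) / 2 - q)) := by
          gcongr
          exact integral_beta_le (by linarith) (by linarith) hq hq' ht.1
      _ = _ := by ring

theorem continuousOn_duh {T δ B q : ℝ} (hδ : 0 < δ) (hδ' : δ < 1) (hq : 0 ≤ q)
    (hq' : q < 1) (hB0 : 0 ≤ B) {F : ℝ → C(Torus, ℝ)} (hF : ContinuousOn F (Ioc 0 T))
    (hB : ∀ s ∈ Ioc 0 T, ‖F s‖ ≤ B * s ^ (-q)) : ContinuousOn (duh F) (Ioc 0 T) := by
  intro t₀ ht₀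
  have hT : 0 < T := ht₀.1.trans_le ht₀.2
  have hhk := hkC_pos hT.le hδ
  -- The substitution s = tτ fixes both the interval and the places of the singularities, so that
  -- dominated convergence applies.
  have hsub : ∀ t, duh F t = ∫ τ in (0 : ℝ)..1, t • hk (t - t * τ) (F (t * τ)) := fun t => by
    rw [intervalIntegral.integral_smul,
      intervalIntegral.smul_integral_comp_mul_left (fun s => hk (t - s) (F s)), mul_zero, mul_one,
      duh]
  rw [show duh F = _ from funext hsub]
  have hev : ∀ᶠ t in 𝓝[Ioc 0 T] t₀, t₀ / 2 < t ∧ t ∈ Ioc 0 T :=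
    (eventually_nhdsWithin_of_eventually_nhds (eventually_gt_nhds (half_lt_self ht₀.1))).and
      self_mem_nhdsWithin
  have h01 : Ioo (0 : ℝ) 1 =ᵐ[volume] uIoc (0 : ℝ) 1 := by
    rw [uIoc_of_le zero_le_one]; exact Ioo_ae_eq_Ioc
  refine intervalIntegral.continuousWithinAt_of_dominated_interval
    (bound := fun τ => T * (hkC T δ * B * (t₀ / 2) ^ (-((1 + δ) / 2)) * (t₀ / 2) ^ (-q)) *
      ((1 - τ) ^ (-((1 + δ) / 2)) * τ ^ (-q))) ?_ ?_ ?_ ?_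
  · filter_upwards [hev] with t ht
    rw [← Measure.restrict_congr_set h01]
    refine ContinuousOn.aestronglyMeasurable ?_ measurableSet_Ioo
    refine ContinuousOn.const_smul (ContinuousOn.hk_apply (r := fun τ => t - t * τ) (by fun_prop)
      (hF.comp (f := fun τ => t * τ) (by fun_prop) ?_) ?_) t
    · intro τ hτ
      exact ⟨mul_pos ht.2.1 hτ.1, (mul_le_of_le_one_right ht.2.1.le hτ.2.le).trans ht.2.2⟩
    · intro τ hτ
      have := mul_lt_of_lt_one_right ht.2.1 hτ.2
      linarith
  · filter_upwards [hev] with t ht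
    rw [uIoc_of_le zero_le_one]
    refine ae_mem_Ioo_of_mem_Ioc 1 fun τ h0 h1 => ?_
    have ht0 := ht.2.1
    have h2 : 0 < t * τ := mul_pos ht0 h0
    have h3 : t * τ < t := mul_lt_of_lt_one_right ht0 h1
    have h4 := norm_hk_sub_le (T := T) hδ hδ'.le ht.2.2 h2 h3 (hB _ ⟨h2, h3.le.trans ht.2.2⟩)
    rw [norm_smul, Real.norm_of_nonneg ht0.le]
    have h5 : t - t * τ = t * (1 - τ) := by ring
    have h6 : 0 < 1 - τ := by linarith
    have h7 : t ^ (-((1 + δ) / 2)) ≤ (t₀ / 2) ^ (-((1 + δ) / 2)) :=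
      Real.rpow_le_rpow_of_nonpos (half_pos ht₀.1) ht.1.le (by linarith)
    have h8 : t ^ (-q) ≤ (t₀ / 2) ^ (-q) :=
      Real.rpow_le_rpow_of_nonpos (half_pos ht₀.1) ht.1.le (by linarith)
    have h9 : 0 < t₀ / 2 := half_pos ht₀.1
    calc t * ‖hk (t - t * τ) (F (t * τ))‖
        ≤ T * (hkC T δ * B * ((t - t * τ) ^ (-((1 + δ) / 2)) * (t * τ) ^ (-q))) :=
          mul_le_mul ht.2.2 h4 (norm_nonneg _) hT.le
      _ = T * (hkC T δ * B * t ^ (-((1 + δ) / 2)) * t ^ (-q)) *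
          ((1 - τ) ^ (-((1 + δ) / 2)) * τ ^ (-q)) := by
          rw [h5, Real.mul_rpow ht0.le h6.le, Real.mul_rpow ht0.le h0.le]; ring
      _ ≤ _ := by gcongr
  · exact (intervalIntegrable_beta (by linarith) (by linarith) hq hq' zero_le_one).const_mul _
  · rw [uIoc_of_le zero_le_one]
    refine ae_mem_Ioo_of_mem_Ioc 1 fun τ h0 h1 => ?_
    have hc : ContinuousOn (fun t => t • hk (t - t * τ) (F (t * τ))) (Ioc 0 T) := by
      refine continuousOn_id.smul (ContinuousOn.hk_apply (r := fun t => t - t * τ) (by fun_prop)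
        (hF.comp (f := fun t => t * τ) (by fun_prop) ?_) ?_)
      · intro t ht
        exact ⟨mul_pos ht.1 h0, (mul_le_of_le_one_right ht.1.le h1.le).trans ht.2⟩
      · intro t ht
        have := mul_lt_of_lt_one_right ht.1 h1
        linarith
    exact hc t₀ ht₀

/-! ### The flux -/

/-- The mean value of a continuous function on the torus. -/
def avg : C(Torus, ℝ) →L[ℝ] ℝ :=
  LinearMap.mkContinuous
    { toFun := fun f => ∫ t, f t ∂(haarAddCircle : Measure Torus)
      map_add' := fun f g => integral_add (integrable_torus f.continuous)
        (integrable_torus g.continuous)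
      map_smul' := fun c f => integral_const_mul c _ } 1 (by
    intro f
    rw [one_mul]
    refine (norm_integral_le_of_norm_le_const (C := ‖f‖) (ae_of_all _ fun t =>
      f.norm_coe_le_norm t)).trans ?_
    simp)

theorem avg_apply (f : C(Torus, ℝ)) : avg f = ∫ t, f t ∂(haarAddCircle : Measure Torus) := rfl

theorem avg_eq_intervalIntegral (f : C(Torus, ℝ)) :
    avg f = ∫ x in (0 : ℝ)..1, f (x : Torus) := by
  have := AddCircle.intervalIntegral_preimage 1 0 (fun t => f t)
  rw [avg_apply, integral_haarAddCircle, inv_one, one_smul, ← this, zero_add]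

theorem mean_toDist_eq_avg (f : C(Torus, ℝ)) : mean (toDist f) = avg f := by
  rw [mean_toDist, avg_eq_intervalIntegral]

theorem avg_const (c : ℝ) : avg (ContinuousMap.const Torus c) = c := by
  simp [avg_apply]

theorem avg_mono {f g : C(Torus, ℝ)} (h : ∀ x, f x ≤ g x) : avg f ≤ avg g :=
  integral_mono (integrable_torus f.continuous) (integrable_torus g.continuous) h

theorem avg_nonneg {f : C(Torus, ℝ)} (h : ∀ x, 0 ≤ f x) : 0 ≤ avg f :=
  integral_nonneg h

theorem abs_avg_le (f : C(Torus, ℝ)) : |avg f| ≤ ‖f‖ := by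
  have := avg.le_of_opNorm_le (LinearMap.mkContinuous_norm_le _ zero_le_one _) f
  simpa using this

theorem primitive_sub (u v : C(Torus, ℝ)) (x : ℝ) :
    primitive (u - v) x = primitive u x - primitive v x := by
  have h : ∀ u : C(Torus, ℝ), IntervalIntegrable
      (fun y : ℝ => u (y : Torus) - mean (toDist u)) volume 0 x := fun u =>
    ((continuous_coe_torus u).sub continuous_const).intervalIntegrable _ _
  rw [primitive, primitive, primitive, ← intervalIntegral.integral_sub (h u) (h v)]
  simp only [mean_toDist_eq_avg, map_sub]
  refine intervalIntegral.integral_congr fun y _ => ?_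
  simp only [ContinuousMap.sub_apply]
  ring

theorem primitive_smul (c : ℝ) (u : C(Torus, ℝ)) (x : ℝ) :
    primitive (c • u) x = c * primitive u x := by
  rw [primitive, primitive, ← intervalIntegral.integral_const_mul]
  simp only [mean_toDist_eq_avg, map_smul]
  refine intervalIntegral.integral_congr fun y _ => ?_
  simp only [ContinuousMap.smul_apply, smul_eq_mul]
  ring

theorem continuous_primitive (u : C(Torus, ℝ)) : Continuous (primitive u) :=
  continuous_iff_continuousAt.2 fun x => (hasDerivAt_primitive u x).continuousAt

theorem gradPotential_sub (u v : C(Torus, ℝ)) :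
    gradPotential (u - v) = gradPotential u - gradPotential v := by
  refine ContinuousMap.ext (forall_torus.2 fun x => ?_)
  rw [ContinuousMap.sub_apply, gradPotential_coe, gradPotential_coe, gradPotential_coe,
    primitive_sub]
  simp only [primitive_sub]
  rw [intervalIntegral.integral_sub ((continuous_primitive u).intervalIntegrable _ _)
    ((continuous_primitive v).intervalIntegrable _ _)]
  ring

theorem gradPotential_smul (c : ℝ) (u : C(Torus, ℝ)) :
    gradPotential (c • u) = c • gradPotential u := by
  refine ContinuousMap.ext (forall_torus.2 fun x => ?_)
  rw [ContinuousMap.smul_apply, gradPotential_coe, gradPotential_coe, primitive_smul]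
  simp only [primitive_smul]
  rw [intervalIntegral.integral_const_mul, smul_eq_mul]
  ring

/-- The primitive is bounded by the L¹ norm of u - ū over one period, and making it mean-free at
most doubles that. Only an integral norm of u is needed, which the energy controls. -/
theorem norm_gradPotential_le_of_integral {u : C(Torus, ℝ)} {L : ℝ}
    (h : ∫ y in (0 : ℝ)..1, |u (y : Torus) - mean (toDist u)| ≤ L) : ‖gradPotential u‖ ≤ 2 * L := by
  have hc : Continuous fun y : ℝ => |u (y : Torus) - mean (toDist u)| :=
    ((continuous_coe_torus u).sub continuous_const).abs
  have h01 : ∀ x ∈ Icc (0 : ℝ) 1, |primitive u x| ≤ L := fun x hx => by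
    refine le_trans ?_ h
    refine (intervalIntegral.abs_integral_le_integral_abs hx.1).trans ?_
    exact intervalIntegral.integral_mono_interval le_rfl hx.1 hx.2
      (ae_of_all _ fun _ => abs_nonneg _) (hc.intervalIntegrable _ _)
  have h0 : 0 ≤ L := (abs_nonneg _).trans (h01 0 ⟨le_rfl, zero_le_one⟩)
  have hall : ∀ x, |primitive u x| ≤ L := fun x => by
    have h2 := (primitive_periodic u).sub_zsmul_eq (x := x) ⌊x⌋
    rw [← h2]
    refine h01 _ ?_
    have h3 : x - ⌊x⌋ • (1 : ℝ) = Int.fract x := by simp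
    rw [h3]
    exact ⟨Int.fract_nonneg x, (Int.fract_lt_one x).le⟩
  refine (ContinuousMap.norm_le _ (by linarith)).2 (forall_torus.2 fun x => ?_)
  rw [gradPotential_coe]
  have h1 : ‖∫ y in (0 : ℝ)..1, primitive u y‖ ≤ L * |1 - 0| :=
    intervalIntegral.norm_integral_le_of_norm_le_const fun y _ => hall y
  have h2 := norm_sub_le (∫ y in (0 : ℝ)..1, primitive u y) (primitive u x)
  have h3 : ‖primitive u x‖ ≤ L := hall x
  rw [sub_zero, abs_one, mul_one] at h1
  linarith

theorem norm_gradPotential_le (u : C(Torus, ℝ)) : ‖gradPotential u‖ ≤ 4 * ‖u‖ := by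
  have : ∫ y in (0 : ℝ)..1, |u (y : Torus) - mean (toDist u)| ≤ 2 * ‖u‖ := by
    have h1 : ‖∫ y in (0 : ℝ)..1, |u (y : Torus) - mean (toDist u)|‖ ≤ (2 * ‖u‖) * |1 - 0| := by
      refine intervalIntegral.norm_integral_le_of_norm_le_const fun y _ => ?_
      rw [Real.norm_eq_abs, abs_abs, mean_toDist_eq_avg]
      have h2 := abs_sub (u (y : Torus)) (avg u)
      have h3 : |u (y : Torus)| ≤ ‖u‖ := u.norm_coe_le_norm _
      have h4 := abs_avg_le u
      linarith
    rw [sub_zero, abs_one, mul_one] at h1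
    exact (le_abs_self _).trans h1
  refine (norm_gradPotential_le_of_integral this).trans (le_of_eq (by ring))

theorem norm_flux_le_mul (u : C(Torus, ℝ)) : ‖flux u‖ ≤ ‖u‖ ^ 2 * ‖gradPotential u‖ :=
  (norm_mul_le _ _).trans (mul_le_mul_of_nonneg_right (norm_pow_le _ _) (norm_nonneg _))

theorem norm_flux_le (u : C(Torus, ℝ)) : ‖flux u‖ ≤ 4 * ‖u‖ ^ 3 := by
  refine (norm_flux_le_mul u).trans ?_
  have := norm_gradPotential_le u
  calc _ ≤ ‖u‖ ^ 2 * (4 * ‖u‖) := by gcongr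
    _ = _ := by ring

theorem norm_flux_sub_le {u v : C(Torus, ℝ)} {B : ℝ} (hu : ‖u‖ ≤ B) (hv : ‖v‖ ≤ B) :
    ‖flux u - flux v‖ ≤ 12 * B ^ 2 * ‖u - v‖ := by
  have hB : 0 ≤ B := (norm_nonneg _).trans hu
  -- The potential is linear in u, so the flux is cubic and its difference telescopes.
  have e : flux u - flux v = (u - v) * ((u + v) * gradPotential u) +
      v ^ 2 * gradPotential (u - v) := by
    rw [gradPotential_sub, flux, flux]; ring
  rw [e]
  have h1 := norm_gradPotential_le u
  have h2 := norm_gradPotential_le (u - v)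
  calc _ ≤ ‖u - v‖ * ((‖u‖ + ‖v‖) * ‖gradPotential u‖) + ‖v‖ ^ 2 * ‖gradPotential (u - v)‖ := by
        refine (norm_add_le _ _).trans (add_le_add ?_ ?_)
        · refine (norm_mul_le _ _).trans ?_
          gcongr
          refine (norm_mul_le _ _).trans ?_
          gcongr
          exact norm_add_le _ _
        · refine (norm_mul_le _ _).trans ?_
          gcongr
          exact norm_pow_le _ _
    _ ≤ ‖u - v‖ * ((B + B) * (4 * B)) + B ^ 2 * (4 * ‖u - v‖) := by
        gcongr
        linarith
    _ = _ := by ring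

/-- Cubic homogeneity: composing the flux with the radial retraction multiplies it by a number,
which preserves the sign structure of the energy estimate. -/
theorem flux_smul (c : ℝ) (u : C(Torus, ℝ)) : flux (c • u) = c ^ 3 • flux u := by
  rw [flux, flux, gradPotential_smul, smul_pow, smul_mul_smul_comm]
  congr 1

theorem continuous_flux : Continuous flux := by
  rw [continuous_iff_continuousAt]
  intro u
  rw [ContinuousAt, tendsto_iff_norm_sub_tendsto_zero]
  have h : ∀ᶠ v in 𝓝 u, ‖flux v - flux u‖ ≤ 12 * (‖u‖ + 1) ^ 2 * ‖v - u‖ := by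
    filter_upwards [Metric.ball_mem_nhds u one_pos] with v hv
    rw [mem_ball_iff_norm] at hv
    refine norm_flux_sub_le ?_ (by linarith)
    have := norm_add_le (v - u) u
    rw [sub_add_cancel] at this
    linarith
  refine squeeze_zero' (Eventually.of_forall fun _ => norm_nonneg _) h ?_
  have : Tendsto (fun v => 12 * (‖u‖ + 1) ^ 2 * ‖v - u‖) (𝓝 u)
      (𝓝 (12 * (‖u‖ + 1) ^ 2 * ‖u - u‖)) :=
    (continuous_const.mul (continuous_id.sub continuous_const).norm).tendsto u
  simpa using this

/-! ### Radial retraction -/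

/-- The radial retraction onto the ball of radius `M > 0`. -/
def ret (M : ℝ) (u : C(Torus, ℝ)) : C(Torus, ℝ) := (M / max M ‖u‖) • u

theorem ret_coeff_nonneg {M : ℝ} (hM : 0 < M) (u : C(Torus, ℝ)) : 0 ≤ M / max M ‖u‖ := by
  positivity

theorem ret_coeff_le_one {M : ℝ} (hM : 0 < M) (u : C(Torus, ℝ)) : M / max M ‖u‖ ≤ 1 :=
  (div_le_one (lt_max_of_lt_left hM)).2 (le_max_left _ _)

theorem norm_ret_le {M : ℝ} (hM : 0 < M) (u : C(Torus, ℝ)) : ‖ret M u‖ ≤ M := by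
  have h : 0 < max M ‖u‖ := lt_max_of_lt_left hM
  rw [ret, norm_smul, Real.norm_of_nonneg (ret_coeff_nonneg hM u), div_mul_eq_mul_div,
    div_le_iff₀ h]
  exact mul_le_mul_of_nonneg_left (le_max_right _ _) hM.le

theorem ret_of_le {M : ℝ} (hM : 0 < M) {u : C(Torus, ℝ)} (h : ‖u‖ ≤ M) : ret M u = u := by
  rw [ret, max_eq_left h, div_self hM.ne', one_smul]

theorem norm_ret_sub_le {M : ℝ} (hM : 0 < M) (u v : C(Torus, ℝ)) :
    ‖ret M u - ret M v‖ ≤ 2 * ‖u - v‖ := by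
  set a := max M ‖u‖ with ha
  set b := max M ‖v‖ with hb
  have ha0 : 0 < a := lt_max_of_lt_left hM
  have hb0 : 0 < b := lt_max_of_lt_left hM
  have e : ret M u - ret M v = (M / a) • (u - v) + (M / a * ((b - a) / b)) • v := by
    rw [ret, ret, ← ha, ← hb, smul_sub]
    have : M / a * ((b - a) / b) = M / a - M / b := by field_simp
    rw [this, sub_smul]; abel
  have h1 : M / a ≤ 1 := ret_coeff_le_one hM u
  have h0 : 0 ≤ M / a := ret_coeff_nonneg hM u
  have h2 : |b - a| ≤ ‖u - v‖ := by
    rw [ha, hb, max_comm M, max_comm M]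
    refine (abs_max_sub_max_le_abs _ _ _).trans ?_
    rw [norm_sub_rev u v]
    exact abs_norm_sub_norm_le v u
  have h3 : |(b - a) / b| * ‖v‖ ≤ ‖u - v‖ := by
    rw [abs_div, abs_of_pos hb0, div_mul_eq_mul_div, div_le_iff₀ hb0]
    exact mul_le_mul h2 (le_max_right _ _) (norm_nonneg _) (norm_nonneg _)
  rw [e]
  refine (norm_add_le _ _).trans ?_
  rw [norm_smul, norm_smul, norm_mul, Real.norm_of_nonneg h0, Real.norm_eq_abs, mul_assoc]
  have h4 : M / a * ‖u - v‖ ≤ 1 * ‖u - v‖ := by gcongr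
  have h5 : M / a * (|(b - a) / b| * ‖v‖) ≤ 1 * ‖u - v‖ := by gcongr
  linarith

theorem flux_ret {M : ℝ} (u : C(Torus, ℝ)) : flux (ret M u) = (M / max M ‖u‖) ^ 3 • flux u :=
  flux_smul _ _

/-! ### Stability of Duhamel equations -/

theorem norm_duh_sub_le {T δ b γ l L B q t : ℝ} (hδ : 0 < δ) (hδ' : δ < 1) (hbγ : 0 ≤ b + γ)
    (hbγ' : b + γ < 1) (hl : 0 < l) (hq : 0 ≤ q) (hq' : q < 1) (ht : t ∈ Ioc 0 T)
    {F F' : ℝ → C(Torus, ℝ)} (hF : ContinuousOn F (Ioc 0 T)) (hF' : ContinuousOn F' (Ioc 0 T))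
    (hB : ∀ s ∈ Ioc 0 T, ‖F s‖ ≤ B * s ^ (-q)) (hB' : ∀ s ∈ Ioc 0 T, ‖F' s‖ ≤ B * s ^ (-q))
    (hd : ∀ s ∈ Ioc 0 t, ‖F s - F' s‖ ≤ L * (s ^ (-b) * (s ^ (-γ) * Real.exp (l * s)))) :
    ‖duh F t - duh F' t‖ ≤
      hkC T δ * L * ∫ s in (0 : ℝ)..t, wker ((1 + δ) / 2) (b + γ) l t s := by
  have hT : 0 < T := ht.1.trans_le ht.2
  have hhk := hkC_pos hT.le hδ
  have e : duh F t - duh F' t = duh (fun s => F s - F' s) t := by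
    simp only [duh, map_sub]
    rw [intervalIntegral.integral_sub (intervalIntegrable_hk_of_bound hδ hδ' hq hq' ht hF hB)
      (intervalIntegrable_hk_of_bound hδ hδ' hq hq' ht hF' hB')]
  rw [e, ← intervalIntegral.integral_const_mul]
  refine norm_duh_le ht.1.le ((intervalIntegrable_wker (by linarith) (by linarith) hbγ hbγ' hl
    ht.1.le).const_mul _) fun s hs hst => ?_
  refine (norm_hk_le (T := T) (by linarith : 0 < t - s) (by linarith [ht.2]) hδ hδ'.le _).trans ?_
  have h1 : 0 < (t - s) ^ (-((1 + δ) / 2)) := Real.rpow_pos_of_pos (by linarith) _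
  have h2 : s ^ (-(b + γ)) = s ^ (-b) * s ^ (-γ) := by
    rw [← Real.rpow_add hs]; congr 1; ring
  rw [← hkC]
  calc _ ≤ hkC T δ * (t - s) ^ (-((1 + δ) / 2)) *
        (L * (s ^ (-b) * (s ^ (-γ) * Real.exp (l * s)))) := by
        gcongr
        exact hd s ⟨hs, hst.le⟩
    _ = _ := by rw [wker, h2]; ring

/-- Used to absorb constants into the weight t^{-γ}. -/
theorem one_le_rpow_mul {T t γ : ℝ} (ht : t ∈ Ioc 0 T) (hγ : 0 ≤ γ) : 1 ≤ T ^ γ * t ^ (-γ) := by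
  rw [Real.rpow_neg ht.1.le, ← div_eq_mul_inv, one_le_div (Real.rpow_pos_of_pos ht.1 _)]
  exact Real.rpow_le_rpow ht.1.le ht.2 hγ

/-- Grönwall for ‖w - w'‖ + E, where E stands for the difference of the noises. The constant does
not depend on D, B or q, which serve only to make the integrals and the iteration meaningful. -/
theorem exists_stability {T δ b γ L : ℝ} (hT : 0 < T) (hδ : 0 < δ) (hδ' : δ < 1) (hb : 0 ≤ b)
    (hγ : 0 ≤ γ) (hpb : (1 + δ) / 2 + b < 1) (hbγ : b + γ < 1) (hL : 0 ≤ L) :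
    ∃ C : ℝ, 0 < C ∧ ∀ (w w' H H' F F' : ℝ → C(Torus, ℝ)) (A E D B q : ℝ),
      0 ≤ A → 0 ≤ E → 0 ≤ q → q < 1 →
      ContinuousOn F (Ioc 0 T) → ContinuousOn F' (Ioc 0 T) →
      (∀ s ∈ Ioc 0 T, ‖F s‖ ≤ B * s ^ (-q)) → (∀ s ∈ Ioc 0 T, ‖F' s‖ ≤ B * s ^ (-q)) →
      (∀ t ∈ Ioc 0 T, ‖w t - w' t‖ ≤ D * t ^ (-γ)) →
      (∀ t ∈ Ioc 0 T, w t = H t + duh F t) → (∀ t ∈ Ioc 0 T, w' t = H' t + duh F' t) →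
      (∀ t ∈ Ioc 0 T, ‖H t - H' t‖ ≤ A * t ^ (-γ)) →
      (∀ s ∈ Ioc 0 T, ‖F s - F' s‖ ≤ L * (s ^ (-b) * (‖w s - w' s‖ + E))) →
      ∀ t ∈ Ioc 0 T, ‖w t - w' t‖ ≤ C * (A + E) * t ^ (-γ) := by
  have hhk := hkC_pos hT.le hδ
  obtain ⟨C, hC, h⟩ := exists_gronwall (p := (1 + δ) / 2) (B := hkC T δ * L) (by linarith) hb hγ
    hpb hbγ hT (by positivity)
  refine ⟨C * (1 + T ^ γ), by positivity, ?_⟩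
  intro w w' H H' F F' A E D B q hA hE hq hq' hF hF' hB hB' hD hw hw' hH hFF t ht
  have hTγ : 0 < T ^ γ := by positivity
  have h1 := h (fun t => ‖w t - w' t‖ + E) (A + E * T ^ γ) (D + E * T ^ γ) (by positivity)
    (fun t ht => ?_) (fun t ht l G hl hG hs => ?_) t ht
  · have htγ : 0 < t ^ (-γ) := Real.rpow_pos_of_pos ht.1 _
    calc ‖w t - w' t‖ ≤ C * (A + E * T ^ γ) * t ^ (-γ) := by linarith
      _ ≤ C * ((1 + T ^ γ) * (A + E)) * t ^ (-γ) := by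
          gcongr
          nlinarith [mul_nonneg hTγ.le hA]
      _ = _ := by ring
  · have h2 := one_le_rpow_mul ht hγ
    have h3 := hD t ht
    change ‖w t - w' t‖ + E ≤ _
    nlinarith
  · have h2 := one_le_rpow_mul ht hγ
    have h3 := hH t ht
    have h4 := norm_duh_sub_le (L := L * G) hδ hδ' (by linarith) hbγ hl hq hq' ht hF hF' hB hB'
      (fun s hs' => by
        have hs0 : s ∈ Ioc 0 T := ⟨hs'.1, hs'.2.trans ht.2⟩
        have h5 : 0 < s ^ (-b) := Real.rpow_pos_of_pos hs'.1 _
        calc _ ≤ _ := hFF s hs0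
          _ ≤ L * (s ^ (-b) * (G * (s ^ (-γ) * Real.exp (l * s)))) := by
              gcongr
              exact hs s hs'
          _ = _ := by ring)
    have h6 : w t - w' t = (H t - H' t) + (duh F t - duh F' t) := by
      rw [hw t ht, hw' t ht]; abel
    have h7 := norm_add_le (H t - H' t) (duh F t - duh F' t)
    rw [← h6] at h7
    change ‖w t - w' t‖ + E ≤ _
    have h8 : E ≤ E * (T ^ γ * t ^ (-γ)) := le_mul_of_one_le_right hE h2
    calc _ ≤ A * t ^ (-γ) + hkC T δ * (L * G) *
          (∫ s in (0 : ℝ)..t, wker ((1 + δ) / 2) (b + γ) l t s) + E * (T ^ γ * t ^ (-γ)) := by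
          linarith
      _ = _ := by ring

/-! ### The truncated equation -/

/-- The flux, truncated at the level `M s^{-γ}`. -/
def tflux (χ M γ s : ℝ) (u : C(Torus, ℝ)) : C(Torus, ℝ) := χ • flux (ret (M * s ^ (-γ)) u)

theorem level_pos {M s : ℝ} (hM : 0 < M) (hs : 0 < s) (γ : ℝ) : 0 < M * s ^ (-γ) :=
  mul_pos hM (Real.rpow_pos_of_pos hs _)

theorem rpow_neg_pow {s : ℝ} (hs : 0 < s) (γ : ℝ) (n : ℕ) : (s ^ (-γ)) ^ n = s ^ (-(n * γ)) := by
  rw [← Real.rpow_natCast, ← Real.rpow_mul hs.le]; congr 1; ring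

theorem norm_tflux_le {χ M γ s : ℝ} (hM : 0 < M) (hs : 0 < s) (u : C(Torus, ℝ)) :
    ‖tflux χ M γ s u‖ ≤ 4 * |χ| * M ^ 3 * s ^ (-(3 * γ)) := by
  rw [tflux, norm_smul, Real.norm_eq_abs]
  have h1 := norm_flux_le (ret (M * s ^ (-γ)) u)
  have h2 := norm_ret_le (level_pos hM hs γ) u
  have h3 := rpow_neg_pow hs γ 3
  push_cast at h3
  calc _ ≤ |χ| * (4 * (M * s ^ (-γ)) ^ 3) := by
        gcongr
        exact h1.trans (by gcongr)
    _ = _ := by rw [mul_pow, h3]; ring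

/-- After truncation the flux is globally Lipschitz, with a constant singular like s^{-2γ}. -/
theorem norm_tflux_sub_le {χ M γ s : ℝ} (hM : 0 < M) (hs : 0 < s) (u v : C(Torus, ℝ)) :
    ‖tflux χ M γ s u - tflux χ M γ s v‖ ≤ 24 * |χ| * M ^ 2 * (s ^ (-(2 * γ)) * ‖u - v‖) := by
  rw [tflux, tflux, ← smul_sub, norm_smul, Real.norm_eq_abs]
  have hl := level_pos hM hs γ
  have h1 := norm_flux_sub_le (norm_ret_le hl u) (norm_ret_le hl v)
  have h2 := norm_ret_sub_le hl u v
  have h3 := rpow_neg_pow hs γ 2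
  push_cast at h3
  calc _ ≤ |χ| * (12 * (M * s ^ (-γ)) ^ 2 * (2 * ‖u - v‖)) := by
        gcongr
        exact h1.trans (by gcongr)
    _ = _ := by rw [mul_pow, h3]; ring

theorem continuousOn_tflux {χ M γ : ℝ} (hM : 0 < M) {S : Set ℝ} (hS : ∀ s ∈ S, 0 < s)
    {u : ℝ → C(Torus, ℝ)} (hu : ContinuousOn u S) :
    ContinuousOn (fun s => tflux χ M γ s (u s)) S := by
  have h1 : ContinuousOn (fun s : ℝ => M * s ^ (-γ)) S :=
    continuousOn_const.mul (continuousOn_id.rpow_const fun s hs => Or.inl (hS s hs).ne')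
  have h2 : ContinuousOn (fun s => M * s ^ (-γ) / max (M * s ^ (-γ)) ‖u s‖) S :=
    h1.div (h1.sup hu.norm) fun s hs => (lt_max_of_lt_left (level_pos hM (hS s hs) γ)).ne'
  exact (continuous_flux.comp_continuousOn (h2.smul hu)).const_smul χ

/-- A solution on `(0,T]` of the Duhamel equation with inhomogeneity `H`, noise `Z` and flux
truncated at the level `M s^{-γ}`. -/
structure IsTruncSol (χ M γ T : ℝ) (H Z w : ℝ → C(Torus, ℝ)) : Prop where
  cont : ContinuousOn w (Ioc 0 T)
  bound : ∃ D : ℝ, ∀ t ∈ Ioc 0 T, ‖w t‖ ≤ D * t ^ (-γ)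
  eq : ∀ t ∈ Ioc 0 T, w t = H t + duh (fun s => tflux χ M γ s (w s + Z s)) t

theorem IsTruncSol.mono {χ M γ T T' : ℝ} {H Z w : ℝ → C(Torus, ℝ)} (h : IsTruncSol χ M γ T H Z w)
    (hT : T' ≤ T) : IsTruncSol χ M γ T' H Z w := by
  obtain ⟨D, hD⟩ := h.bound
  exact ⟨h.cont.mono (Ioc_subset_Ioc_right hT), ⟨D, fun t ht => hD t ⟨ht.1, ht.2.trans hT⟩⟩,
    fun t ht => h.eq t ⟨ht.1, ht.2.trans hT⟩⟩

theorem IsTruncSol.unique {χ M γ T δ : ℝ} (hT : 0 < T) (hδ : 0 < δ) (hδ' : δ < 1) (hγ : 0 ≤ γ)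
    (hpγ : (1 + δ) / 2 + 2 * γ < 1) (hM : 0 < M) {H Z w w' : ℝ → C(Torus, ℝ)}
    (hZ : ContinuousOn Z (Ioc 0 T)) (h : IsTruncSol χ M γ T H Z w)
    (h' : IsTruncSol χ M γ T H Z w') : EqOn w w' (Ioc 0 T) := by
  obtain ⟨C, hC, hst⟩ := exists_stability (L := 24 * |χ| * M ^ 2) hT hδ hδ'
    (by linarith : 0 ≤ 2 * γ) hγ hpγ (by linarith) (by positivity)
  obtain ⟨D, hD⟩ := h.bound
  obtain ⟨D', hD'⟩ := h'.bound
  intro t ht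
  have := hst w w' H H _ _ 0 0 (D + D') (4 * |χ| * M ^ 3) (3 * γ) le_rfl le_rfl (by linarith)
    (by linarith) (continuousOn_tflux hM (fun s hs => hs.1) (h.cont.add hZ))
    (continuousOn_tflux hM (fun s hs => hs.1) (h'.cont.add hZ))
    (fun s hs => norm_tflux_le hM hs.1 _) (fun s hs => norm_tflux_le hM hs.1 _)
    (fun s hs => (norm_sub_le _ _).trans (by linarith [hD s hs, hD' s hs]))
    h.eq h'.eq (by simp) (fun s hs => by
      refine (norm_tflux_sub_le hM hs.1 _ _).trans (le_of_eq ?_)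
      rw [Pi.add_apply, Pi.add_apply, add_sub_add_right_eq_sub, add_zero]) t ht
  rw [add_zero, mul_zero, zero_mul] at this
  exact sub_eq_zero.1 (norm_le_zero_iff.1 this)

/-- Banach's fixed point theorem for the normalised unknown v = w / (t^{-γ} e^{lt}) in bounded
continuous functions on (0,T]; `exists_weight` supplies an l with contraction factor 1/2 on the
whole interval. -/
theorem exists_truncSol {χ M γ T δ A : ℝ} (hT : 0 < T) (hδ : 0 < δ) (hδ' : δ < 1) (hγ : 0 ≤ γ)
    (hpγ : (1 + δ) / 2 + 2 * γ < 1) (hM : 0 < M) {H Z : ℝ → C(Torus, ℝ)}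
    (hH : ContinuousOn H (Ioc 0 T)) (hHA : ∀ t ∈ Ioc 0 T, ‖H t‖ ≤ A * t ^ (-γ))
    (hZ : ContinuousOn Z (Ioc 0 T)) : ∃ w, IsTruncSol χ M γ T H Z w := by
  have hhk := hkC_pos hT.le hδ
  set p := (1 + δ) / 2 with hp
  have hp0 : 0 ≤ p := by rw [hp]; linarith
  obtain ⟨l, hl, hcon⟩ := exists_weight (b := 2 * γ) (B := hkC T δ * (24 * |χ| * M ^ 2))
    hp0 (by linarith) hγ hpγ (by linarith) hT (by positivity)
  set wt : ℝ → ℝ := fun t => t ^ (-γ) * Real.exp (l * t) with hwt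
  have hwtpos : ∀ t ∈ Ioc 0 T, 0 < wt t := fun t ht =>
    mul_pos (Real.rpow_pos_of_pos ht.1 _) (Real.exp_pos _)
  have hwtc : ContinuousOn wt (Ioc 0 T) :=
    (continuousOn_id.rpow_const fun s hs => Or.inl hs.1.ne').mul (by fun_prop)
  let X := BoundedContinuousFunction (Ioc 0 T) C(Torus, ℝ)
  let W : X → ℝ → C(Torus, ℝ) := fun v t => if h : t ∈ Ioc 0 T then wt t • v ⟨t, h⟩ else 0
  have hWeq : ∀ v : X, ∀ t (h : t ∈ Ioc 0 T), W v t = wt t • v ⟨t, h⟩ := fun v t h => dif_pos h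
  have hWc : ∀ v : X, ContinuousOn (W v) (Ioc 0 T) := fun v => by
    rw [continuousOn_iff_continuous_domRestrict] at hwtc ⊢
    have h1 : Continuous fun t : Ioc 0 T => (Ioc 0 T).domRestrict wt t • v t := hwtc.smul v.continuous
    refine h1.congr fun t => ?_
    exact (hWeq v t t.2).symm
  let F : X → ℝ → C(Torus, ℝ) := fun v s => tflux χ M γ s (W v s + Z s)
  have hFc : ∀ v, ContinuousOn (F v) (Ioc 0 T) := fun v =>
    continuousOn_tflux hM (fun s hs => hs.1) ((hWc v).add hZ)
  have hFb : ∀ v, ∀ s ∈ Ioc 0 T, ‖F v s‖ ≤ 4 * |χ| * M ^ 3 * s ^ (-(3 * γ)) := fun v s hs =>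
    norm_tflux_le hM hs.1 _
  have hB0 : 0 ≤ 4 * |χ| * M ^ 3 := by positivity
  have hq : 0 ≤ 3 * γ := by linarith
  have hq' : 3 * γ < 1 := by linarith
  have hGc : ∀ v, ContinuousOn (fun t => (wt t)⁻¹ • (H t + duh (F v) t)) (Ioc 0 T) := fun v =>
    (hwtc.inv₀ fun t ht => (hwtpos t ht).ne').smul
      (hH.add (continuousOn_duh hδ hδ' hq hq' hB0 (hFc v) (hFb v)))
  have hbeta := betaC_pos (p := p) (q := 3 * γ) (by linarith) hq'
  have hGb : ∀ v, ∀ t : Ioc 0 T, ‖(wt t)⁻¹ • (H t + duh (F v) t)‖ ≤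
      |A| + hkC T δ * (4 * |χ| * M ^ 3) * (betaC p (3 * γ) * T ^ (1 - p - 2 * γ)) := by
    rintro v ⟨t, ht⟩
    have h1 := norm_duh_le_of_bound hδ hδ' hq hq' hB0 ht
      (fun s hs => hFb v s ⟨hs.1, hs.2.trans ht.2⟩)
    have h2 := hHA t ht
    have h3 := hwtpos t ht
    have htγ : 0 < t ^ (-γ) := Real.rpow_pos_of_pos ht.1 _
    have h4 : t ^ (-γ) ≤ wt t :=
      le_mul_of_one_le_right htγ.le (Real.one_le_exp (mul_pos hl ht.1).le)
    rw [norm_smul, norm_inv, Real.norm_of_nonneg h3.le, inv_mul_le_iff₀ h3]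
    -- One factor t^{-γ} is the weight; the remaining exponent 1 - p - 2γ is positive.
    have h5 : t ^ (1 - p - 3 * γ) = t ^ (1 - p - 2 * γ) * t ^ (-γ) := by
      rw [← Real.rpow_add ht.1]; congr 1; ring
    have h6 : t ^ (1 - p - 2 * γ) ≤ T ^ (1 - p - 2 * γ) :=
      Real.rpow_le_rpow ht.1.le ht.2 (by linarith)
    calc ‖H t + duh (F v) t‖ ≤ ‖H t‖ + ‖duh (F v) t‖ := norm_add_le _ _
      _ ≤ |A| * t ^ (-γ) + hkC T δ * (4 * |χ| * M ^ 3) *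
          (betaC p (3 * γ) * (T ^ (1 - p - 2 * γ) * t ^ (-γ))) := by
          refine add_le_add (h2.trans (by gcongr; exact le_abs_self A)) (h1.trans ?_)
          rw [h5]
          gcongr
      _ = t ^ (-γ) * (|A| + hkC T δ * (4 * |χ| * M ^ 3) *
          (betaC p (3 * γ) * T ^ (1 - p - 2 * γ))) := by ring
      _ ≤ _ := by gcongr
  let Ψ : X → X := fun v => BoundedContinuousFunction.ofNormedAddCommGroup
    (fun t : Ioc 0 T => (wt t)⁻¹ • (H t + duh (F v) t))
    (continuousOn_iff_continuous_domRestrict.1 (hGc v)) _ (hGb v)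
  have hΨ : ∀ v (t : Ioc 0 T), Ψ v t = (wt t)⁻¹ • (H t + duh (F v) t) := fun v t => rfl
  have hcontr : ContractingWith (1 / 2) Ψ := by
    refine ⟨by rw [← NNReal.coe_lt_coe]; norm_num, LipschitzWith.of_dist_le_mul fun v v' => ?_⟩
    refine (BoundedContinuousFunction.dist_le (by positivity)).2 ?_
    rintro ⟨t, ht⟩
    have h3 := hwtpos t ht
    rw [dist_eq_norm, hΨ, hΨ, ← smul_sub, add_sub_add_left_eq_sub, norm_smul, norm_inv,
      Real.norm_of_nonneg h3.le, inv_mul_le_iff₀ h3]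
    have h4 := norm_duh_sub_le (b := 2 * γ) (γ := γ) (L := 24 * |χ| * M ^ 2 * dist v v') hδ hδ'
      (by linarith) (by linarith) hl hq hq' ht (hFc v) (hFc v') (hFb v) (hFb v') (fun s hs => by
        have hs' : s ∈ Ioc 0 T := ⟨hs.1, hs.2.trans ht.2⟩
        refine (norm_tflux_sub_le hM hs.1 _ _).trans ?_
        have h5 : 0 < s ^ (-(2 * γ)) := Real.rpow_pos_of_pos hs.1 _
        have h6 : ‖W v s + Z s - (W v' s + Z s)‖ ≤ wt s * dist v v' := by
          rw [add_sub_add_right_eq_sub, hWeq v s hs', hWeq v' s hs', ← smul_sub, norm_smul,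
            Real.norm_of_nonneg (hwtpos s hs').le, ← dist_eq_norm]
          have := BoundedContinuousFunction.dist_coe_le_dist (f := v) (g := v') ⟨s, hs'⟩
          exact mul_le_mul_of_nonneg_left this (hwtpos s hs').le
        calc _ ≤ 24 * |χ| * M ^ 2 * (s ^ (-(2 * γ)) * (wt s * dist v v')) := by gcongr
          _ = _ := by rw [hwt]; ring)
    have h7 := mul_le_mul_of_nonneg_right (hcon t ht) (dist_nonneg (x := v) (y := v'))
    refine h4.trans ?_
    have h8 : ((1 / 2 : ℝ≥0) : ℝ) = 1 / 2 := by norm_num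
    rw [h8]
    calc _ = hkC T δ * (24 * |χ| * M ^ 2) *
          (∫ s in (0 : ℝ)..t, wker p (2 * γ + γ) l t s) * dist v v' := by ring
      _ ≤ _ := h7
      _ = _ := by rw [hwt]; ring
  have hfix := hcontr.fixedPoint_isFixedPt
  set v := ContractingWith.fixedPoint Ψ hcontr with hv
  refine ⟨W v, hWc v, ⟨‖v‖ * Real.exp (l * T), fun t ht => ?_⟩, fun t ht => ?_⟩
  · rw [hWeq v t ht, norm_smul, Real.norm_of_nonneg (hwtpos t ht).le]
    have h1 := v.norm_coe_le_norm ⟨t, ht⟩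
    have h2 : Real.exp (l * t) ≤ Real.exp (l * T) :=
      Real.exp_le_exp.2 (mul_le_mul_of_nonneg_left ht.2 hl.le)
    have htγ : 0 < t ^ (-γ) := Real.rpow_pos_of_pos ht.1 _
    calc t ^ (-γ) * Real.exp (l * t) * ‖v ⟨t, ht⟩‖ ≤ t ^ (-γ) * Real.exp (l * T) * ‖v‖ := by
          gcongr
      _ = _ := by ring
  · have h1 : v ⟨t, ht⟩ = Ψ v ⟨t, ht⟩ := by rw [hfix]
    rw [hWeq v t ht, h1, hΨ, smul_inv_smul₀ (hwtpos t ht).ne']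

/-! ### Differentiation and integration by parts -/

/-- `g` is the derivative of `f`. -/
def IsDeriv (f g : C(Torus, ℝ)) : Prop :=
  ∀ x : ℝ, HasDerivAt (fun y : ℝ => f (y : Torus)) (g (x : Torus)) x

theorem IsDeriv.add {f f' g g' : C(Torus, ℝ)} (hf : IsDeriv f f') (hg : IsDeriv g g') :
    IsDeriv (f + g) (f' + g') := fun x => (hf x).add (hg x)

theorem IsDeriv.mul {f f' g g' : C(Torus, ℝ)} (hf : IsDeriv f f') (hg : IsDeriv g g') :
    IsDeriv (f * g) (f' * g + f * g') := fun x => (hf x).mul (hg x)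

theorem IsDeriv.avg_eq_zero {f g : C(Torus, ℝ)} (h : IsDeriv f g) : avg g = 0 := by
  rw [avg_eq_intervalIntegral, intervalIntegral.integral_eq_sub_of_hasDerivAt (fun x _ => h x)
    ((continuous_coe_torus g).intervalIntegrable _ _)]
  have : ((1 : ℝ) : Torus) = ((0 : ℝ) : Torus) := by
    rw [AddCircle.coe_period, QuotientAddGroup.mk_zero]
  rw [this, sub_self]

theorem isDeriv_gradPotential (u : C(Torus, ℝ)) :
    IsDeriv (gradPotential u) (ContinuousMap.const Torus (avg u) - u) := fun x => by
  have h := (hasDerivAt_primitive u x).const_sub (∫ y in (0 : ℝ)..1, primitive u y)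
  rw [mean_toDist_eq_avg] at h
  have e : (ContinuousMap.const Torus (avg u) - u) (x : Torus) = -(u (x : Torus) - avg u) :=
    (neg_sub _ _).symm
  rw [e]
  exact h

/-- The frequencies that are not cut off by `cu J`. -/
def modes (J : ℕ) : Finset ℤ := Finset.Icc (-2 ^ (J + 1)) (2 ^ (J + 1))

theorem cu_eq_zero_of_notMem {J : ℕ} {n : ℤ} (h : n ∉ modes J) : cu J n = 0 := by
  refine cu_eq_zero ?_
  by_contra h'
  exact h (Finset.mem_Icc.2 (abs_le.1 (not_le.1 h').le))

theorem mulR_eq_sum {m : ℤ → ℂ} {s : Finset ℤ} (hm : ∀ n ∉ s, m n = 0) (f : C(Torus, ℝ)) :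
    mulR m f = reC (∑ n ∈ s, (m n * coefC n (toC f)) • fou n) := by
  have hs : Summable fun n => ‖m n‖ :=
    summable_of_ne_finset_zero (s := s) fun n hn => by rw [hm n hn, norm_zero]
  rw [mulR_apply, mulOp_eq hs, trigSum,
    tsum_eq_sum (s := s) fun n hn => by rw [hm n hn, zero_mul, zero_smul]]

theorem isDeriv_mulR {m : ℤ → ℂ} {s : Finset ℤ} (hm : ∀ n ∉ s, m n = 0) (f : C(Torus, ℝ)) :
    IsDeriv (mulR m f) (mulR (fun n => dx n * m n) f) := fun x => by
  rw [mulR_eq_sum hm, mulR_eq_sum fun n hn => by rw [hm n hn, mul_zero]]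
  have h : HasDerivAt (fun y : ℝ => (∑ n ∈ s, (m n * coefC n (toC f)) • fou n) (y : Torus))
      ((∑ n ∈ s, (dx n * m n * coefC n (toC f)) • fou n) (x : Torus)) x := by
    simp only [ContinuousMap.sum_apply, ContinuousMap.smul_apply, smul_eq_mul]
    refine HasDerivAt.fun_sum fun n _ => ?_
    refine ((hasDerivAt_fourier 1 n x).const_mul (m n * coefC n (toC f))).congr_deriv ?_
    change _ = dx n * m n * coefC n (toC f) * fourier n (x : AddCircle (1 : ℝ))
    rw [dx]
    push_cast
    ring
  exact Complex.reCLM.hasFDerivAt.comp_hasDerivAt x h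

theorem isDeriv_trunc (J : ℕ) (f : C(Torus, ℝ)) :
    IsDeriv (trunc J f) (mulR (fun n => dx n * cu J n) f) :=
  isDeriv_mulR (fun _ hn => cu_eq_zero_of_notMem hn) f

theorem norm_mulR_le_sum {m : ℤ → ℂ} (hm : Summable fun n => ‖m n‖) (f : C(Torus, ℝ)) :
    ‖mulR m f‖ ≤ (∑' n, ‖m n‖) * ‖f‖ := by
  refine norm_mulR_le (fun g => ?_) f
  rw [mulOp_eq hm, ← tsum_mul_right]
  refine (norm_trigSum_le (summable_norm_mul_coefC hm g)).trans ?_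
  refine Summable.tsum_le_tsum (fun n => ?_) (summable_norm_mul_coefC hm g) (hm.mul_right _)
  rw [norm_mul]
  exact mul_le_mul_of_nonneg_left (norm_coefC_le n g) (norm_nonneg _)

/-! ### The energy inequality at a fixed time -/

theorem sq_avg_le (f : C(Torus, ℝ)) : avg f ^ 2 ≤ avg (f ^ 2) := by
  have h : 0 ≤ avg ((f - ContinuousMap.const Torus (avg f)) ^ 2) :=
    avg_nonneg fun x => sq_nonneg _
  have e : (f - ContinuousMap.const Torus (avg f)) ^ 2 =
      f ^ 2 - (2 * avg f) • f + ContinuousMap.const Torus (avg f ^ 2) := by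
    ext x; simp; ring
  rw [e, map_add, map_sub, map_smul, avg_const, smul_eq_mul] at h
  linarith

/-- The potential is controlled by an L¹ norm, hence by the L² norm of W, up to the bounded
contributions of Z and of the mean. -/
theorem sq_norm_gradPotential_le {W Z : C(Torus, ℝ)} {K : ℝ} (hZ : ‖Z‖ ≤ K)
    (hm : |avg (W + Z)| ≤ K) :
    ‖gradPotential (W + Z)‖ ^ 2 ≤ 8 * avg (W ^ 2) + 32 * K ^ 2 := by
  set N : C(Torus, ℝ) := |W| with hN
  have hp : avg N ^ 2 ≤ avg (W ^ 2) := by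
    refine (sq_avg_le N).trans (le_of_eq ?_)
    congr 1; ext x; simp [hN]
  have hN0 : 0 ≤ avg N := avg_nonneg fun x => by simp [hN]
  have h1 : ∫ y in (0 : ℝ)..1, |(W + Z) (y : Torus) - mean (toDist (W + Z))| ≤ avg N + 2 * K := by
    rw [mean_toDist_eq_avg]
    have e : avg (N + ContinuousMap.const Torus (2 * K)) = avg N + 2 * K := by
      rw [map_add, avg_const]
    rw [← e, avg_eq_intervalIntegral (N + _)]
    have hc : Continuous fun y : ℝ => |(W + Z) (y : Torus) - avg (W + Z)| :=
      ((continuous_coe_torus _).sub continuous_const).abs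
    refine intervalIntegral.integral_mono_on zero_le_one (hc.intervalIntegrable _ _)
      ((continuous_coe_torus _).intervalIntegrable _ _) fun y _ => ?_
    have h2 : |Z (y : Torus)| ≤ ‖Z‖ := Z.norm_coe_le_norm _
    have h3 : (N + ContinuousMap.const Torus (2 * K)) (y : Torus) = |W (y : Torus)| + 2 * K := by
      simp [hN]
    rw [h3, ContinuousMap.add_apply]
    have h4 := abs_sub (W (y : Torus) + Z (y : Torus)) (avg (W + Z))
    have h5 := abs_add_le (W (y : Torus)) (Z (y : Torus))
    linarith
  have h2 := norm_gradPotential_le_of_integral h1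
  have hK : 0 ≤ K := (norm_nonneg _).trans hZ
  calc ‖gradPotential (W + Z)‖ ^ 2 ≤ (2 * (avg N + 2 * K)) ^ 2 := by gcongr
    _ ≤ 8 * avg N ^ 2 + 32 * K ^ 2 := by nlinarith [sq_nonneg (avg N - 2 * K)]
    _ ≤ _ := by linarith

/-- The identity behind global existence. The derivatives of W³ g and W² Zl g have mean zero, where
g is the gradient of the potential and g' = m - (W + Z). The first yields the quartic term; the
second moves the derivative off W in the term containing the smooth part of the noise. What still
contains DW is quadratic in Z or carries the small factor Z - Zl. -/
theorem avg_flux_mul_deriv {W DW Z Zl DZl : C(Torus, ℝ)} {m : ℝ} (hW : IsDeriv W DW)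
    (hl : IsDeriv Zl DZl) (hm : avg (W + Z) = m) :
    avg (flux (W + Z) * DW) = 1 / 3 * avg (W ^ 4) + 1 / 3 * avg (W ^ 3 * Z) -
      m / 3 * avg (W ^ 3) - avg (W ^ 2 * DZl * gradPotential (W + Z)) +
      avg (W ^ 2 * Zl * (W + Z - ContinuousMap.const Torus m)) +
      avg (2 * W * (Z - Zl) * gradPotential (W + Z) * DW + Z ^ 2 * gradPotential (W + Z) * DW) := by
  have hg := isDeriv_gradPotential (W + Z)
  rw [hm] at hg
  set g := gradPotential (W + Z) with hgdef
  have h1 := (((hW.mul hW).mul hW).mul hg).avg_eq_zero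
  have h2 := (((hW.mul hW).mul hl).mul hg).avg_eq_zero
  set c := ContinuousMap.const Torus m with hc
  have hcW : avg (W ^ 3 * c) = m * avg (W ^ 3) := by
    have : W ^ 3 * c = m • W ^ 3 := by ext x; simp [hc, mul_comm]
    rw [this, map_smul, smul_eq_mul]
  have e1 : ((DW * W + W * DW) * W + W * W * DW) * g + W * W * W * (c - (W + Z)) =
      (3 : ℝ) • (W ^ 2 * g * DW) - W ^ 4 - W ^ 3 * Z + W ^ 3 * c := by
    have : (3 : ℝ) • (W ^ 2 * g * DW) = 3 * (W ^ 2 * g * DW) := by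
      rw [Algebra.smul_def, map_ofNat]
    rw [this]; ring
  have e2 : ((DW * W + W * DW) * Zl + W * W * DZl) * g + W * W * Zl * (c - (W + Z)) =
      2 * W * Zl * g * DW + W ^ 2 * DZl * g - W ^ 2 * Zl * (W + Z - c) := by ring
  rw [e1, map_add, map_sub, map_sub, map_smul, smul_eq_mul, hcW] at h1
  rw [e2, map_sub, map_add] at h2
  have e3 : flux (W + Z) * DW = W ^ 2 * g * DW + 2 * W * Zl * g * DW +
      (2 * W * (Z - Zl) * g * DW + Z ^ 2 * g * DW) := by
    rw [flux, ← hgdef]; ring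
  rw [e3, map_add, map_add]
  linarith

/-- The constant of the energy inequality. -/
def energyC (χ K : ℝ) : ℝ :=
  χ * (2 * K * (48 * K) ^ 3 + 6 * (51 * K ^ 2 + 8 * χ * K ^ 4) ^ 2 + 32 * χ * K ^ 6)

/-- Here y, p, c and d stand for the means of W⁴, W², |W|³ and (DW)², and G for the sup norm of the
potential gradient. Four error terms each consume y/24 of the available y/3; the remainders are
constants collected in `energyC`. -/
theorem energy_arith {χ K θ ε y p G c d : ℝ} (hχ : 0 < χ) (hK : 1 ≤ K) (hθ : 0 ≤ θ) (hθ' : θ ≤ 1)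
    (hε : 768 * ε ^ 2 * χ ≤ 1) (hp : 0 ≤ p) (hpy : p ^ 2 ≤ y)
    (hG : G ^ 2 ≤ 8 * p + 32 * K ^ 2) (hc : c ≤ y / (48 * K) + (48 * K) ^ 3)
    {I : ℝ} (hI : χ * θ * (1 / 3 * y - 2 * K * c - K * (G * p) - 2 * K ^ 2 * p) -
      θ * (4 * ε ^ 2 * χ ^ 2 * (G ^ 2 * p) + χ ^ 2 * K ^ 4 * G ^ 2) - 1 / 2 * d ≤ χ * θ * I) :
    -energyC χ K ≤ 1 / 2 * d + χ * θ * I := by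
  have hK0 : 0 < K := by linarith
  have h1 : 2 * K * c ≤ y / 24 + 2 * K * (48 * K) ^ 3 := by
    calc 2 * K * c ≤ 2 * K * (y / (48 * K) + (48 * K) ^ 3) := by gcongr
      _ = _ := by field_simp; ring
  have h2 : G ^ 2 * p ≤ 8 * y + 32 * K ^ 2 * p := by
    have := mul_le_mul_of_nonneg_right hG hp
    linarith
  -- Young with weight 96K, so that the coefficient 1/192 turns the 8y of the previous bound into
  -- y/24.
  have h3 : K * (G * p) ≤ G ^ 2 * p / 192 + 48 * K ^ 2 * p := by
    have := mul_nonneg hp (sq_nonneg (G - 96 * K))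
    linarith
  -- The smallness condition on ε is exactly 4 · 192 ε²χ ≤ 1.
  have h4 : 4 * ε ^ 2 * χ ^ 2 * (G ^ 2 * p) ≤ χ * (G ^ 2 * p / 192) := by
    have := mul_nonneg (by positivity : 0 ≤ χ * (G ^ 2 * p)) (sub_nonneg.2 hε)
    linarith
  have h5 : χ ^ 2 * K ^ 4 * G ^ 2 ≤ χ ^ 2 * K ^ 4 * (8 * p + 32 * K ^ 2) := by gcongr
  -- The coefficient 51 dominates 48 + 2 + 2 · 32/192, the total of the K² p terms.
  set B := 51 * K ^ 2 + 8 * χ * K ^ 4 with hB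
  have h6 : B * p ≤ y / 24 + 6 * B ^ 2 := by
    have := sq_nonneg (p - 12 * B)
    linarith
  have hy : 0 ≤ y := (sq_nonneg p).trans hpy
  have h9 : B * p = 51 * K ^ 2 * p + 8 * χ * K ^ 4 * p := by rw [hB]; ring
  have h10 : 0 ≤ K ^ 2 * p := by positivity
  set Q := 2 * K * (48 * K) ^ 3 + 6 * B ^ 2 + 32 * χ * K ^ 6 with hQ
  have hE : energyC χ K = χ * Q := rfl
  have hE0 : 0 ≤ energyC χ K := by rw [hE]; positivity
  have h8 : 0 ≤ 1 / 3 * y - 2 * K * c - K * (G * p) - 2 * K ^ 2 * p - G ^ 2 * p / 192 -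
      χ * K ^ 4 * (8 * p + 32 * K ^ 2) + Q := by
    have e : χ * K ^ 4 * (8 * p + 32 * K ^ 2) = 8 * χ * K ^ 4 * p + 32 * χ * K ^ 6 := by ring
    rw [e]
    linarith
  set X := 1 / 3 * y - 2 * K * c - K * (G * p) - 2 * K ^ 2 * p with hX
  have h11 := mul_nonneg hχ.le h8
  have h7 : -energyC χ K ≤ χ * X - (4 * ε ^ 2 * χ ^ 2 * (G ^ 2 * p) + χ ^ 2 * K ^ 4 * G ^ 2) := by
    rw [hE]
    linarith
  have h12 := mul_le_mul_of_nonneg_left h7 hθ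
  have h13 := mul_le_mul_of_nonneg_right hθ' hE0
  linarith

/-- Pointwise bounds of the terms of `avg_flux_mul_deriv`. The terms containing DW use half of the
dissipation; all others are of lower order than the quartic term or carry a small factor. -/
theorem energy_lower {χ K θ ε m : ℝ} (hχ : 0 < χ) (hK : 1 ≤ K) (hθ : 0 ≤ θ) (hθ' : θ ≤ 1)
    (hε : 768 * ε ^ 2 * χ ≤ 1) {W DW Z Zl DZl : C(Torus, ℝ)} (hW : IsDeriv W DW)
    (hl : IsDeriv Zl DZl) (hm : avg (W + Z) = m) (hmK : |m| ≤ K) (hZ : ‖Z‖ ≤ K) (hZl : ‖Zl‖ ≤ K)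
    (hDZl : ‖DZl‖ ≤ K) (hZh : ‖Z - Zl‖ ≤ ε) :
    -energyC χ K ≤ 1 / 2 * avg (DW ^ 2) + χ * θ * avg (flux (W + Z) * DW) := by
  set g := gradPotential (W + Z) with hg
  set G := ‖g‖ with hGdef
  have hG0 : 0 ≤ G := norm_nonneg _
  have hK0 : 0 < K := by linarith
  have hε0 : 0 ≤ ε := (norm_nonneg _).trans hZh
  set V : C(Torus, ℝ) := |W| ^ 3 with hV
  have hVx : ∀ x, V x = |W x| ^ 3 := fun x => by simp [hV]
  have hZx : ∀ x, |Z x| ≤ K := fun x => (Z.norm_coe_le_norm x).trans hZ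
  have hZlx : ∀ x, |Zl x| ≤ K := fun x => (Zl.norm_coe_le_norm x).trans hZl
  have hDx : ∀ x, |DZl x| ≤ K := fun x => (DZl.norm_coe_le_norm x).trans hDZl
  have hhx : ∀ x, |(Z - Zl) x| ≤ ε := fun x => ((Z - Zl).norm_coe_le_norm x).trans hZh
  have hgx : ∀ x, |g x| ≤ G := fun x => g.norm_coe_le_norm x
  have lower : ∀ {f h : C(Torus, ℝ)}, (∀ x, |f x| ≤ h x) → -avg h ≤ avg f := fun {f h} hfh => by
    rw [← map_neg]
    exact avg_mono fun x => (abs_le.1 (hfh x)).1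
  have hW3 : ∀ x, |W x ^ 3| = V x := fun x => by rw [abs_pow, hVx]
  have b1 : -avg (K • V) ≤ avg (W ^ 3 * Z) := lower fun x => by
    simp only [ContinuousMap.mul_apply, ContinuousMap.pow_apply, ContinuousMap.smul_apply,
      smul_eq_mul]
    rw [abs_mul, hW3, mul_comm]
    exact mul_le_mul_of_nonneg_right (hZx x) (by rw [← hW3]; positivity)
  have b2 : m * avg (W ^ 3) ≤ K * avg V := by
    have h1 : |avg (W ^ 3)| ≤ avg V := abs_le.2
      ⟨lower fun x => by rw [ContinuousMap.pow_apply, hW3], avg_mono fun x => by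
        rw [ContinuousMap.pow_apply, ← hW3]; exact le_abs_self _⟩
    calc m * avg (W ^ 3) ≤ |m| * |avg (W ^ 3)| := by rw [← abs_mul]; exact le_abs_self _
      _ ≤ _ := by gcongr
  have b3 : avg (W ^ 2 * DZl * g) ≤ avg ((K * G) • W ^ 2) := avg_mono fun x => by
    simp only [ContinuousMap.mul_apply, ContinuousMap.pow_apply, ContinuousMap.smul_apply,
      smul_eq_mul]
    have h1 : DZl x * g x ≤ K * G := (le_abs_self _).trans (by
      rw [abs_mul]; exact mul_le_mul (hDx x) (hgx x) (abs_nonneg _) hK0.le)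
    nlinarith [sq_nonneg (W x)]
  have b4 : -avg (K • V + (2 * K ^ 2) • W ^ 2) ≤
      avg (W ^ 2 * Zl * (W + Z - ContinuousMap.const Torus m)) := lower fun x => by
    simp only [ContinuousMap.mul_apply, ContinuousMap.pow_apply, ContinuousMap.smul_apply,
      smul_eq_mul, ContinuousMap.add_apply, ContinuousMap.sub_apply, ContinuousMap.const_apply]
    rw [hVx, abs_mul, abs_mul, abs_pow, ← sq_abs (W x)]
    have h1 : |W x + Z x - m| ≤ |W x| + 2 * K := by
      have h2 := abs_sub (W x + Z x) m
      have h3 := abs_add_le (W x) (Z x)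
      linarith [hZx x]
    calc |W x| ^ 2 * |Zl x| * |W x + Z x - m| ≤ |W x| ^ 2 * K * (|W x| + 2 * K) := by
          gcongr; exact hZlx x
      _ = _ := by ring
  have b5 : -avg ((1 / 2 : ℝ) • DW ^ 2 + θ • ((4 * ε ^ 2 * χ ^ 2 * G ^ 2) • W ^ 2 +
        ContinuousMap.const Torus (χ ^ 2 * K ^ 4 * G ^ 2))) ≤
      avg ((χ * θ) • (2 * W * (Z - Zl) * g * DW + Z ^ 2 * g * DW)) := lower fun x => by
    simp only [ContinuousMap.mul_apply, ContinuousMap.pow_apply, ContinuousMap.smul_apply,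
      smul_eq_mul, ContinuousMap.add_apply, ContinuousMap.const_apply]
    have e2 : (2 : C(Torus, ℝ)) x = 2 := rfl
    rw [e2, abs_mul, abs_of_nonneg (by positivity : 0 ≤ χ * θ)]
    have h1 := abs_add_le (2 * W x * (Z - Zl) x * g x * DW x) (Z x ^ 2 * g x * DW x)
    have h2 : |2 * W x * (Z - Zl) x * g x * DW x| ≤ 2 * |W x| * ε * G * |DW x| := by
      rw [abs_mul, abs_mul, abs_mul, abs_mul, abs_two]
      gcongr
      · exact hhx x
      · exact hgx x
    have h3 : |Z x ^ 2 * g x * DW x| ≤ K ^ 2 * G * |DW x| := by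
      rw [abs_mul, abs_mul, abs_pow]
      gcongr
      · exact hZx x
      · exact hgx x
    have h4 : χ * θ * (|2 * W x * (Z - Zl) x * g x * DW x + Z x ^ 2 * g x * DW x|) ≤
        χ * θ * (2 * |W x| * ε * G * |DW x| + K ^ 2 * G * |DW x|) := by gcongr; linarith
    refine h4.trans ?_
    -- Completing squares produces θ², while the quartic term is only available with weight θ; as θ
    -- ≤ 1, the errors still carry a factor θ.
    have hθ2 : θ ^ 2 ≤ θ := by nlinarith
    have hA : θ ^ 2 * (4 * ε ^ 2 * χ ^ 2 * G ^ 2 * W x ^ 2 + χ ^ 2 * K ^ 4 * G ^ 2) ≤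
        θ * (4 * ε ^ 2 * χ ^ 2 * G ^ 2 * W x ^ 2 + χ ^ 2 * K ^ 4 * G ^ 2) :=
      mul_le_mul_of_nonneg_right hθ2 (by positivity)
    refine le_trans ?_ (add_le_add_right hA _)
    rw [← sq_abs (W x), ← sq_abs (DW x)]
    nlinarith [sq_nonneg (|DW x| / 2 - 2 * χ * θ * ε * G * |W x|),
      sq_nonneg (|DW x| / 2 - χ * θ * K ^ 2 * G)]
  have hid := avg_flux_mul_deriv hW hl hm
  -- Pointwise split at |W| = 48K: below it the cube is bounded, above it the quartic dominates.
  have hc : avg V ≤ avg (W ^ 4) / (48 * K) + (48 * K) ^ 3 := by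
    have h1 : avg V ≤ avg ((1 / (48 * K)) • W ^ 4 + ContinuousMap.const Torus ((48 * K) ^ 3)) :=
      avg_mono fun x => by
        simp only [ContinuousMap.pow_apply, ContinuousMap.smul_apply, smul_eq_mul,
          ContinuousMap.add_apply, ContinuousMap.const_apply]
        have h48 : 0 < 48 * K := by positivity
        have e4 : W x ^ 4 = |W x| ^ 4 := by rw [← abs_pow]; exact (abs_of_nonneg (by positivity)).symm
        rw [hVx, e4]
        rcases le_total (|W x|) (48 * K) with h | h
        · have : |W x| ^ 3 ≤ (48 * K) ^ 3 := by gcongr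
          have h2 : 0 ≤ 1 / (48 * K) * |W x| ^ 4 := by positivity
          linarith
        · have : |W x| ^ 3 ≤ 1 / (48 * K) * |W x| ^ 4 := by
            rw [one_div, inv_mul_eq_div, le_div_iff₀ h48, pow_succ (|W x|) 3]
            gcongr
          have h2 : 0 ≤ (48 * K) ^ 3 := by positivity
          linarith
    rw [map_add, map_smul, avg_const, smul_eq_mul] at h1
    refine h1.trans (le_of_eq ?_)
    ring
  have hp : 0 ≤ avg (W ^ 2) := avg_nonneg fun x => sq_nonneg _
  have hpy : avg (W ^ 2) ^ 2 ≤ avg (W ^ 4) := by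
    have := sq_avg_le (W ^ 2)
    rwa [← pow_mul] at this
  have hG := sq_norm_gradPotential_le (W := W) hZ (by rw [hm]; exact hmK)
  rw [← hg, ← hGdef] at hG
  simp only [map_add, map_smul, smul_eq_mul, avg_const] at b1 b3 b4 b5
  refine energy_arith hχ hK hθ hθ' hε hp hpy hG hc ?_
  rw [hid]
  have hχθ : 0 ≤ χ * θ := by positivity
  have h9 : χ * θ * (1 / 3 * avg (W ^ 4) - 2 * K * avg V - K * (G * avg (W ^ 2)) -
      2 * K ^ 2 * avg (W ^ 2)) ≤ χ * θ * (1 / 3 * avg (W ^ 4) + 1 / 3 * avg (W ^ 3 * Z) -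
      m / 3 * avg (W ^ 3) - avg (W ^ 2 * DZl * g) +
      avg (W ^ 2 * Zl * (W + Z - ContinuousMap.const Torus m))) := by
    refine mul_le_mul_of_nonneg_left ?_ hχθ
    have hV0 : 0 ≤ avg V := avg_nonneg fun x => by rw [← hW3]; positivity
    have := mul_nonneg hK0.le hV0
    linarith
  rw [← hg, mul_add]
  rw [map_add]
  linarith

/-! ### Evolution of the Fourier modes -/

/-- The `n`-th Fourier coefficient of a real function. -/
def coefR (n : ℤ) : C(Torus, ℝ) →L[ℝ] ℂ := (coefC n).restrictScalars ℝ ∘L toC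

theorem coefR_apply (n : ℤ) (f : C(Torus, ℝ)) : coefR n f = coefC n (toC f) := rfl

theorem norm_coefR_le (n : ℤ) (f : C(Torus, ℝ)) : ‖coefR n f‖ ≤ ‖f‖ :=
  (norm_coefC_le n _).trans (norm_toC f).le

theorem coefR_zero (f : C(Torus, ℝ)) : coefR 0 f = avg f := by
  have h : (toDist f).1 (sinTest 0) = 0 := by
    have : sinTest 0 = 0 := by ext x; simp [sinTest]
    rw [this, map_zero]
  rw [coefR_apply, ← fourierCoef_toDist, fourierCoef, h, ← mean, mean_toDist_eq_avg]
  simp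

theorem fourierCoef_zero (u : PeriodicDist) : fourierCoef u 0 = mean u := by
  have : sinTest 0 = 0 := by ext x; simp [sinTest]
  rw [fourierCoef, this, map_zero, ← mean]
  simp

theorem coefR_heatC {t : ℝ} (ht : 0 < t) (u : PeriodicDist) (n : ℤ) :
    coefR n (heatC t u) = he t n * fourierCoef u n := by
  rw [coefR_apply, toC_heatC ht, coefC_trigSum (summable_he_mul u ht)]

theorem he_sub (t s : ℝ) (n : ℤ) : he (t - s) n = he t n * he (-s) n := by
  rw [he, he, he, heR, heR, heR, ← Complex.ofReal_mul, ← Real.exp_add]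
  congr 3; ring

/-- On a single mode e^{(t-s)Δ} factors as e^{tΔ} e^{-sΔ}, so t leaves the integrand and the
fundamental theorem of calculus applies. -/
theorem coefR_duh {T δ B q t : ℝ} (hδ : 0 < δ) (hδ' : δ < 1) (hq : 0 ≤ q) (hq' : q < 1)
    (ht : t ∈ Ioc 0 T) {F : ℝ → C(Torus, ℝ)} (hF : ContinuousOn F (Ioc 0 T))
    (hB : ∀ s ∈ Ioc 0 T, ‖F s‖ ≤ B * s ^ (-q)) (n : ℤ) :
    coefR n (duh F t) = he t n * (dx n * ∫ s in (0 : ℝ)..t, he (-s) n * coefR n (F s)) := by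
  rw [duh, ← ContinuousLinearMap.intervalIntegral_comp_comm _
    (intervalIntegrable_hk_of_bound hδ hδ' hq hq' ht hF hB), ← mul_assoc,
    ← intervalIntegral.integral_const_mul]
  refine intervalIntegral.integral_congr_ae ?_
  rw [uIoc_of_le ht.1.le]
  refine ae_mem_Ioo_of_mem_Ioc t fun s hs hst => ?_
  rw [coefR_apply, hk, coefC_mulR (summable_ker (by linarith)) (herm_ker _), ker, he_sub,
    coefR_apply]
  ring

theorem intervalIntegrable_mode {T B q t : ℝ} (hq' : q < 1)
    (ht : t ∈ Ioc 0 T) {F : ℝ → C(Torus, ℝ)} (hF : ContinuousOn F (Ioc 0 T))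
    (hB : ∀ s ∈ Ioc 0 T, ‖F s‖ ≤ B * s ^ (-q)) (n : ℤ) :
    IntervalIntegrable (fun s => he (-s) n * coefR n (F s)) volume 0 t := by
  have h1 : IntervalIntegrable (fun s : ℝ => heR (-t) n * (B * s ^ (-q))) volume 0 t :=
    ((intervalIntegral.intervalIntegrable_rpow' (by linarith)).const_mul _).const_mul _
  have hc : ContinuousOn (fun s => he (-s) n * coefR n (F s)) (Ioc 0 t) :=
    ((continuous_he n).comp continuous_neg).continuousOn.mul
      ((coefR n).continuous.comp_continuousOn (hF.mono (Ioc_subset_Ioc_right ht.2)))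
  rw [intervalIntegrable_iff_integrableOn_Ioc_of_le ht.1.le] at h1 ⊢
  refine Integrable.mono' h1 (hc.aestronglyMeasurable measurableSet_Ioc) ?_
  rw [ae_restrict_iff' measurableSet_Ioc]
  refine ae_of_all _ fun s hs => ?_
  rw [norm_mul, norm_he]
  exact mul_le_mul (heR_antitone (by linarith [hs.2]) n)
    ((norm_coefR_le n _).trans (hB s ⟨hs.1, hs.2.trans ht.2⟩)) (norm_nonneg _) (heR_pos _ n).le

theorem hasDerivAt_he (t : ℝ) (n : ℤ) : HasDerivAt (fun t => he t n) (dx n * dx n * he t n) t := by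
  have h1 : HasDerivAt (fun t : ℝ => -4 * Real.pi ^ 2 * (n : ℝ) ^ 2 * t)
      (-4 * Real.pi ^ 2 * (n : ℝ) ^ 2) t :=
    ((hasDerivAt_id t).const_mul _).congr_deriv (mul_one _)
  refine h1.exp.ofReal_comp.congr_deriv ?_
  rw [he, heR, dx]
  push_cast
  have := Complex.I_sq
  linear_combination (-(4 * (Real.pi : ℂ) ^ 2 * n ^ 2 *
    Complex.exp (-4 * Real.pi ^ 2 * n ^ 2 * t))) * this

/-- Conservation of mass: the source is a derivative, so the zero mode does not evolve. -/
theorem coefR_zero_of_duhamel {T δ B q t : ℝ} (hδ : 0 < δ) (hδ' : δ < 1) (hq : 0 ≤ q)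
    (hq' : q < 1) (ht : t ∈ Ioc 0 T) {F w : ℝ → C(Torus, ℝ)} {ζ : PeriodicDist}
    (hF : ContinuousOn F (Ioc 0 T)) (hB : ∀ s ∈ Ioc 0 T, ‖F s‖ ≤ B * s ^ (-q))
    (hw : w t = heatC t ζ + duh F t) : avg (w t) = mean ζ := by
  have h1 : coefR 0 (w t) = mean ζ := by
    rw [hw, map_add, coefR_heatC ht.1, coefR_duh hδ hδ' hq hq' ht hF hB, fourierCoef_zero]
    have h2 : dx 0 = 0 := by simp [dx]
    have h3 : he t 0 = 1 := by simp [he, heR]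
    rw [h2, h3, zero_mul, mul_zero, add_zero, one_mul]
  rw [coefR_zero] at h1
  exact_mod_cast h1

theorem hasDerivAt_coefR {T δ B q t : ℝ} (hδ : 0 < δ) (hδ' : δ < 1) (hq : 0 ≤ q) (hq' : q < 1)
    (ht : t ∈ Ioo 0 T) {F w : ℝ → C(Torus, ℝ)} {ζ : PeriodicDist} (hF : ContinuousOn F (Ioc 0 T))
    (hB : ∀ s ∈ Ioc 0 T, ‖F s‖ ≤ B * s ^ (-q))
    (hw : ∀ t ∈ Ioc 0 T, w t = heatC t ζ + duh F t) (n : ℤ) :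
    HasDerivAt (fun t => coefR n (w t))
      (dx n * dx n * coefR n (w t) + dx n * coefR n (F t)) t := by
  have hopen : Ioo 0 T ∈ 𝓝 t := isOpen_Ioo.mem_nhds ht
  have hc : ContinuousOn (fun s => he (-s) n * coefR n (F s)) (Ioo 0 T) :=
    ((continuous_he n).comp continuous_neg).continuousOn.mul
      ((coefR n).continuous.comp_continuousOn (hF.mono Ioo_subset_Ioc_self))
  have h1 := intervalIntegral.integral_hasDerivAt_right
    (intervalIntegrable_mode hq' (Ioo_subset_Ioc_self ht) hF hB n)
    (hc.stronglyMeasurableAtFilter isOpen_Ioo t ht) (hc.continuousAt hopen)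
  have h2 := (hasDerivAt_he t n).mul ((h1.const_mul (dx n)).const_add (fourierCoef ζ n))
  have e : ∀ t ∈ Ioc 0 T, coefR n (w t) = he t n *
      (fourierCoef ζ n + dx n * ∫ s in (0 : ℝ)..t, he (-s) n * coefR n (F s)) := fun t ht => by
    rw [hw t ht, map_add, coefR_heatC ht.1, coefR_duh hδ hδ' hq hq' ht hF hB]; ring
  refine (h2.congr_of_eventuallyEq ?_).congr_deriv ?_
  · filter_upwards [hopen] with s hs using e s (Ioo_subset_Ioc_self hs)
  · rw [e t (Ioo_subset_Ioc_self ht)]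
    have h3 : he t n * he (-t) n = 1 := by
      rw [← he_sub, sub_self]; simp [he, heR]
    linear_combination (dx n * coefR n (F t)) * h3

/-- The truncation involves finitely many modes, each solving an ordinary differential equation;
this gives a classical energy identity without spatial regularity of w. -/
theorem hasDerivAt_trunc_time {T δ B q t : ℝ} (hδ : 0 < δ) (hδ' : δ < 1) (hq : 0 ≤ q) (hq' : q < 1)
    (ht : t ∈ Ioo 0 T) {F w : ℝ → C(Torus, ℝ)} {ζ : PeriodicDist} (hF : ContinuousOn F (Ioc 0 T))
    (hB : ∀ s ∈ Ioc 0 T, ‖F s‖ ≤ B * s ^ (-q))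
    (hw : ∀ t ∈ Ioc 0 T, w t = heatC t ζ + duh F t) (J : ℕ) :
    HasDerivAt (fun t => trunc J (w t)) (mulR (fun n => dx n * (dx n * cu J n)) (w t) +
      mulR (fun n => dx n * cu J n) (F t)) t := by
  have h0 : ∀ n ∉ modes J, cu J n = 0 := fun _ hn => cu_eq_zero_of_notMem hn
  have h1 : ∀ n ∉ modes J, dx n * cu J n = 0 := fun n hn => by rw [h0 n hn, mul_zero]
  have h2 : ∀ n ∉ modes J, dx n * (dx n * cu J n) = 0 := fun n hn => by rw [h1 n hn, mul_zero]
  have h : HasDerivAt (fun t => ∑ n ∈ modes J, (cu J n * coefR n (w t)) • fou n)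
      (∑ n ∈ modes J, (cu J n * (dx n * dx n * coefR n (w t) + dx n * coefR n (F t))) • fou n) t :=
    HasDerivAt.fun_sum fun n _ =>
      ((hasDerivAt_coefR hδ hδ' hq hq' ht hF hB hw n).const_mul (cu J n)).smul_const (fou n)
  have h3 := reC.hasFDerivAt.comp_hasDerivAt t h
  rw [mulR_eq_sum h2, mulR_eq_sum h1, ← map_add, ← Finset.sum_add_distrib]
  refine (h3.congr_of_eventuallyEq (Eventually.of_forall fun t => ?_)).congr_deriv ?_
  · exact mulR_eq_sum h0 (w t)
  · congr 1
    refine Finset.sum_congr rfl fun n _ => ?_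
    rw [← add_smul]
    congr 1
    simp only [coefR_apply]
    ring

/-! ### Growth of the energy -/

theorem l2sq_eq_avg (f : C(Torus, ℝ)) : l2sq f = avg (f ^ 2) := rfl

theorem hasDerivAt_energy {T δ B q t : ℝ} (hδ : 0 < δ) (hδ' : δ < 1) (hq : 0 ≤ q) (hq' : q < 1)
    (ht : t ∈ Ioo 0 T) {F w : ℝ → C(Torus, ℝ)} {ζ : PeriodicDist} (hF : ContinuousOn F (Ioc 0 T))
    (hB : ∀ s ∈ Ioc 0 T, ‖F s‖ ≤ B * s ^ (-q))
    (hw : ∀ t ∈ Ioc 0 T, w t = heatC t ζ + duh F t) (J : ℕ) :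
    HasDerivAt (fun t => l2sq (trunc J (w t)))
      (-(2 * avg (mulR (fun n => dx n * cu J n) (w t) ^ 2)) -
        2 * avg (trunc J (F t) * mulR (fun n => dx n * cu J n) (w t))) t := by
  have h1 := hasDerivAt_trunc_time hδ hδ' hq hq' ht hF hB hw J
  have h2 := avg.hasFDerivAt.comp_hasDerivAt t (h1.mul h1)
  have hW := isDeriv_trunc J (w t)
  have hDW : IsDeriv (mulR (fun n => dx n * cu J n) (w t))
      (mulR (fun n => dx n * (dx n * cu J n)) (w t)) :=
    isDeriv_mulR (s := modes J) (fun n hn => by rw [cu_eq_zero_of_notMem hn, mul_zero]) (w t)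
  -- Mean zero of the derivative of W(DW + G): this is the integration by parts in space.
  have h3 := (hW.mul (hDW.add (isDeriv_trunc J (F t)))).avg_eq_zero
  refine (h2.congr_of_eventuallyEq (Eventually.of_forall fun t => ?_)).congr_deriv ?_
  · rw [l2sq_eq_avg, sq]; rfl
  · set W := trunc J (w t)
    set DW := mulR (fun n => dx n * cu J n) (w t)
    set D2 := mulR (fun n => dx n * (dx n * cu J n)) (w t)
    set G := trunc J (F t)
    set DG := mulR (fun n => dx n * cu J n) (F t)
    have e1 : DW * (DW + G) + W * (D2 + DG) = DW ^ 2 + G * DW + W * (D2 + DG) := by ring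
    have e2 : (D2 + DG) * W + W * (D2 + DG) = W * (D2 + DG) + W * (D2 + DG) := by ring
    rw [e1, map_add, map_add] at h3
    rw [e2, map_add]
    linarith

theorem tflux_eq_smul (χ M γ s : ℝ) (u : C(Torus, ℝ)) :
    tflux χ M γ s u = (χ * (M * s ^ (-γ) / max (M * s ^ (-γ)) ‖u‖) ^ 3) • flux u := by
  rw [tflux, flux_ret, smul_smul]

/-- The growth rate of the energy. -/
theorem exists_energyRate {α : ℝ} (χ R : ℝ) (hα : 0 < α) (hχ : 0 < χ) : ∃ C : ℝ, 0 ≤ C ∧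
    ∀ (W DW Z : C(Torus, ℝ)) (θ : ℝ), IsDeriv W DW → |avg W| ≤ 1 → avg Z = 0 → 0 ≤ θ → θ ≤ 1 →
      (∀ j : ℕ, ‖blk j Z‖ ≤ R * 2 ^ (-(α * ((j : ℝ) - 1)))) →
      -C ≤ 1 / 2 * avg (DW ^ 2) + χ * θ * avg (flux (W + Z) * DW) := by
  -- Since α > 0, the high-frequency part of the noise tends to 0 in sup norm; L is a truncation
  -- scale, depending on R, α and χ only, at which it meets the smallness condition of
  -- `energy_lower`.
  obtain ⟨L, hL⟩ : ∃ L : ℕ,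
      768 * (R * (2 ^ (-(α * L)) * (1 - 2 ^ (-α))⁻¹)) ^ 2 * χ ≤ 1 := by
    have h1 : Tendsto (fun L : ℕ => (2 : ℝ) ^ (-(α * L))) atTop (𝓝 0) := by
      have h2 : Tendsto (fun L : ℕ => ((2 : ℝ) ^ (-α)) ^ L) atTop (𝓝 0) :=
        tendsto_pow_atTop_nhds_zero_of_lt_one (by positivity)
          (Real.rpow_lt_one_of_one_lt_of_neg one_lt_two (by linarith))
      refine h2.congr fun L => ?_
      rw [← Real.rpow_natCast, ← Real.rpow_mul zero_le_two, neg_mul]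
    have h3 : Tendsto (fun L : ℕ => 768 * (R * (2 ^ (-(α * L)) * (1 - 2 ^ (-α))⁻¹)) ^ 2 * χ) atTop
        (𝓝 (768 * (R * (0 * (1 - 2 ^ (-α))⁻¹)) ^ 2 * χ)) :=
      ((((h1.mul_const _).const_mul R).pow 2).const_mul 768).mul_const χ
    have h4 : 768 * (R * (0 * (1 - (2 : ℝ) ^ (-α))⁻¹)) ^ 2 * χ < 1 := by norm_num
    exact (h3.eventually (Iic_mem_nhds h4)).exists
  set b := ∑' n, ‖dx n * cu L n‖ with hb
  have hb0 : 0 ≤ b := tsum_nonneg fun _ => norm_nonneg _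
  have hemb := embC_pos hα
  have hlip := one_le_lipC
  -- One number bounding the mean, Z, its low-frequency part and the derivative of the latter.
  set K := 1 + (4 * lipC + b + 1) * (embC α * |R|) with hK
  have hK1 : 1 ≤ K := by
    have : 0 ≤ (4 * lipC + b + 1) * (embC α * |R|) := by positivity
    linarith
  refine ⟨energyC χ K, by unfold energyC; positivity, ?_⟩
  intro W DW Z θ hW hm hZ hθ hθ' hR
  have hZn : ‖Z‖ ≤ embC α * |R| :=
    (norm_le_of_blk hα hR).trans (mul_le_mul_of_nonneg_left (le_abs_self R) hemb.le)
  have hN := norm_nonneg Z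
  have hsm : Summable fun n => ‖dx n * cu L n‖ :=
    summable_of_ne_finset_zero (s := modes L) fun n hn => by
      rw [cu_eq_zero_of_notMem hn, mul_zero, norm_zero]
  have k1 : 0 ≤ b * (embC α * |R|) := by positivity
  have k2 : 0 ≤ 4 * lipC * (embC α * |R|) := by positivity
  have k3 : 0 ≤ embC α * |R| := by positivity
  refine energy_lower hχ hK1 hθ hθ' hL hW (isDeriv_trunc L Z) rfl ?_ ?_ ?_ ?_
    (norm_sub_trunc_le hα hR L)
  · rw [map_add, hZ, add_zero]; linarith
  · rw [hK]; linarith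
  · refine (norm_trunc_le L Z).trans ?_
    have : 4 * lipC * ‖Z‖ ≤ 4 * lipC * (embC α * |R|) := by gcongr
    rw [hK]; linarith
  · refine (norm_mulR_le_sum hsm Z).trans ?_
    have : b * ‖Z‖ ≤ b * (embC α * |R|) := by gcongr
    rw [hK]; linarith

theorem avg_trunc (J : ℕ) (f : C(Torus, ℝ)) : avg (trunc J f) = avg f := by
  have h : coefR 0 (trunc J f) = coefR 0 f := by
    rw [coefR_apply, trunc, coefC_mulR (summable_cu J) (herm_cu J), cu_eq_one (by simp), one_mul,
      coefR_apply]
  rw [coefR_zero, coefR_zero] at h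
  exact_mod_cast h

theorem avg_mul_ge (r D : C(Torus, ℝ)) :
    -(1 / 2 * avg (D ^ 2) + 1 / 2 * ‖r‖ ^ 2) ≤ avg (r * D) := by
  have h : avg (-((1 / 2 : ℝ) • D ^ 2 + ContinuousMap.const Torus (1 / 2 * ‖r‖ ^ 2))) ≤
      avg (r * D) := avg_mono fun x => by
    simp only [ContinuousMap.neg_apply, ContinuousMap.add_apply, ContinuousMap.smul_apply,
      ContinuousMap.pow_apply, ContinuousMap.const_apply, ContinuousMap.mul_apply, smul_eq_mul]
    have h1 : |r x| ≤ ‖r‖ := r.norm_coe_le_norm x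
    have h2 : r x ^ 2 ≤ ‖r‖ ^ 2 := sq_le_sq' (abs_le.1 h1).1 (abs_le.1 h1).2
    nlinarith [sq_nonneg (r x + D x)]
  rw [map_neg, map_add, map_smul, avg_const, smul_eq_mul] at h
  exact h

/-- Galerkin argument: the energy inequality is applied to `trunc J (w t)`. Truncation does not
commute with the flux, and the commutator error r J tends to 0. Half of the dissipation absorbs that
error, the other half enters `energy_lower`. -/
theorem l2sq_le_of_truncSol {χ M γ T δ α R : ℝ} {C : ℝ} (hχ : 0 < χ) (hδ : 0 < δ)
    (hδ' : δ < 1) (hγ : 0 ≤ γ) (hγ' : 3 * γ < 1) (hM : 0 < M) {ζ : PeriodicDist} {Z w : ℝ → C(Torus, ℝ)}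
    (hC : ∀ (W DW Z : C(Torus, ℝ)) (θ : ℝ), IsDeriv W DW → |avg W| ≤ 1 → avg Z = 0 → 0 ≤ θ →
      θ ≤ 1 → (∀ j : ℕ, ‖blk j Z‖ ≤ R * 2 ^ (-(α * ((j : ℝ) - 1)))) →
      -C ≤ 1 / 2 * avg (DW ^ 2) + χ * θ * avg (flux (W + Z) * DW))
    (hζ : |mean ζ| ≤ 1) (hZ : ContinuousOn Z (Ioc 0 T)) (hZ0 : ∀ t ∈ Ioc 0 T, avg (Z t) = 0)
    (hZR : ∀ t ∈ Ioc 0 T, ∀ j : ℕ, ‖blk j (Z t)‖ ≤ R * 2 ^ (-(α * ((j : ℝ) - 1))))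
    (h : IsTruncSol χ M γ T (fun t => heatC t ζ) Z w) {a b : ℝ} (ha : 0 < a) (hab : a ≤ b)
    (hbT : b ≤ T) : l2sq (w b) ≤ l2sq (w a) + 2 * C * (b - a) := by
  set F : ℝ → C(Torus, ℝ) := fun s => tflux χ M γ s (w s + Z s) with hF
  have hFc : ContinuousOn F (Ioc 0 T) :=
    continuousOn_tflux hM (fun s hs => hs.1) (h.cont.add hZ)
  have hFb : ∀ s ∈ Ioc 0 T, ‖F s‖ ≤ 4 * |χ| * M ^ 3 * s ^ (-(3 * γ)) := fun s hs =>
    norm_tflux_le hM hs.1 _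
  have hq : 0 ≤ 3 * γ := by linarith
  have hsub : Icc a b ⊆ Ioc 0 T := fun s hs => ⟨ha.trans_le hs.1, hs.2.trans hbT⟩
  set θ : ℝ → ℝ := fun s => (M * s ^ (-γ) / max (M * s ^ (-γ)) ‖w s + Z s‖) ^ 3 with hθ
  have hθ0 : ∀ s ∈ Icc a b, 0 ≤ θ s := fun s hs =>
    pow_nonneg (ret_coeff_nonneg (level_pos hM (hsub hs).1 γ) _) 3
  have hθ1 : ∀ s ∈ Icc a b, θ s ≤ 1 := fun s hs =>
    pow_le_one₀ (ret_coeff_nonneg (level_pos hM (hsub hs).1 γ) _)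
      (ret_coeff_le_one (level_pos hM (hsub hs).1 γ) _)
  have hwc : ContinuousOn w (Icc a b) := h.cont.mono hsub
  have hZc : ContinuousOn Z (Icc a b) := hZ.mono hsub
  have hθc : ContinuousOn θ (Icc a b) := by
    have h1 : ContinuousOn (fun s : ℝ => M * s ^ (-γ)) (Icc a b) :=
      continuousOn_const.mul (continuousOn_id.rpow_const fun s hs => Or.inl (hsub hs).1.ne')
    exact (h1.div (h1.sup (hwc.add hZc).norm) fun s hs =>
      (lt_max_of_lt_left (level_pos hM (hsub hs).1 γ)).ne').pow 3
  -- The truncated flux is the true flux times a number θ s in [0,1], so C does not depend on M.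
  have hFθ : ∀ s, F s = (χ * θ s) • flux (w s + Z s) := fun s => tflux_eq_smul _ _ _ _ _
  set r : ℕ → ℝ → C(Torus, ℝ) := fun J s =>
    trunc J (F s) - (χ * θ s) • flux (trunc J (w s) + Z s) with hr
  have hrc : ∀ J, ContinuousOn (r J) (Icc a b) := fun J =>
    ((trunc J).continuous.comp_continuousOn (hFc.mono hsub)).sub
      ((continuousOn_const.mul hθc).smul (continuous_flux.comp_continuousOn
        (((trunc J).continuous.comp_continuousOn hwc).add hZc)))
  have key : ∀ J, l2sq (trunc J (w b)) - l2sq (trunc J (w a)) ≤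
      2 * C * (b - a) + ∫ s in a..b, ‖r J s‖ ^ 2 := fun J => by
    have hint : IntervalIntegrable (fun s => ‖r J s‖ ^ 2) volume a b :=
      ContinuousOn.intervalIntegrable_of_Icc hab ((hrc J).norm.pow 2)
    have e : 2 * C * (b - a) + ∫ s in a..b, ‖r J s‖ ^ 2 =
        ∫ s in a..b, (2 * C + ‖r J s‖ ^ 2) := by
      rw [intervalIntegral.integral_add (by simp) hint]
      simp; ring
    rw [e]
    refine intervalIntegral.sub_le_integral_of_hasDeriv_right_of_le hab
      (g := fun t => l2sq (trunc J (w t))) ?_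
      (fun t ht => (hasDerivAt_energy (T := T) hδ hδ' hq hγ' ⟨ha.trans ht.1, ht.2.trans_le hbT⟩ hFc
        hFb h.eq J).hasDerivWithinAt) ?_ fun t ht => ?_
    · exact avg.continuous.comp_continuousOn
        (((trunc J).continuous.comp_continuousOn hwc).pow 2)
    · exact (continuousOn_const.add ((hrc J).norm.pow 2)).integrableOn_Icc
    · have ht' : t ∈ Icc a b := Ioo_subset_Icc_self ht
      have h1 := hC (trunc J (w t)) _ (Z t) (θ t) (isDeriv_trunc J (w t))
        (by rw [avg_trunc, coefR_zero_of_duhamel hδ hδ' hq hγ' (hsub ht') hFc hFb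
          (h.eq t (hsub ht'))]; exact hζ)
        (hZ0 t (hsub ht')) (hθ0 t ht') (hθ1 t ht') (hZR t (hsub ht'))
      have h2 := avg_mul_ge (r J t) (mulR (fun n => dx n * cu J n) (w t))
      set DW := mulR (fun n => dx n * cu J n) (w t)
      have e2 : trunc J (F t) * DW = r J t * DW + (χ * θ t) • (flux (trunc J (w t) + Z t) * DW) := by
        rw [hr]
        simp only [sub_mul, smul_mul_assoc, sub_add_cancel]
      rw [e2, map_add, map_smul, smul_eq_mul]
      linarith
  -- Dominated convergence on [a,b], which stays away from the singular time 0, so w and the flux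
  -- are bounded there.
  have hlim : Tendsto (fun J => ∫ s in a..b, ‖r J s‖ ^ 2) atTop (𝓝 0) := by
    obtain ⟨Bw, hBw⟩ := isCompact_Icc.exists_bound_of_continuousOn hwc
    obtain ⟨BZ, hBZ⟩ := isCompact_Icc.exists_bound_of_continuousOn hZc
    obtain ⟨BF, hBF⟩ := isCompact_Icc.exists_bound_of_continuousOn (hFc.mono hsub)
    have hl := one_le_lipC
    have hlim0 : Tendsto (fun J => ∫ s in a..b, ‖r J s‖ ^ 2) atTop (𝓝 (∫ s in a..b, (0 : ℝ))) := by
      refine intervalIntegral.tendsto_integral_filter_of_dominated_convergence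
        (fun _ => (4 * lipC * BF + χ * (4 * (4 * lipC * Bw + BZ) ^ 3)) ^ 2) ?_ ?_ (by simp) ?_
      · refine Eventually.of_forall fun J => ?_
        rw [uIoc_of_le hab]
        exact (((hrc J).norm.pow 2).mono Ioc_subset_Icc_self).aestronglyMeasurable measurableSet_Ioc
      · refine Eventually.of_forall fun J => ae_of_all _ fun s hs => ?_
        rw [uIoc_of_le hab] at hs
        have hs' := Ioc_subset_Icc_self hs
        rw [norm_pow, norm_norm]
        refine pow_le_pow_left₀ (norm_nonneg _) ((norm_sub_le _ _).trans (add_le_add ?_ ?_)) 2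
        · exact (norm_trunc_le J _).trans (mul_le_mul_of_nonneg_left (hBF s hs') (by linarith))
        · rw [norm_smul, norm_mul, Real.norm_of_nonneg hχ.le, Real.norm_of_nonneg (hθ0 s hs'),
            mul_assoc]
          refine mul_le_mul_of_nonneg_left ?_ hχ.le
          refine (mul_le_of_le_one_left (norm_nonneg _) (hθ1 s hs')).trans ?_
          refine (norm_flux_le _).trans ?_
          gcongr
          refine (norm_add_le _ _).trans (add_le_add ?_ (hBZ s hs'))
          exact (norm_trunc_le J _).trans (mul_le_mul_of_nonneg_left (hBw s hs') (by linarith))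
      · refine ae_of_all _ fun s _ => ?_
        have h1 : Tendsto (fun J => r J s) atTop
            (𝓝 (F s - (χ * θ s) • flux (w s + Z s))) :=
          (tendsto_trunc (F s)).sub (((continuous_flux.tendsto _).comp
            ((tendsto_trunc (w s)).add_const (Z s))).const_smul _)
        rw [← hFθ, sub_self] at h1
        simpa using h1.norm.pow 2
    simpa using hlim0
  have hl : ∀ t, Tendsto (fun J => l2sq (trunc J (w t))) atTop (𝓝 (l2sq (w t))) := fun t =>
    (avg.continuous.tendsto _).comp ((tendsto_trunc (w t)).pow 2)
  have := le_of_tendsto_of_tendsto' ((hl b).sub (hl a)) (tendsto_const_nhds.add hlim) key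
  linarith

/-! ### Short times -/

theorem tflux_of_le {χ M γ s : ℝ} (hM : 0 < M) (hs : 0 < s) {u : C(Torus, ℝ)}
    (h : ‖u‖ ≤ M * s ^ (-γ)) : tflux χ M γ s u = χ • flux u := by
  rw [tflux, ret_of_le (level_pos hM hs γ) h]

theorem duh_congr {F G : ℝ → C(Torus, ℝ)} {t : ℝ} (ht : 0 ≤ t) (h : ∀ s ∈ Ioc 0 t, F s = G s) :
    duh F t = duh G t := by
  refine intervalIntegral.integral_congr_ae ?_
  rw [uIoc_of_le ht]
  exact ae_of_all _ fun s hs => by rw [h s hs]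

/-- The solution truncated at the fixed level M₀ never reaches that level before t₀, hence solves
the equation truncated at every higher level too; uniqueness identifies it with the given w. Both M₀
and t₀ are independent of M. -/
theorem exists_shortTime {T δ γ A E : ℝ} (χ : ℝ) (hT : 0 < T) (hδ : 0 < δ) (hδ' : δ < 1)
    (hγ : 0 ≤ γ) (hpγ : (1 + δ) / 2 + 2 * γ < 1) (hA : 0 ≤ A) (hE : 0 ≤ E) :
    ∃ M₀ : ℝ, 0 < M₀ ∧ ∃ t₀ ∈ Ioc 0 T, ∀ H Z : ℝ → C(Torus, ℝ), ContinuousOn H (Ioc 0 T) →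
      (∀ t ∈ Ioc 0 T, ‖H t‖ ≤ A * t ^ (-γ)) → ContinuousOn Z (Ioc 0 T) →
      (∀ t ∈ Ioc 0 T, ‖Z t‖ ≤ E) → ∀ M, M₀ ≤ M → ∀ w, IsTruncSol χ M γ T H Z w →
      ∀ t ∈ Ioc 0 t₀, ‖w t + Z t‖ ≤ M₀ * t ^ (-γ) := by
  have hhk := hkC_pos hT.le hδ
  -- The 1 is room for the Duhamel term, which is at most t^{-γ} up to t₀ because the exponent 1 - p
  -- - 2γ is positive.
  set M₀ := A + E * T ^ γ + 1 with hM₀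
  have hTγ : 0 < T ^ γ := by positivity
  have hM0 : 0 < M₀ := by positivity
  set p := (1 + δ) / 2 with hp
  have hq : 0 ≤ 3 * γ := by linarith
  have hq' : 3 * γ < 1 := by linarith
  have hbeta := betaC_pos (p := p) (q := 3 * γ) (by linarith) hq'
  set c := hkC T δ * (4 * |χ| * M₀ ^ 3) * betaC p (3 * γ) with hc
  have hc0 : 0 ≤ c := by positivity
  obtain ⟨t₀, ht₀, hct⟩ : ∃ t₀ ∈ Ioc 0 T, c * t₀ ^ (1 - p - 2 * γ) ≤ 1 := by
    have h1 : Tendsto (fun t : ℝ => c * t ^ (1 - p - 2 * γ)) (𝓝[>] 0) (𝓝 (c * 0)) := by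
      refine Tendsto.const_mul c ?_
      have h2 : ContinuousAt (fun t : ℝ => t ^ (1 - p - 2 * γ)) 0 :=
        Real.continuousAt_rpow_const _ _ (Or.inr (by linarith))
      have h3 : Tendsto (fun t : ℝ => t ^ (1 - p - 2 * γ)) (𝓝[>] 0) (𝓝 (0 ^ (1 - p - 2 * γ))) :=
        h2.tendsto.mono_left nhdsWithin_le_nhds
      rwa [Real.zero_rpow (by linarith)] at h3
    have h4 : ∀ᶠ t : ℝ in 𝓝[>] 0, c * t ^ (1 - p - 2 * γ) ≤ 1 :=
      h1.eventually (Iic_mem_nhds (by norm_num))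
    have h5 : ∀ᶠ t : ℝ in 𝓝[>] 0, t ∈ Ioc 0 T := Ioc_mem_nhdsGT hT
    obtain ⟨t, h6, h7⟩ := (h5.and h4).exists
    exact ⟨t, h6, h7⟩
  refine ⟨M₀, hM0, t₀, ht₀, ?_⟩
  intro H Z hH hHA hZ hZE M hM w hw
  have hMpos : 0 < M := hM0.trans_le hM
  obtain ⟨v, hv⟩ := exists_truncSol (χ := χ) hT hδ hδ' hγ hpγ hM0 hH hHA hZ
  have hvb : ∀ t ∈ Ioc 0 t₀, ‖v t + Z t‖ ≤ M₀ * t ^ (-γ) := fun t ht => by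
    have ht' : t ∈ Ioc 0 T := ⟨ht.1, ht.2.trans ht₀.2⟩
    have h1 := norm_duh_le_of_bound (F := fun s => tflux χ M₀ γ s (v s + Z s)) hδ hδ' hq hq'
      (by positivity) ht' (fun s hs => norm_tflux_le hM0 hs.1 _)
    have htγ : 0 < t ^ (-γ) := Real.rpow_pos_of_pos ht.1 _
    have h2 : t ^ (1 - p - 3 * γ) = t ^ (1 - p - 2 * γ) * t ^ (-γ) := by
      rw [← Real.rpow_add ht.1]; congr 1; ring
    have h3 : t ^ (1 - p - 2 * γ) ≤ t₀ ^ (1 - p - 2 * γ) :=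
      Real.rpow_le_rpow ht.1.le ht.2 (by linarith)
    have h4 : ‖duh (fun s => tflux χ M₀ γ s (v s + Z s)) t‖ ≤ 1 * t ^ (-γ) := by
      refine h1.trans ?_
      rw [h2]
      calc _ = c * t ^ (1 - p - 2 * γ) * t ^ (-γ) := by rw [hc]; ring
        _ ≤ _ := by
          gcongr
          exact le_trans (by gcongr) hct
    have h5 := hHA t ht'
    have h6 : E ≤ E * (T ^ γ * t ^ (-γ)) := le_mul_of_one_le_right hE (one_le_rpow_mul ht' hγ)
    have h7 := hZE t ht'
    rw [hv.eq t ht']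
    have h8 := norm_add_le (H t + duh (fun s => tflux χ M₀ γ s (v s + Z s)) t) (Z t)
    have h9 := norm_add_le (H t) (duh (fun s => tflux χ M₀ γ s (v s + Z s)) t)
    rw [hM₀]
    linarith
  have hv' : IsTruncSol χ M γ t₀ H Z v := by
    have h1 := hv.mono ht₀.2
    refine ⟨h1.cont, h1.bound, fun t ht => ?_⟩
    rw [h1.eq t ht]
    congr 1
    refine duh_congr ht.1.le fun s hs => ?_
    have h2 := hvb s ⟨hs.1, hs.2.trans ht.2⟩
    have hsγ : 0 < s ^ (-γ) := Real.rpow_pos_of_pos hs.1 _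
    rw [tflux_of_le hM0 hs.1 h2, tflux_of_le hMpos hs.1 (h2.trans (by gcongr))]
  have huniq := (hw.mono ht₀.2).unique ht₀.1 hδ hδ' hγ hpγ hMpos
    (hZ.mono (Ioc_subset_Ioc_right ht₀.2)) hv'
  intro t ht
  rw [huniq ht]
  exact hvb t ht

/-! ### The a priori bound -/

theorem l2sq_le_sq_norm (f : C(Torus, ℝ)) : l2sq f ≤ ‖f‖ ^ 2 := by
  rw [l2sq_eq_avg]
  exact (le_abs_self _).trans ((abs_avg_le _).trans (norm_pow_le _ _))

theorem l2sq_smul (c : ℝ) (f : C(Torus, ℝ)) : l2sq (c • f) = c ^ 2 * l2sq f := by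
  rw [l2sq_eq_avg, l2sq_eq_avg, smul_pow, map_smul, smul_eq_mul]

theorem l2sq_mul_le (f g : C(Torus, ℝ)) : l2sq (f * g) ≤ l2sq f * ‖g‖ ^ 2 := by
  have e : l2sq f * ‖g‖ ^ 2 = avg (‖g‖ ^ 2 • f ^ 2) := by
    rw [map_smul, smul_eq_mul, mul_comm, l2sq_eq_avg]
  rw [e, l2sq_eq_avg]
  refine avg_mono fun x => ?_
  simp only [ContinuousMap.pow_apply, ContinuousMap.mul_apply, ContinuousMap.smul_apply,
    smul_eq_mul]
  have h1 : |g x| ≤ ‖g‖ := g.norm_coe_le_norm x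
  have h2 : g x ^ 2 ≤ ‖g‖ ^ 2 := sq_le_sq' (abs_le.1 h1).1 (abs_le.1 h1).2
  rw [mul_pow, mul_comm]
  exact mul_le_mul_of_nonneg_right h2 (sq_nonneg _)

theorem l2sq_add_le (f g : C(Torus, ℝ)) : l2sq (f + g) ≤ 2 * l2sq f + 2 * l2sq g := by
  rw [l2sq_eq_avg, l2sq_eq_avg, l2sq_eq_avg, ← smul_eq_mul, ← smul_eq_mul, ← map_smul, ← map_smul,
    ← map_add]
  refine avg_mono fun x => ?_
  simp only [ContinuousMap.pow_apply, ContinuousMap.add_apply, ContinuousMap.smul_apply,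
    smul_eq_mul]
  nlinarith [sq_nonneg (f x - g x)]

theorem sqrt_l2sq_le_norm (f : C(Torus, ℝ)) : √(l2sq f) ≤ ‖f‖ :=
  Real.sqrt_le_iff.2 ⟨norm_nonneg _, l2sq_le_sq_norm f⟩

/-- In u · u · g one factor is measured in L², g is bounded through L², and only one factor is left
in sup norm. The bound is affine in ‖w‖, and this linearity lets Grönwall close. -/
theorem sqrt_l2sq_flux_le {w Z : C(Torus, ℝ)} {P K : ℝ} (hP : l2sq w ≤ P) (hZ : ‖Z‖ ≤ K)
    (hm : |avg (w + Z)| ≤ K) :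
    √(l2sq (flux (w + Z))) ≤ (8 * P + 32 * K ^ 2) * (‖w‖ + K) := by
  have hK : 0 ≤ K := (norm_nonneg _).trans hZ
  have hP0 : 0 ≤ P := (l2sq_nonneg w).trans hP
  have h1 := sq_norm_gradPotential_le hZ hm
  rw [← l2sq_eq_avg] at h1
  have h2 : l2sq (w + Z) ≤ 8 * P + 32 * K ^ 2 := by
    have h3 := l2sq_add_le w Z
    have h4 : l2sq Z ≤ K ^ 2 := (l2sq_le_sq_norm Z).trans (by gcongr)
    nlinarith [sq_nonneg K]
  have h3 : ‖w + Z‖ ≤ ‖w‖ + K := (norm_add_le _ _).trans (by gcongr)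
  refine Real.sqrt_le_iff.2 ⟨by positivity, ?_⟩
  have e : flux (w + Z) = (w + Z) * (w + Z) * gradPotential (w + Z) := by rw [flux, sq]
  rw [e]
  calc _ ≤ l2sq (w + Z) * ‖w + Z‖ ^ 2 * ‖gradPotential (w + Z)‖ ^ 2 :=
        (l2sq_mul_le _ _).trans (by gcongr; exact l2sq_mul_le _ _)
    _ ≤ (8 * P + 32 * K ^ 2) * (‖w‖ + K) ^ 2 * (8 * P + 32 * K ^ 2) := by
        gcongr
        linarith
    _ = _ := by ring

theorem sqrt_l2sq_tflux_le {χ M γ s : ℝ} (hM : 0 < M) (hs : 0 < s) (u : C(Torus, ℝ)) :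
    √(l2sq (tflux χ M γ s u)) ≤ |χ| * √(l2sq (flux u)) := by
  have h0 := ret_coeff_nonneg (level_pos hM hs γ) u
  have h1 := pow_le_one₀ (n := 3) h0 (ret_coeff_le_one (level_pos hM hs γ) u)
  rw [tflux_eq_smul, l2sq_smul, Real.sqrt_mul (sq_nonneg _), Real.sqrt_sq_eq_abs, abs_mul,
    abs_of_nonneg (pow_nonneg h0 3), mul_assoc]
  exact mul_le_mul_of_nonneg_left (mul_le_of_le_one_left (Real.sqrt_nonneg _) h1) (abs_nonneg _)

/-- Up to t₀ the short-time bound applies. From t₀ on, the L² norm is bounded by the energy estimate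
started at t₀, and the Duhamel formula with the L² to L^∞ bound gives a linear singular inequality
for the sup norm. None of the constants involves M. -/
theorem exists_apriori_bound {T δ γ α₀ α χ R : ℝ} (hT : 0 < T) (hδ : 0 < δ) (hδ' : δ < 1 / 2)
    (hγ : γ = (δ - α₀) / 2) (hpγ : (1 + δ) / 2 + 2 * γ < 1) (hα₀ : -1 ≤ α₀) (hα₀' : α₀ ≤ 0)
    (hα : 0 < α) (hχ : 0 < χ) (hR : 0 ≤ R) :
    ∃ M₀ B : ℝ, 0 < M₀ ∧ 0 ≤ B ∧ ∀ (ζ : PeriodicDist) (Z : ℝ → C(Torus, ℝ)), |mean ζ| ≤ 1 →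
      (∀ j : ℕ, ‖dblk j ζ‖ ≤ R * 2 ^ (-(α₀ * ((j : ℝ) - 1)))) → ContinuousOn Z (Ioc 0 T) →
      (∀ t ∈ Ioc 0 T, avg (Z t) = 0) →
      (∀ t ∈ Ioc 0 T, ∀ j : ℕ, ‖blk j (Z t)‖ ≤ R * 2 ^ (-(α * ((j : ℝ) - 1)))) →
      ∀ M, M₀ ≤ M → ∀ w, IsTruncSol χ M γ T (fun t => heatC t ζ) Z w →
        ∀ t ∈ Ioc 0 T, ‖w t‖ ≤ B * t ^ (-γ) := by
  have hhk := hkC_pos hT.le hδ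
  have hγ0 : 0 ≤ γ := by rw [hγ]; linarith
  have hembα := embC_pos hα
  set A := hkC T δ * R with hA
  set E := embC α * R with hE
  have hA0 : 0 ≤ A := by positivity
  have hE0 : 0 ≤ E := by positivity
  obtain ⟨M₀, hM₀, t₀, ht₀, hshort⟩ := exists_shortTime χ hT hδ (by linarith) hγ0 hpγ hA0 hE0
  obtain ⟨C, hC0, hC⟩ := exists_energyRate χ R hα hχ
  -- Singularity of e^{tΔ}∂ₓ from L² to L^∞; it is below 1 because δ < 1/2.
  set p := (3 / 2 + δ) / 2 with hp
  set P := (M₀ * t₀ ^ (-γ) + E) ^ 2 + 2 * C * T with hP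
  have hP0 : 0 ≤ P := by positivity
  set K := 1 + E with hK
  have hK0 : 0 ≤ K := by positivity
  set Q := χ * (8 * P + 32 * K ^ 2) with hQ
  have hQ0 : 0 ≤ Q := by positivity
  set C₁ := 4 * χ * M₀ ^ 3 + Q * K * T ^ (3 * γ) with hC₁
  have hC₁0 : 0 ≤ C₁ := by positivity
  obtain ⟨Γ, hΓ, hgron⟩ := exists_gronwall (p := p) (b := 0) (γ := γ) (B := hkC T δ * Q)
    (by linarith) le_rfl hγ0 (by linarith) (by linarith) hT (by positivity)
  have hbeta := betaC_pos (p := p) (q := 3 * γ) (by linarith) (by linarith)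
  set c := 1 - p - 3 * γ with hc
  set D := hkC T δ * C₁ * (betaC p (3 * γ) * (t₀ ^ c + T ^ c)) with hD
  have hD0 : 0 ≤ D := by have := ht₀.1; positivity
  set A₁ := M₀ + E * T ^ γ + A + D * T ^ γ with hA₁
  have hA₁0 : 0 ≤ A₁ := by positivity
  refine ⟨M₀, Γ * A₁, hM₀, by positivity, ?_⟩
  intro ζ Z hζ hζR hZ hZ0 hZR M hM w hw
  have hMpos : 0 < M := hM₀.trans_le hM
  have hZE : ∀ t ∈ Ioc 0 T, ‖Z t‖ ≤ E := fun t ht => norm_le_of_blk hα (hZR t ht)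
  have hHA : ∀ t ∈ Ioc 0 T, ‖heatC t ζ‖ ≤ A * t ^ (-γ) := fun t ht => by
    refine (norm_heatC_le ht.1 ht.2 hα₀ hα₀' hδ (by linarith) hζR).trans (le_of_eq ?_)
    rw [hA, hγ, hkC]; ring
  have hHc : ContinuousOn (fun t => heatC t ζ) (Ioc 0 T) :=
    (continuousOn_heatC ζ).mono fun t ht => ht.1
  have hs := hshort _ Z hHc hHA hZ hZE M hM w hw
  set F : ℝ → C(Torus, ℝ) := fun s => tflux χ M γ s (w s + Z s) with hF
  have hFc : ContinuousOn F (Ioc 0 T) :=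
    continuousOn_tflux hMpos (fun s hs => hs.1) (hw.cont.add hZ)
  have hFb : ∀ s ∈ Ioc 0 T, ‖F s‖ ≤ 4 * |χ| * M ^ 3 * s ^ (-(3 * γ)) := fun s hs =>
    norm_tflux_le hMpos hs.1 _
  have hws : ∀ t ∈ Ioc 0 t₀, ‖w t‖ ≤ M₀ * t ^ (-γ) + E := fun t ht => by
    have h1 := norm_sub_le (w t + Z t) (Z t)
    rw [add_sub_cancel_right] at h1
    linarith [hs t ht, hZE t ⟨ht.1, ht.2.trans ht₀.2⟩]
  have hl2 : ∀ t ∈ Icc t₀ T, l2sq (w t) ≤ P := fun t ht => by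
    have h1 := l2sq_le_of_truncSol hχ hδ (by linarith) hγ0 (by linarith) hMpos hC hζ hZ hZ0 hZR hw
      ht₀.1 ht.1 ht.2
    have h2 : l2sq (w t₀) ≤ (M₀ * t₀ ^ (-γ) + E) ^ 2 :=
      (l2sq_le_sq_norm _).trans (pow_le_pow_left₀ (norm_nonneg _) (hws t₀ ⟨ht₀.1, le_rfl⟩) 2)
    have h3 : 2 * C * (t - t₀) ≤ 2 * C * T := by
      have := ht.2; have := ht₀.1
      gcongr; linarith
    linarith
  have hmean : ∀ t ∈ Ioc 0 T, |avg (w t + Z t)| ≤ K := fun t ht => by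
    rw [map_add, hZ0 t ht, add_zero, coefR_zero_of_duhamel hδ (by linarith) (by linarith)
      (by linarith) ht hFc hFb (hw.eq t ht)]
    linarith
  have hF2 : ∀ s ∈ Ioc 0 T, √(l2sq (F s)) ≤ C₁ * s ^ (-(3 * γ)) + Q * ‖w s‖ := fun s hs' => by
    have hsγ : 0 < s ^ (-(3 * γ)) := Real.rpow_pos_of_pos hs'.1 _
    rcases le_total s t₀ with h | h
    -- Before t₀ truncation at M and at M₀ coincide, so the bound may be taken with M₀.
    · have h1 := hs s ⟨hs'.1, h⟩
      have hsγ' : 0 < s ^ (-γ) := Real.rpow_pos_of_pos hs'.1 _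
      have h2 : F s = tflux χ M₀ γ s (w s + Z s) := by
        rw [tflux_of_le hM₀ hs'.1 h1]
        exact tflux_of_le hMpos hs'.1 (h1.trans (by gcongr))
      have h3 := norm_tflux_le (χ := χ) (γ := γ) hM₀ hs'.1 (w s + Z s)
      rw [← h2, abs_of_pos hχ] at h3
      have h4 := sqrt_l2sq_le_norm (F s)
      have h5 : 4 * χ * M₀ ^ 3 * s ^ (-(3 * γ)) ≤ C₁ * s ^ (-(3 * γ)) := by
        gcongr
        have : 0 ≤ Q * K * T ^ (3 * γ) := by positivity
        linarith
      have h6 : 0 ≤ Q * ‖w s‖ := by positivity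
      linarith
    · have h1 := sqrt_l2sq_tflux_le (χ := χ) (γ := γ) hMpos hs'.1 (w s + Z s)
      have h2 := sqrt_l2sq_flux_le (K := K) (hl2 s ⟨h, hs'.2⟩) (by linarith [hZE s hs'])
        (hmean s hs')
      rw [abs_of_pos hχ] at h1
      have h3 := one_le_rpow_mul hs' (by linarith : 0 ≤ 3 * γ)
      have h4 : χ * √(l2sq (flux (w s + Z s))) ≤ χ * ((8 * P + 32 * K ^ 2) * (‖w s‖ + K)) := by
        gcongr
      have h5 : Q * K ≤ Q * K * (T ^ (3 * γ) * s ^ (-(3 * γ))) :=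
        le_mul_of_one_le_right (by positivity) h3
      have h6 : 0 ≤ 4 * χ * M₀ ^ 3 * s ^ (-(3 * γ)) := by positivity
      calc _ ≤ _ := h1
        _ ≤ _ := h4
        _ = Q * K + Q * ‖w s‖ := by rw [hQ]; ring
        _ ≤ _ := by rw [hC₁]; linarith
  obtain ⟨D₀, hD₀⟩ := hw.bound
  refine hgron (fun t => ‖w t‖) A₁ D₀ hA₁0 hD₀ fun t ht l G hl hG hG' => ?_
  have htγ : 0 < t ^ (-γ) := Real.rpow_pos_of_pos ht.1 _
  have hone := one_le_rpow_mul ht hγ0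
  have hint0 : 0 ≤ ∫ s in (0 : ℝ)..t, wker p (0 + γ) l t s :=
    intervalIntegral.integral_nonneg ht.1.le fun s hs => wker_nonneg hs.1 hs.2
  rcases le_total t t₀ with h | h
  · have h1 := hws t ⟨ht.1, h⟩
    have h2 : E ≤ E * (T ^ γ * t ^ (-γ)) := le_mul_of_one_le_right hE0 hone
    have h3 : 0 ≤ hkC T δ * Q * (G * ∫ s in (0 : ℝ)..t, wker p (0 + γ) l t s) := by positivity
    have h4 : 0 ≤ (A + D * T ^ γ) * t ^ (-γ) := by positivity
    rw [hA₁]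
    linarith
  · have hbint := intervalIntegrable_beta (p := p) (q := 3 * γ) (by linarith) (by linarith)
      (by linarith) (by linarith) ht.1.le
    have hwint := intervalIntegrable_wker (p := p) (q := 0 + γ) (by linarith) (by linarith)
      (by linarith) (by linarith) hl ht.1.le
    have h1 : ‖duh F t‖ ≤ ∫ s in (0 : ℝ)..t, (hkC T δ * C₁ * ((t - s) ^ (-p) * s ^ (-(3 * γ))) +
        hkC T δ * Q * G * wker p (0 + γ) l t s) := by
      refine norm_duh_le ht.1.le ((hbint.const_mul _).add (hwint.const_mul _)) fun s hs hst => ?_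
      have hs' : s ∈ Ioc 0 T := ⟨hs, hst.le.trans ht.2⟩
      have h2 := norm_hk_le_l2 (T := T) (by linarith : 0 < t - s) (by linarith [ht.2]) hδ hδ'.le (F s)
      refine h2.trans ?_
      have h3 : 0 < (t - s) ^ (-p) := Real.rpow_pos_of_pos (by linarith) _
      rw [← hkC]
      calc _ ≤ hkC T δ * (t - s) ^ (-p) * (C₁ * s ^ (-(3 * γ)) +
            Q * (G * (s ^ (-γ) * Real.exp (l * s)))) := by
            gcongr
            refine (hF2 s hs').trans ?_
            gcongr
            exact hG' s ⟨hs, hst.le⟩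
        _ = _ := by rw [wker, zero_add]; ring
    rw [intervalIntegral.integral_add (hbint.const_mul _) (hwint.const_mul _),
      intervalIntegral.integral_const_mul, intervalIntegral.integral_const_mul] at h1
    have h2 := integral_beta_le (p := p) (q := 3 * γ) (by linarith) (by linarith)
      (by linarith) (by linarith) ht.1
    -- The exponent c may have either sign; on [t₀,T] the power is bounded by the sum of its
    -- endpoint values. This is why t ≤ t₀ is treated separately.
    have h3 : t ^ c ≤ t₀ ^ c + T ^ c := by
      have ha : 0 < t₀ ^ c := Real.rpow_pos_of_pos ht₀.1 _
      have hb : 0 < T ^ c := Real.rpow_pos_of_pos hT _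
      rcases le_total 0 c with hc0 | hc0
      · linarith [Real.rpow_le_rpow ht.1.le ht.2 hc0]
      · linarith [Real.rpow_le_rpow_of_nonpos ht₀.1 h hc0]
    have h4 : hkC T δ * C₁ * (∫ s in (0 : ℝ)..t, (t - s) ^ (-p) * s ^ (-(3 * γ))) ≤ D := by
      rw [hD]
      gcongr
      exact h2.trans (by gcongr)
    have h5 : D ≤ D * (T ^ γ * t ^ (-γ)) := le_mul_of_one_le_right hD0 hone
    have h6 := hHA t ht
    have h7 := norm_add_le (heatC t ζ) (duh F t)
    rw [← hw.eq t ht] at h7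
    have h8 : 0 ≤ (M₀ + E * T ^ γ) * t ^ (-γ) := by positivity
    rw [hA₁]
    linarith

/-! ### Global solutions of the Duhamel equation -/

/-- A solution on `(0,T]` of the Duhamel form of the remainder equation, bounded by
`B t^{-γ}`. -/
structure IsDuhamelSol (χ γ T B : ℝ) (ζ : PeriodicDist) (Z w : ℝ → C(Torus, ℝ)) : Prop where
  cont : ContinuousOn w (Ioc 0 T)
  bound : ∀ t ∈ Ioc 0 T, ‖w t‖ ≤ B * t ^ (-γ)
  eq : ∀ t ∈ Ioc 0 T, w t = heatC t ζ + duh (fun s => χ • flux (w s + Z s)) t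

theorem exists_duhamelSol {T δ γ α₀ α χ R : ℝ} (hT : 0 < T) (hδ : 0 < δ) (hδ' : δ < 1 / 2)
    (hγ : γ = (δ - α₀) / 2) (hpγ : (1 + δ) / 2 + 2 * γ < 1) (hα₀ : -1 ≤ α₀) (hα₀' : α₀ ≤ 0)
    (hα : 0 < α) (hχ : 0 < χ) (hR : 0 ≤ R) :
    ∃ B : ℝ, 0 ≤ B ∧ ∀ (ζ : PeriodicDist) (Z : ℝ → C(Torus, ℝ)), |mean ζ| ≤ 1 →
      (∀ j : ℕ, ‖dblk j ζ‖ ≤ R * 2 ^ (-(α₀ * ((j : ℝ) - 1)))) → ContinuousOn Z (Ioc 0 T) →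
      (∀ t ∈ Ioc 0 T, avg (Z t) = 0) →
      (∀ t ∈ Ioc 0 T, ∀ j : ℕ, ‖blk j (Z t)‖ ≤ R * 2 ^ (-(α * ((j : ℝ) - 1)))) →
      ∃ w, IsDuhamelSol χ γ T B ζ Z w := by
  obtain ⟨M₀, B, hM₀, hB, h⟩ := exists_apriori_bound hT hδ hδ' hγ hpγ hα₀ hα₀' hα hχ hR
  refine ⟨B, hB, fun ζ Z hζ hζR hZ hZ0 hZR => ?_⟩
  have hγ0 : 0 ≤ γ := by rw [hγ]; linarith
  have hembα := embC_pos hα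
  have hE0 : 0 ≤ embC α * R * T ^ γ := by positivity
  -- Large enough that w + Z stays below the level M s^{-γ}: B for w, the last summand for Z.
  set M := M₀ + B + embC α * R * T ^ γ with hM
  have hMpos : 0 < M := by positivity
  have hHA : ∀ t ∈ Ioc 0 T, ‖heatC t ζ‖ ≤ hkC T δ * R * t ^ (-γ) := fun t ht => by
    refine (norm_heatC_le ht.1 ht.2 hα₀ hα₀' hδ (by linarith) hζR).trans (le_of_eq ?_)
    rw [hγ, hkC]; ring
  obtain ⟨w, hw⟩ := exists_truncSol (χ := χ) hT hδ (by linarith) hγ0 hpγ hMpos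
    ((continuousOn_heatC ζ).mono fun t ht => ht.1) hHA hZ
  have hb := h ζ Z hζ hζR hZ hZ0 hZR M (by linarith) w hw
  refine ⟨w, hw.cont, hb, fun t ht => ?_⟩
  rw [hw.eq t ht]
  congr 1
  refine duh_congr ht.1.le fun s hs => tflux_of_le hMpos hs.1 ?_
  have hs' : s ∈ Ioc 0 T := ⟨hs.1, hs.2.trans ht.2⟩
  have h1 : ‖Z s‖ ≤ embC α * R := norm_le_of_blk hα (hZR s hs')
  have h2 : embC α * R ≤ embC α * R * (T ^ γ * s ^ (-γ)) :=
    le_mul_of_one_le_right (by positivity) (one_le_rpow_mul hs' hγ0)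
  have h3 : 0 ≤ M₀ * s ^ (-γ) := (level_pos hM₀ hs.1 γ).le
  have h4 := norm_add_le (w s) (Z s)
  have h5 := hb s hs'
  rw [hM]
  linarith

/-! ### Smooth functions and Hölder--Besov spaces -/

theorem contDiff_trunc (J : ℕ) (f : C(Torus, ℝ)) :
    ContDiff ℝ ∞ fun x : ℝ => trunc J f (x : Torus) := by
  have e : (fun x : ℝ => trunc J f (x : Torus)) = fun x : ℝ => Complex.reCLM
      (∑ n ∈ modes J, cu J n * coefC n (toC f) * Complex.exp (2 * Real.pi * Complex.I * n * x)) := by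
    funext x
    rw [trunc, mulR_eq_sum (s := modes J) fun _ hn => cu_eq_zero_of_notMem hn]
    simp only [reC_apply, ContinuousMap.sum_apply, ContinuousMap.smul_apply, smul_eq_mul, fou_coe,
      Complex.reCLM_apply]
  rw [e]
  refine Complex.reCLM.contDiff.comp (ContDiff.sum fun n _ => contDiff_const.mul ?_)
  exact (Complex.contDiff_exp (𝕜 := ℝ)).comp (contDiff_const.mul Complex.ofRealCLM.contDiff)

theorem exists_isDeriv {f : C(Torus, ℝ)} (hf : ContDiff ℝ ∞ fun x : ℝ => f (x : Torus)) :
    ∃ g : C(Torus, ℝ), IsDeriv f g ∧ ContDiff ℝ ∞ fun x : ℝ => g (x : Torus) := by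
  set F : ℝ → ℝ := fun x => f (x : Torus) with hF
  obtain ⟨hd, hd'⟩ := contDiff_infty_iff_deriv.1 hf
  have hp : Function.Periodic (deriv F) 1 := fun x => by
    have h : (fun y => F (y + 1)) = F := funext fun y => by
      simp only [hF, AddCircle.coe_add, AddCircle.coe_period, add_zero]
    rw [← deriv_comp_add_const, h]
  exact ⟨⟨hp.lift, continuous_coinduced_dom.2 hd'.continuous⟩, fun x => (hd x).hasDerivAt, hd'⟩

theorem IsDeriv.coefC_eq {f g : C(Torus, ℝ)} (h : IsDeriv f g) (n : ℤ) :
    coefC n (toC g) = dx n * coefC n (toC f) := by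
  set e : ℝ → ℂ := fun x => Complex.exp (2 * Real.pi * Complex.I * (-n : ℤ) * x) with he
  have hed : ∀ x : ℝ, HasDerivAt e (-dx n * e x) x := fun x => by
    have h1 : HasDerivAt (fun x : ℝ => 2 * Real.pi * Complex.I * (-n : ℤ) * (x : ℂ))
        (2 * Real.pi * Complex.I * (-n : ℤ) * 1) x :=
      Complex.ofRealCLM.hasDerivAt.const_mul _
    refine h1.cexp.congr_deriv ?_
    rw [he, dx]
    push_cast
    ring
  have hec : Continuous e := continuous_iff_continuousAt.2 fun x => (hed x).continuousAt
  have hfc : Continuous fun x : ℝ => (f (x : Torus) : ℂ) :=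
    Complex.continuous_ofReal.comp (continuous_coe_torus f)
  have hgc : Continuous fun x : ℝ => (g (x : Torus) : ℂ) :=
    Complex.continuous_ofReal.comp (continuous_coe_torus g)
  have hprod : ∀ x : ℝ, HasDerivAt (fun x : ℝ => e x * (f (x : Torus) : ℂ))
      (-dx n * e x * (f (x : Torus) : ℂ) + e x * (g (x : Torus) : ℂ)) x := fun x =>
    (hed x).mul (h x).ofReal_comp
  have h1 := intervalIntegral.integral_eq_sub_of_hasDerivAt (a := 0) (b := 1)
    (fun x _ => hprod x)
    ((((continuous_const.mul hec).mul hfc).add (hec.mul hgc)).intervalIntegrable _ _)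
  have hper : e 1 * (f ((1 : ℝ) : Torus) : ℂ) - e 0 * (f ((0 : ℝ) : Torus) : ℂ) = 0 := by
    have h2 : ((1 : ℝ) : Torus) = ((0 : ℝ) : Torus) := by
      rw [AddCircle.coe_period, QuotientAddGroup.mk_zero]
    have h3 : e 1 = e 0 := by
      have h4 := fou_coe (-n) 1
      have h5 := fou_coe (-n) 0
      rw [h2, h5] at h4
      exact h4.symm
    rw [h2, h3, sub_self]
  have i1 : IntervalIntegrable (fun y : ℝ => -dx n * e y * (f (y : Torus) : ℂ)) volume 0 1 :=
    ((continuous_const.mul hec).mul hfc).intervalIntegrable _ _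
  have i2 : IntervalIntegrable (fun y : ℝ => e y * (g (y : Torus) : ℂ)) volume 0 1 :=
    (hec.mul hgc).intervalIntegrable _ _
  rw [hper, intervalIntegral.integral_add i1 i2] at h1
  simp only [mul_assoc] at h1
  rw [intervalIntegral.integral_const_mul] at h1
  rw [coefC_toC, coefC_toC]
  linear_combination h1

/-- Two derivatives give |f̂(n)| = O(4^{-j}) on the annulus, and a block has O(2^j) modes. -/
theorem norm_blk_le_of_contDiff {f : C(Torus, ℝ)} (hf : ContDiff ℝ ∞ fun x : ℝ => f (x : Torus)) :
    ∃ A : ℝ, 0 ≤ A ∧ ∀ j : ℕ, ‖blk j f‖ ≤ A * 2 ^ (-(j : ℝ)) := by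
  obtain ⟨g, hg, hg'⟩ := exists_isDeriv hf
  obtain ⟨k, hk, -⟩ := exists_isDeriv hg'
  refine ⟨8 * (‖f‖ + ‖k‖), by positivity, fun j => ?_⟩
  have hterm : ∀ n, ‖dy j n * fourierCoef (toDist f) n‖ ≤ (‖f‖ + ‖k‖) / 4 ^ j := fun n => by
    by_cases h0 : dy j n = 0
    · rw [h0, zero_mul, norm_zero]; positivity
    rw [norm_mul]
    have h1 : ‖fourierCoef (toDist f) n‖ * 4 ^ j ≤ ‖f‖ + ‖k‖ := by
      have h2 : (2 : ℤ) ^ j ≤ 2 * |n| + 1 := (mem_annulus_of_ne_zero h0).2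
      rw [fourierCoef_toDist]
      rcases eq_or_ne n 0 with rfl | hn
      -- The zero frequency belongs to the annulus of index 0 only.
      · have h3 : j = 0 := by
          by_contra hj
          have : (2 : ℤ) ^ 1 ≤ 2 ^ j := pow_le_pow_right₀ (by norm_num) (Nat.one_le_iff_ne_zero.2 hj)
          simp at h2
          omega
        have h4 := (norm_coefC_le 0 (toC f)).trans (norm_toC f).le
        have := norm_nonneg k
        rw [h3, pow_zero, mul_one]
        linarith
      · have h3 : (1 : ℤ) ≤ |n| := Int.one_le_abs hn
        have h4 : ((2 : ℝ) ^ j) ≤ 3 * |(n : ℝ)| := by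
          have : (2 : ℤ) ^ j ≤ 3 * |n| := by linarith
          exact_mod_cast this
        have h5 : (4 : ℝ) ^ j ≤ ‖dx n‖ ^ 2 := by
          have h6 : (4 : ℝ) ^ j = (2 ^ j) ^ 2 := by
            rw [← pow_mul, mul_comm, pow_mul]; norm_num
          rw [h6, norm_dx]
          refine pow_le_pow_left₀ (by positivity) (h4.trans ?_) 2
          have := Real.pi_gt_three
          have := abs_nonneg (n : ℝ)
          nlinarith
        have h6 := (norm_coefC_le n (toC k)).trans (norm_toC k).le
        rw [hk.coefC_eq, hg.coefC_eq, norm_mul, norm_mul] at h6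
        have h7 := norm_nonneg (coefC n (toC f))
        have h8 := norm_nonneg f
        nlinarith
    rw [le_div_iff₀ (by positivity)]
    calc _ ≤ 1 * ‖fourierCoef (toDist f) n‖ * 4 ^ j := by
          gcongr
          exact norm_dy_le j n
      _ ≤ _ := by rw [one_mul]; exact h1
  rw [← norm_toC, toC_blk]
  refine (norm_trigSum_le (summable_dy_mul j _)).trans ?_
  rw [tsum_eq_sum (s := modes j) fun n hn => by
    have : dy j n = 0 := dy_eq_zero (by
      by_contra h'
      exact hn (Finset.mem_Icc.2 (abs_le.1 (not_le.1 h').le)))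
    rw [this, zero_mul, norm_zero]]
  refine (Finset.sum_le_card_nsmul _ _ _ fun n _ => hterm n).trans ?_
  have hcard : ((modes j).card : ℝ) ≤ 8 * 2 ^ j := by
    have h1 : (modes j).card ≤ 8 * 2 ^ j := by
      rw [modes, Int.card_Icc]
      have h2 : (2 : ℤ) ^ (j + 1) + 1 - -2 ^ (j + 1) ≤ 8 * 2 ^ j := by
        have : (1 : ℤ) ≤ 2 ^ j := one_le_pow₀ (by norm_num)
        rw [pow_succ]; linarith
      have h3 : (8 * 2 ^ j : ℤ) = ((8 * 2 ^ j : ℕ) : ℤ) := by push_cast; ring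
      rw [h3] at h2
      omega
    exact_mod_cast h1
  have h4 : (4 : ℝ) ^ j = 2 ^ j * 2 ^ j := by rw [← mul_pow]; norm_num
  rw [nsmul_eq_mul, Real.rpow_neg zero_le_two, Real.rpow_natCast, h4]
  calc _ ≤ 8 * 2 ^ j * ((‖f‖ + ‖k‖) / (2 ^ j * 2 ^ j)) := by gcongr
    _ = _ := by field_simp

theorem hbNorm_lt_top_of_contDiff {β : ℝ} (hβ : 0 ≤ β) (hβ' : β ≤ 1) {f : C(Torus, ℝ)}
    (hf : ContDiff ℝ ∞ fun x : ℝ => f (x : Torus)) : hbNorm β f < ⊤ := by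
  obtain ⟨A, hA, h⟩ := norm_blk_le_of_contDiff hf
  refine lt_of_le_of_lt ((hbNorm_le_iff hA).2 fun j => (h j).trans ?_) ENNReal.ofReal_lt_top
  refine mul_le_mul_of_nonneg_left ?_ hA
  refine Real.rpow_le_rpow_of_exponent_le one_le_two ?_
  have : 0 ≤ (j : ℝ) := Nat.cast_nonneg j
  nlinarith

/-- An element of the closure lies at distance at most 1 from a smooth function, whose norm is
finite. -/
theorem besovNorm_lt_top {β : ℝ} (hβ : β ≤ 1) (hβ' : -1 ≤ β) {u : PeriodicDist}
    (hu : u ∈ HolderBesov β) : besovNorm β u < ⊤ := by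
  obtain ⟨φ, hφ, h⟩ := hu 1 one_pos
  have h1 : besovNorm β (toDist φ) < ⊤ := by
    rcases le_total 0 β with h0 | h0
    · exact hbNorm_lt_top_of_contDiff h0 hβ hφ
    · have hb := bernC_pos
      refine lt_of_le_of_lt ((hbNorm_le_iff (A := 2 * (bernC * ‖φ‖)) (by positivity)).2 fun j => ?_)
        ENNReal.ofReal_lt_top
      refine (norm_blk_le j φ).trans ?_
      have h2 : (1 : ℝ) ≤ 2 * 2 ^ (-(β * ((j : ℝ) - 1))) := by
        have h3 : (2 : ℝ) ^ (-1 : ℝ) ≤ 2 ^ (-(β * ((j : ℝ) - 1))) := by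
          refine Real.rpow_le_rpow_of_exponent_le one_le_two ?_
          have : 0 ≤ (j : ℝ) := Nat.cast_nonneg j
          nlinarith
        rw [Real.rpow_neg_one] at h3
        linarith
      calc bernC * ‖φ‖ ≤ bernC * ‖φ‖ * (2 * 2 ^ (-(β * ((j : ℝ) - 1)))) :=
            le_mul_of_one_le_right (by positivity) h2
        _ = _ := by ring
  calc besovNorm β u = besovNorm β (u - toDist φ + toDist φ) := by rw [sub_add_cancel]
    _ ≤ _ := besovNorm_add_le _ _ _
    _ < ⊤ := ENNReal.add_lt_top.2 ⟨h.trans_lt ENNReal.one_lt_top, h1⟩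

/-- Continuity gives local boundedness in time, and [0,T] is compact. -/
theorem normCT_lt_top {T α m : ℝ} (hα : 0 ≤ α) (hα' : α ≤ 1) {Z : ℝ → C(Torus, ℝ)}
    (hZ : Z ∈ SpaceCT T α m) : normCT T α Z < ⊤ := by
  have h : ∃ A : ℝ≥0∞, A < ⊤ ∧ ∀ t ∈ Icc 0 T, hbNorm α (Z t) ≤ A := by
    refine isCompact_Icc.induction_on
      (p := fun S => ∃ A : ℝ≥0∞, A < ⊤ ∧ ∀ t ∈ S, hbNorm α (Z t) ≤ A) ⟨0, by simp, by simp⟩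
      (fun S S' hS ⟨A, hA, h⟩ => ⟨A, hA, fun t ht => h t (hS ht)⟩) ?_ fun t ht => ?_
    · rintro S S' ⟨A, hA, h⟩ ⟨A', hA', h'⟩
      refine ⟨max A A', max_lt hA hA', ?_⟩
      rintro t (ht | ht)
      · exact (h t ht).trans (le_max_left _ _)
      · exact (h' t ht).trans (le_max_right _ _)
    · have h1 := besovNorm_lt_top hα' (by linarith) (hZ.1 t ht).1
      have h2 := (hZ.2 t ht).eventually (gt_mem_nhds one_pos)
      refine ⟨_, h2, hbNorm α (Z t) + 1, ENNReal.add_lt_top.2 ⟨h1, ENNReal.one_lt_top⟩,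
        fun s hs => ?_⟩
      have h3 := hbNorm_add_le α (Z t) (Z s - Z t)
      rw [add_sub_cancel] at h3
      exact h3.trans (add_le_add le_rfl (le_of_lt hs))
  obtain ⟨A, hA, h⟩ := h
  exact lt_of_le_of_lt (iSup₂_le h) hA

theorem ContinuousInTime.continuousOn {I : Set ℝ} {α : ℝ} (hα : 0 < α) {f : ℝ → C(Torus, ℝ)}
    (h : ContinuousInTime I α f) : ContinuousOn f I := by
  intro t ht
  have h1 := h t ht
  rw [ContinuousWithinAt, tendsto_iff_norm_sub_tendsto_zero]
  have h2 : Tendsto (fun s => embC α * (hbNorm α (f s - f t)).toReal) (𝓝[I] t) (𝓝 0) := by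
    have h3 := ((ENNReal.tendsto_toReal ENNReal.zero_ne_top).comp h1).const_mul (embC α)
    simpa using h3
  refine squeeze_zero' (Eventually.of_forall fun _ => norm_nonneg _) ?_ h2
  filter_upwards [h1.eventually (gt_mem_nhds one_pos)] with s hs
  exact norm_le_of_hbNorm hα (hs.trans ENNReal.one_lt_top).ne

theorem tendsto_interpolation {α β B : ℝ} (hβ : 0 < β) (hαβ : α < β) :
    Tendsto (fun b : ℝ => ENNReal.ofReal (B ^ (α / β) * (bernC * b) ^ (1 - α / β))) (𝓝 0) (𝓝 0) := by
  have h1 : 0 < 1 - α / β := by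
    have := (div_lt_one hβ).2 hαβ
    linarith
  have h2 : Tendsto (fun b : ℝ => (bernC * b) ^ (1 - α / β)) (𝓝 0) (𝓝 ((bernC * 0) ^ (1 - α / β))) :=
    ((tendsto_id.const_mul bernC)).rpow_const (Or.inr h1.le)
  rw [mul_zero, Real.zero_rpow h1.ne'] at h2
  have h3 := ENNReal.tendsto_ofReal (h2.const_mul (B ^ (α / β)))
  simpa using h3

theorem hbNorm_le_interpolation {α β B b : ℝ} (hα : 0 < α) (hαβ : α < β) {f : C(Torus, ℝ)}
    (h : ∀ j : ℕ, ‖blk j f‖ ≤ B * 2 ^ (-(β * ((j : ℝ) - 1)))) (hb : ‖f‖ ≤ b) :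
    hbNorm α f ≤ ENNReal.ofReal (B ^ (α / β) * (bernC * b) ^ (1 - α / β)) := by
  have hB : 0 ≤ B := by
    have h1 := (norm_nonneg _).trans (h 0)
    exact nonneg_of_mul_nonneg_left h1 (by positivity)
  have hb0 : 0 ≤ b := (norm_nonneg _).trans hb
  have := bernC_pos
  exact (hbNorm_le_iff (by positivity)).2 (blk_interpolation hα hαβ h hb)

/-- Interpolation: local boundedness in a higher regularity β and continuity in sup norm give
continuity in 𝒞^α. -/
theorem continuousInTime_of_blk {I : Set ℝ} {α β : ℝ} (hα : 0 < α) (hαβ : α < β)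
    {f : ℝ → C(Torus, ℝ)} (hf : ContinuousOn f I) {D : ℝ → ℝ} (hD : ContinuousOn D I)
    (h : ∀ t ∈ I, ∀ j : ℕ, ‖blk j (f t)‖ ≤ D t * 2 ^ (-(β * ((j : ℝ) - 1)))) :
    ContinuousInTime I α f := by
  intro t ht
  have h1 : Tendsto (fun s => ‖f s - f t‖) (𝓝[I] t) (𝓝 0) :=
    tendsto_iff_norm_sub_tendsto_zero.1 (hf t ht)
  have h2 := (tendsto_interpolation (B := D t + 1 + D t) (hα.trans hαβ) hαβ).comp h1
  refine tendsto_of_tendsto_of_tendsto_of_le_of_le' tendsto_const_nhds h2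
    (Eventually.of_forall fun _ => zero_le) ?_
  filter_upwards [(hD t ht).eventually (gt_mem_nhds (lt_add_one (D t))), self_mem_nhdsWithin]
    with s hs hsI
  refine hbNorm_le_interpolation hα hαβ (fun j => ?_) le_rfl
  rw [map_sub, add_mul]
  have h3 : (0 : ℝ) < 2 ^ (-(β * ((j : ℝ) - 1))) := by positivity
  refine (norm_sub_le _ _).trans (add_le_add ((h s hsI j).trans ?_) (h t ht j))
  gcongr

/-- The smooth approximants are the frequency truncations: they converge in sup norm and stay
bounded in regularity β, because blocks commute with truncation; interpolation gives convergence in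
𝒞^α. -/
theorem mem_holderBesov_of_blk {α β B : ℝ} (hα : 0 < α) (hαβ : α < β) {f : C(Torus, ℝ)}
    (h : ∀ j : ℕ, ‖blk j f‖ ≤ B * 2 ^ (-(β * ((j : ℝ) - 1)))) : toDist f ∈ HolderBesov α := by
  intro ε hε
  have h1 : Tendsto (fun J => ‖f - trunc J f‖) atTop (𝓝 0) := by
    have := ((tendsto_trunc f).const_sub f).norm
    simpa using this
  have h2 := (tendsto_interpolation (B := (1 + 4 * lipC) * B) (hα.trans hαβ) hαβ).comp h1
  obtain ⟨J, hJ⟩ := (h2.eventually (gt_mem_nhds hε)).exists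
  refine ⟨trunc J f, contDiff_trunc J f, ?_⟩
  rw [← toDist_sub]
  refine (hbNorm_le_interpolation hα hαβ (fun j => ?_) le_rfl).trans hJ.le
  have hl := one_le_lipC
  have e : blk j (trunc J f) = trunc J (blk j f) := by
    rw [blk, trunc, mulR_mulR (summable_dy j) (summable_cu J) (herm_cu J),
      mulR_mulR (summable_cu J) (summable_dy j) (herm_dy j)]
    simp only [mul_comm]
  rw [map_sub, e]
  have h3 := norm_trunc_le J (blk j f)
  calc _ ≤ ‖blk j f‖ + 4 * lipC * ‖blk j f‖ := (norm_sub_le _ _).trans (by gcongr)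
    _ = (1 + 4 * lipC) * ‖blk j f‖ := by ring
    _ ≤ (1 + 4 * lipC) * (B * 2 ^ (-(β * ((j : ℝ) - 1)))) := by gcongr; exact h j
    _ = _ := by ring

/-! ### The nonlinear source -/

theorem norm_add_le_level {T γ B E s : ℝ} (hγ : 0 ≤ γ) (hE : 0 ≤ E) (hs : s ∈ Ioc 0 T)
    {w Z : C(Torus, ℝ)} (hw : ‖w‖ ≤ B * s ^ (-γ)) (hZ : ‖Z‖ ≤ E) :
    ‖w + Z‖ ≤ (B + E * T ^ γ) * s ^ (-γ) := by
  have h1 : E ≤ E * (T ^ γ * s ^ (-γ)) := le_mul_of_one_le_right hE (one_le_rpow_mul hs hγ)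
  have := norm_add_le w Z
  linarith

theorem norm_source_le {T γ B E s : ℝ} (χ : ℝ) (hγ : 0 ≤ γ) (hE : 0 ≤ E) (hs : s ∈ Ioc 0 T)
    {w Z : C(Torus, ℝ)} (hw : ‖w‖ ≤ B * s ^ (-γ)) (hZ : ‖Z‖ ≤ E) :
    ‖χ • flux (w + Z)‖ ≤ 4 * |χ| * (B + E * T ^ γ) ^ 3 * s ^ (-(3 * γ)) := by
  have h1 := norm_add_le_level hγ hE hs hw hZ
  have h2 := rpow_neg_pow hs.1 γ 3
  push_cast at h2
  rw [norm_smul, Real.norm_eq_abs]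
  calc _ ≤ |χ| * (4 * ((B + E * T ^ γ) * s ^ (-γ)) ^ 3) := by
        gcongr
        exact (norm_flux_le _).trans (by gcongr)
    _ = _ := by rw [mul_pow, h2]; ring

theorem norm_source_sub_le {T γ B E s : ℝ} (χ : ℝ) (hγ : 0 ≤ γ) (hE : 0 ≤ E) (hs : s ∈ Ioc 0 T)
    {w w' Z Z' : C(Torus, ℝ)} (hw : ‖w‖ ≤ B * s ^ (-γ)) (hZ : ‖Z‖ ≤ E)
    (hw' : ‖w'‖ ≤ B * s ^ (-γ)) (hZ' : ‖Z'‖ ≤ E) :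
    ‖χ • flux (w + Z) - χ • flux (w' + Z')‖ ≤ 12 * |χ| * (B + E * T ^ γ) ^ 2 *
      (s ^ (-(2 * γ)) * (‖w - w'‖ + ‖Z - Z'‖)) := by
  have h1 := norm_flux_sub_le (norm_add_le_level hγ hE hs hw hZ)
    (norm_add_le_level hγ hE hs hw' hZ')
  have h2 := rpow_neg_pow hs.1 γ 2
  push_cast at h2
  have h3 : ‖w + Z - (w' + Z')‖ ≤ ‖w - w'‖ + ‖Z - Z'‖ := by
    rw [add_sub_add_comm]; exact norm_add_le _ _
  rw [← smul_sub, norm_smul, Real.norm_eq_abs]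
  calc _ ≤ |χ| * (12 * ((B + E * T ^ γ) * s ^ (-γ)) ^ 2 * (‖w - w'‖ + ‖Z - Z'‖)) := by
        gcongr
        exact h1.trans (by gcongr)
    _ = _ := by rw [mul_pow, h2]; ring

theorem continuousOn_source (χ : ℝ) {S : Set ℝ} {w Z : ℝ → C(Torus, ℝ)} (hw : ContinuousOn w S)
    (hZ : ContinuousOn Z S) : ContinuousOn (fun s => χ • flux (w s + Z s)) S :=
  (continuous_flux.comp_continuousOn (hw.add hZ)).const_smul χ

theorem IsDuhamelSol.mono {χ γ T B B' : ℝ} {ζ : PeriodicDist} {Z w : ℝ → C(Torus, ℝ)}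
    (h : IsDuhamelSol χ γ T B ζ Z w) (hB : B ≤ B') : IsDuhamelSol χ γ T B' ζ Z w :=
  ⟨h.cont, fun t ht => (h.bound t ht).trans
    (mul_le_mul_of_nonneg_right hB (Real.rpow_nonneg ht.1.le _)), h.eq⟩

theorem IsDuhamelSol.congr {χ γ T B : ℝ} {ζ : PeriodicDist} {Z w w' : ℝ → C(Torus, ℝ)}
    (h : IsDuhamelSol χ γ T B ζ Z w) (hw : EqOn w' w (Ioc 0 T)) : IsDuhamelSol χ γ T B ζ Z w' :=
  ⟨h.cont.congr hw, fun t ht => by rw [hw ht]; exact h.bound t ht, fun t ht => by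
    rw [hw ht, h.eq t ht]
    congr 1
    exact duh_congr ht.1.le fun s hs => by rw [hw ⟨hs.1, hs.2.trans ht.2⟩]⟩

/-! ### Mild solutions and the Duhamel equation -/

theorem duh_apply {F : ℝ → C(Torus, ℝ)} {t : ℝ}
    (h : IntervalIntegrable (fun s => hk (t - s) (F s)) volume 0 t) (x : Torus) :
    duh F t x = ∫ s in (0 : ℝ)..t, hk (t - s) (F s) x :=
  (ContinuousLinearMap.intervalIntegral_comp_comm (ContinuousMap.evalCLM ℝ x) h).symm

theorem heat_source_eq {χ t : ℝ} (f : ℝ → C(Torus, ℝ)) (x : ℝ) {s : ℝ} (hst : s < t) :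
    heat (t - s) (χ • distDeriv (toDist (f s))) x = hk (t - s) (χ • f s) (x : Torus) :=
  heat_distDeriv_eq (by linarith) χ (f s) x

theorem integral_heat_source {χ t : ℝ} (ht : 0 ≤ t) {f : ℝ → C(Torus, ℝ)}
    (h : IntervalIntegrable (fun s => hk (t - s) (χ • f s)) volume 0 t) (x : ℝ) :
    IntervalIntegrable (fun s => heat (t - s) (χ • distDeriv (toDist (f s))) x) volume 0 t ∧
      ∫ s in (0 : ℝ)..t, heat (t - s) (χ • distDeriv (toDist (f s))) x =
        duh (fun s => χ • f s) t (x : Torus) := by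
  have hae : ∀ᵐ s ∂(volume : Measure ℝ), s ∈ uIoc 0 t →
      hk (t - s) (χ • f s) (x : Torus) = heat (t - s) (χ • distDeriv (toDist (f s))) x := by
    rw [uIoc_of_le ht]
    exact ae_mem_Ioo_of_mem_Ioc t fun s _ hst => (heat_source_eq f x hst).symm
  let L : C(Torus, ℝ) →L[ℝ] ℝ := ContinuousMap.evalCLM ℝ (x : Torus)
  have hi : IntervalIntegrable (fun s => hk (t - s) (χ • f s) (x : Torus)) volume 0 t :=
    ⟨L.integrable_comp h.1, L.integrable_comp h.2⟩
  refine ⟨hi.congr_ae ?_, ?_⟩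
  · rwa [EventuallyEq, ae_restrict_iff' measurableSet_uIoc]
  · rw [duh_apply h]
    refine (intervalIntegral.integral_congr_ae ?_).symm
    exact hae

/-- A mild solution of the class C_{η;T} satisfies the Duhamel equation in sup norm with weight
exponent η rather than γ; 3η < 1 makes its source integrable. -/
theorem IsMildSolution.isDuhamelSol {α η T χ E : ℝ} (hα : 0 < α) (hη : 0 < η) (hη' : η < 1 / 4)
    (hE : 0 ≤ E) {ζ : PeriodicDist} {Z w : ℝ → C(Torus, ℝ)}
    (hZ : ContinuousOn Z (Ioc 0 T)) (hZE : ∀ t ∈ Ioc 0 T, ‖Z t‖ ≤ E)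
    (h : IsMildSolution α η T χ ζ Z w) : ∃ B, IsDuhamelSol χ η T B ζ Z w := by
  obtain ⟨-, hc, hn⟩ := h.mem
  have hcont := hc.continuousOn hα
  have hemb := embC_pos hα
  set N := (normCeta η T α w).toReal with hN
  have hN0 : 0 ≤ N := ENNReal.toReal_nonneg
  have hbd : ∀ t ∈ Ioc 0 T, ‖w t‖ ≤ embC α * N * (1 + T ^ η) * t ^ (-η) := fun t ht => by
    have hT : 0 < T := ht.1.trans_le ht.2
    have hmin : 0 < min (t ^ η) 1 := lt_min (Real.rpow_pos_of_pos ht.1 _) one_pos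
    have h1 : ENNReal.ofReal (min (t ^ η) 1) * hbNorm α (w t) ≤ ENNReal.ofReal N := by
      rw [hN, ENNReal.ofReal_toReal hn.ne]
      exact le_iSup₂_of_le (f := fun t (_ : t ∈ Ioc 0 T) =>
        ENNReal.ofReal (min (t ^ η) 1) * hbNorm α (w t)) t ht le_rfl
    have h2 : hbNorm α (w t) ≤ ENNReal.ofReal (N / min (t ^ η) 1) := by
      rw [ENNReal.ofReal_div_of_pos hmin, ENNReal.le_div_iff_mul_le
        (Or.inl (ENNReal.ofReal_pos.2 hmin).ne') (Or.inl ENNReal.ofReal_ne_top), mul_comm]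
      exact h1
    have h3 := norm_le_of_blk hα ((hbNorm_le_iff (by positivity)).1 h2)
    have htη : 0 < t ^ η := Real.rpow_pos_of_pos ht.1 _
    -- Past t = 1 the weight is 1 instead of t^η; the summand with T^η covers those times.
    have h4 : 1 / min (t ^ η) 1 ≤ (1 + T ^ η) * t ^ (-η) := by
      have h5 := one_le_rpow_mul ht hη.le
      have h6 : 0 < t ^ (-η) := Real.rpow_pos_of_pos ht.1 _
      have hTη : 0 < T ^ η := by positivity
      rcases min_choice (t ^ η) 1 with h7 | h7
      · rw [h7, one_div, ← Real.rpow_neg ht.1.le, add_mul, one_mul]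
        have : 0 < T ^ η * t ^ (-η) := by positivity
        linarith
      · rw [h7, div_one]
        linarith
    calc ‖w t‖ ≤ embC α * N * (1 / min (t ^ η) 1) := h3.trans (le_of_eq (by ring))
      _ ≤ embC α * N * ((1 + T ^ η) * t ^ (-η)) := by gcongr
      _ = _ := by ring
  refine ⟨_, hcont, hbd, fun t ht => ContinuousMap.ext (forall_torus.2 fun x => ?_)⟩
  have hint := intervalIntegrable_hk_of_bound (δ := 1 / 2) (by norm_num) (by norm_num)
    (by linarith : 0 ≤ 3 * η) (by linarith) ht (continuousOn_source χ hcont hZ)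
    (fun s hs => norm_source_le χ hη.le hE hs (hbd s hs) (hZE s hs))
  rw [h.eq t ht x, heat_eq ht.1, (integral_heat_source ht.1.le hint x).2, ContinuousMap.add_apply]

theorem exists_duhamel_stability {T δ γ : ℝ} (χ B E : ℝ) (hT : 0 < T) (hδ : 0 < δ) (hδ' : δ < 1)
    (hγ : 0 ≤ γ) (hpγ : (1 + δ) / 2 + 2 * γ < 1) (hE : 0 ≤ E) :
    ∃ C : ℝ, 0 < C ∧ ∀ (ζ ζ' : PeriodicDist) (Z Z' w w' : ℝ → C(Torus, ℝ)) (A e : ℝ),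
      IsDuhamelSol χ γ T B ζ Z w → IsDuhamelSol χ γ T B ζ' Z' w' → ContinuousOn Z (Ioc 0 T) →
      ContinuousOn Z' (Ioc 0 T) → (∀ t ∈ Ioc 0 T, ‖Z t‖ ≤ E) → (∀ t ∈ Ioc 0 T, ‖Z' t‖ ≤ E) →
      0 ≤ A → 0 ≤ e → (∀ t ∈ Ioc 0 T, ‖heatC t ζ - heatC t ζ'‖ ≤ A * t ^ (-γ)) →
      (∀ t ∈ Ioc 0 T, ‖Z t - Z' t‖ ≤ e) →
      ∀ t ∈ Ioc 0 T, ‖w t - w' t‖ ≤ C * (A + e) * t ^ (-γ) := by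
  obtain ⟨C, hC, h⟩ := exists_stability (L := 12 * |χ| * (B + E * T ^ γ) ^ 2) hT hδ hδ'
    (by linarith : 0 ≤ 2 * γ) hγ hpγ (by linarith) (by positivity)
  refine ⟨C, hC, ?_⟩
  intro ζ ζ' Z Z' w w' A e hw hw' hZ hZ' hZE hZE' hA he hζ hZZ
  refine h w w' (fun t => heatC t ζ) (fun t => heatC t ζ') _ _ A e (B + B)
    (4 * |χ| * (B + E * T ^ γ) ^ 3) (3 * γ) hA he (by linarith) (by linarith)
    (continuousOn_source χ hw.cont hZ) (continuousOn_source χ hw'.cont hZ')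
    (fun s hs => norm_source_le χ hγ hE hs (hw.bound s hs) (hZE s hs))
    (fun s hs => norm_source_le χ hγ hE hs (hw'.bound s hs) (hZE' s hs))
    (fun t ht => (norm_sub_le _ _).trans (by linarith [hw.bound t ht, hw'.bound t ht]))
    hw.eq hw'.eq hζ fun s hs => ?_
  refine (norm_source_sub_le χ hγ hE hs (hw.bound s hs) (hZE s hs) (hw'.bound s hs)
    (hZE' s hs)).trans ?_
  have : 0 < s ^ (-(2 * γ)) := Real.rpow_pos_of_pos hs.1 _
  gcongr
  exact hZZ s hs

theorem IsMildSolution.unique {α η T χ E : ℝ} (hα : 0 < α) (hη : 0 < η) (hη' : η < 1 / 4)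
    (hT : 0 < T) (hE : 0 ≤ E) {ζ : PeriodicDist} {Z w w' : ℝ → C(Torus, ℝ)}
    (hZ : ContinuousOn Z (Ioc 0 T)) (hZE : ∀ t ∈ Ioc 0 T, ‖Z t‖ ≤ E)
    (h : IsMildSolution α η T χ ζ Z w) (h' : IsMildSolution α η T χ ζ Z w') :
    EqOn w w' (Ioc 0 T) := by
  obtain ⟨B, hB⟩ := h.isDuhamelSol hα hη hη' hE hZ hZE
  obtain ⟨B', hB'⟩ := h'.isDuhamelSol hα hη hη' hE hZ hZE
  -- With this δ the condition (1+δ)/2 + 2η < 1 reads 3/4 + η < 1, that is η < 1/4.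
  obtain ⟨C, hC, hst⟩ := exists_duhamel_stability (δ := (1 - 4 * η) / 2) χ (max B B') E hT
    (by linarith) (by linarith) hη.le (by linarith) hE
  intro t ht
  have h1 := hst ζ ζ Z Z w w' 0 0 (hB.mono (le_max_left _ _)) (hB'.mono (le_max_right _ _)) hZ hZ
    hZE hZE le_rfl le_rfl (by simp) (by simp) t ht
  rw [add_zero, mul_zero, zero_mul] at h1
  exact sub_eq_zero.1 (norm_le_zero_iff.1 h1)

/-! ### Hölder--Besov bounds of solutions -/

theorem IsDuhamelSol.norm_blk_le {χ γ T B E R α₀ β : ℝ} (hγ : 0 ≤ γ) (hγ' : 3 * γ < 1)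
    (hα₀ : -1 ≤ α₀) (hα₀' : α₀ ≤ 0) (hβ : 0 ≤ β) (hβ' : β < 1) (hE : 0 ≤ E) (hB : 0 ≤ B)
    {ζ : PeriodicDist} {Z w : ℝ → C(Torus, ℝ)}
    (hζ : ∀ j : ℕ, ‖dblk j ζ‖ ≤ R * 2 ^ (-(α₀ * ((j : ℝ) - 1))))
    (hZ : ContinuousOn Z (Ioc 0 T)) (hZE : ∀ t ∈ Ioc 0 T, ‖Z t‖ ≤ E)
    (h : IsDuhamelSol χ γ T B ζ Z w) {t : ℝ} (ht : t ∈ Ioc 0 T) (j : ℕ) :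
    ‖blk j (w t)‖ ≤ (smC T * R * t ^ (-((β - α₀) / 2)) +
      smC T * (4 * |χ| * (B + E * T ^ γ) ^ 3) * betaC ((1 + β) / 2) (3 * γ) *
        t ^ (1 - (1 + β) / 2 - 3 * γ)) * 2 ^ (-(β * ((j : ℝ) - 1))) := by
  have hT : 0 < T := ht.1.trans_le ht.2
  have hTγ : 0 < T ^ γ := by positivity
  have h1 := norm_blk_heatC_le_of_besov ht.1 ht.2 hα₀ hα₀' hβ hβ'.le hζ j
  have h2 := norm_blk_duh_le_of_bound (δ := 1 / 2) (by norm_num) (by norm_num) hβ hβ'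
    (by linarith : 0 ≤ 3 * γ) hγ' (by positivity : 0 ≤ 4 * |χ| * (B + E * T ^ γ) ^ 3) ht
    (continuousOn_source χ h.cont hZ)
    (fun s hs => norm_source_le χ hγ hE hs (h.bound s hs) (hZE s hs)) j
  rw [h.eq t ht, map_add]
  refine (norm_add_le _ _).trans ((add_le_add h1 h2).trans (le_of_eq ?_))
  ring

/-- Both conditions on the exponents say that t^η compensates the singularity at 0. -/
theorem weighted_hbNorm_le {α η T p q a b t : ℝ} (ha : 0 ≤ a) (hb : 0 ≤ b) (hp : p ≤ η)
    (hq : -q ≤ η) (ht : t ∈ Ioc 0 T) {f : C(Torus, ℝ)}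
    (h : ∀ j : ℕ, ‖blk j f‖ ≤ (a * t ^ (-p) + b * t ^ q) * 2 ^ (-(α * ((j : ℝ) - 1)))) :
    ENNReal.ofReal (min (t ^ η) 1) * hbNorm α f ≤
      ENNReal.ofReal (a * T ^ (η - p) + b * T ^ (η + q)) := by
  have ht0 := ht.1
  have h1 := (hbNorm_le_iff (by positivity)).2 h
  calc _ ≤ ENNReal.ofReal (t ^ η) * ENNReal.ofReal (a * t ^ (-p) + b * t ^ q) := by
        gcongr
        exact min_le_left _ _
    _ = ENNReal.ofReal (t ^ η * (a * t ^ (-p) + b * t ^ q)) :=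
        (ENNReal.ofReal_mul (by positivity)).symm
    _ ≤ _ := by
        refine ENNReal.ofReal_le_ofReal ?_
        have e : t ^ η * (a * t ^ (-p) + b * t ^ q) = a * t ^ (η - p) + b * t ^ (η + q) := by
          rw [sub_eq_add_neg, Real.rpow_add ht0, Real.rpow_add ht0]; ring
        rw [e]
        have h2 : t ^ (η - p) ≤ T ^ (η - p) := Real.rpow_le_rpow ht0.le ht.2 (by linarith)
        have h3 : t ^ (η + q) ≤ T ^ (η + q) := Real.rpow_le_rpow ht0.le ht.2 (by linarith)
        gcongr

theorem IsDuhamelSol.isMildSolution {χ γ T B E R α₀ α η : ℝ} (hT : 0 < T) (hγ : 0 ≤ γ)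
    (hγ' : 3 * γ < 1) (hα₀ : -1 ≤ α₀) (hα₀' : α₀ ≤ 0) (hα : 0 < α) (hα' : α < 1)
    (hη : (α - α₀) / 2 ≤ η) (hγη : 3 * γ ≤ 1 / 2 - α / 2 + η) (hE : 0 ≤ E) (hB : 0 ≤ B)
    (hR : 0 ≤ R) {ζ : PeriodicDist} {Z w : ℝ → C(Torus, ℝ)}
    (hζ : ∀ j : ℕ, ‖dblk j ζ‖ ≤ R * 2 ^ (-(α₀ * ((j : ℝ) - 1))))
    (hZ : ContinuousOn Z (Ioc 0 T)) (hZE : ∀ t ∈ Ioc 0 T, ‖Z t‖ ≤ E)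
    (h : IsDuhamelSol χ γ T B ζ Z w) : IsMildSolution α η T χ ζ Z w := by
  have hTγ : 0 < T ^ γ := by positivity
  have hsm := smC_pos hT.le
  -- The intermediate regularity (1+α)/2 lies strictly between α and 1; it feeds the interpolation
  -- giving membership and continuity, while α itself is used for the weighted norm.
  have hblk := fun {t : ℝ} (ht : t ∈ Ioc 0 T) => h.norm_blk_le (β := (1 + α) / 2) hγ hγ' hα₀ hα₀'
    (by linarith) (by linarith) hE hB hζ hZ hZE ht
  have hblkα := fun {t : ℝ} (ht : t ∈ Ioc 0 T) => h.norm_blk_le (β := α) hγ hγ' hα₀ hα₀'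
    hα.le hα' hE hB hζ hZ hZE ht
  have hint := fun {t : ℝ} (ht : t ∈ Ioc 0 T) => integral_heat_source ht.1.le
    (intervalIntegrable_hk_of_bound (δ := 1 / 2) (by norm_num) (by norm_num)
      (by linarith : 0 ≤ 3 * γ) hγ' ht (continuousOn_source χ h.cont hZ)
      (fun s hs => norm_source_le χ hγ hE hs (h.bound s hs) (hZE s hs)))
  refine ⟨⟨fun t ht => mem_holderBesov_of_blk hα (by linarith : α < (1 + α) / 2) (hblk ht),
    continuousInTime_of_blk hα (by linarith : α < (1 + α) / 2) h.cont ?_ fun t ht => hblk ht, ?_⟩,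
    fun t ht x => (hint ht x).1, fun t ht x => ?_⟩
  · have hr : ∀ r : ℝ, ContinuousOn (fun t : ℝ => t ^ r) (Ioc 0 T) := fun r =>
      continuousOn_id.rpow_const fun s hs => Or.inl hs.1.ne'
    exact (continuousOn_const.mul (hr _)).add (continuousOn_const.mul (hr _))
  · have hbeta := betaC_pos (p := (1 + α) / 2) (q := 3 * γ) (by linarith) hγ'
    refine lt_of_le_of_lt (iSup₂_le fun t ht => weighted_hbNorm_le (by positivity) (by positivity)
      hη ?_ ht (hblkα ht)) ENNReal.ofReal_lt_top
    linarith
  · rw [(hint ht x).2, heat_eq ht.1, h.eq t ht, ContinuousMap.add_apply]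

/-- Two stages: stability in sup norm bounds the difference of the sources by (a + e) s^{-3γ}, and
blockwise smoothing of the Duhamel integral then recovers regularity α. -/
theorem exists_duhamel_lipschitz {T δ γ α₀ α η : ℝ} (χ B E : ℝ) (hT : 0 < T) (hδ : 0 < δ)
    (hδ' : δ < 1) (hγ : γ = (δ - α₀) / 2) (hpγ : (1 + δ) / 2 + 2 * γ < 1) (hα₀ : -1 ≤ α₀)
    (hα₀' : α₀ ≤ 0) (hα : 0 < α) (hα' : α < 1) (hη : (α - α₀) / 2 ≤ η)
    (hE : 0 ≤ E) :
    ∃ K : ℝ, 0 ≤ K ∧ ∀ (ζ ζ' : PeriodicDist) (Z Z' w w' : ℝ → C(Torus, ℝ)) (a e : ℝ),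
      IsDuhamelSol χ γ T B ζ Z w → IsDuhamelSol χ γ T B ζ' Z' w' → ContinuousOn Z (Ioc 0 T) →
      ContinuousOn Z' (Ioc 0 T) → (∀ t ∈ Ioc 0 T, ‖Z t‖ ≤ E) → (∀ t ∈ Ioc 0 T, ‖Z' t‖ ≤ E) →
      0 ≤ a → 0 ≤ e → (∀ j : ℕ, ‖dblk j (ζ - ζ')‖ ≤ a * 2 ^ (-(α₀ * ((j : ℝ) - 1)))) →
      (∀ t ∈ Ioc 0 T, ‖Z t - Z' t‖ ≤ e) → ∀ t ∈ Ioc 0 T,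
      ENNReal.ofReal (min (t ^ η) 1) * hbNorm α (w t - w' t) ≤ ENNReal.ofReal (K * (a + e)) := by
  have hγ0 : 0 ≤ γ := by rw [hγ]; linarith
  have hhk := hkC_pos hT.le hδ
  have hsm := smC_pos hT.le
  obtain ⟨C, hC, hst⟩ := exists_duhamel_stability χ B E hT hδ hδ' hγ0 hpγ hE
  have hTγ : 0 < T ^ γ := by positivity
  set L := 12 * |χ| * (B + E * T ^ γ) ^ 2 with hL
  have hL0 : 0 ≤ L := by positivity
  have hbeta := betaC_pos (p := (1 + α) / 2) (q := 3 * γ) (by linarith) (by linarith)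
  set k₁ := smC T * T ^ (η - (α - α₀) / 2) with hk₁
  set k₂ := smC T * (L * (C * (hkC T δ + 1) + T ^ γ)) * betaC ((1 + α) / 2) (3 * γ) *
    T ^ (η + (1 - (1 + α) / 2 - 3 * γ)) with hk₂
  have hk₁0 : 0 ≤ k₁ := by positivity
  have hk₂0 : 0 ≤ k₂ := by positivity
  refine ⟨k₁ + k₂, by positivity, ?_⟩
  intro ζ ζ' Z Z' w w' a e hw hw' hZ hZ' hZE hZE' ha he hζ hZZ t ht
  have hd := hst ζ ζ' Z Z' w w' (hkC T δ * a) e hw hw' hZ hZ' hZE hZE' (by positivity) he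
    (fun t ht => by
      rw [← heatC_sub ht.1]
      refine (norm_heatC_le ht.1 ht.2 hα₀ hα₀' hδ hδ'.le hζ).trans (le_of_eq ?_)
      rw [hγ, hkC]; ring) hZZ
  set F : ℝ → C(Torus, ℝ) := fun s => χ • flux (w s + Z s) with hF
  set F' : ℝ → C(Torus, ℝ) := fun s => χ • flux (w' s + Z' s) with hF'
  have hFc : ContinuousOn F (Ioc 0 T) := continuousOn_source χ hw.cont hZ
  have hFc' : ContinuousOn F' (Ioc 0 T) := continuousOn_source χ hw'.cont hZ'
  have hq : 0 ≤ 3 * γ := by linarith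
  have hq' : 3 * γ < 1 := by linarith
  have e1 : duh F t - duh F' t = duh (fun s => F s - F' s) t := by
    simp only [duh, map_sub]
    rw [intervalIntegral.integral_sub
      (intervalIntegrable_hk_of_bound hδ hδ' hq hq' ht hFc
        fun s hs => norm_source_le χ hγ0 hE hs (hw.bound s hs) (hZE s hs))
      (intervalIntegrable_hk_of_bound hδ hδ' hq hq' ht hFc'
        fun s hs => norm_source_le χ hγ0 hE hs (hw'.bound s hs) (hZE' s hs))]
  have hFF : ∀ s ∈ Ioc 0 T, ‖F s - F' s‖ ≤
      L * (C * (hkC T δ + 1) + T ^ γ) * (a + e) * s ^ (-(3 * γ)) := fun s hs => by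
    have h1 := norm_source_sub_le χ hγ0 hE hs (hw.bound s hs) (hZE s hs) (hw'.bound s hs) (hZE' s hs)
    have h2 : 0 < s ^ (-(2 * γ)) := Real.rpow_pos_of_pos hs.1 _
    have h3 : 0 < s ^ (-γ) := Real.rpow_pos_of_pos hs.1 _
    have h4 : s ^ (-(3 * γ)) = s ^ (-(2 * γ)) * s ^ (-γ) := by
      rw [← Real.rpow_add hs.1]; congr 1; ring
    have h5 : e ≤ e * (T ^ γ * s ^ (-γ)) := le_mul_of_one_le_right he (one_le_rpow_mul hs hγ0)
    have h6 := hd s hs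
    have h7 := hZZ s hs
    have h8 : C * (hkC T δ * a + e) + e * T ^ γ ≤ (C * (hkC T δ + 1) + T ^ γ) * (a + e) := by
      have h9 : 0 ≤ C * a + C * (hkC T δ * e) + T ^ γ * a := by positivity
      linarith
    calc _ ≤ L * (s ^ (-(2 * γ)) * (‖w s - w' s‖ + ‖Z s - Z' s‖)) := h1
      _ ≤ L * (s ^ (-(2 * γ)) * (((C * (hkC T δ + 1) + T ^ γ) * (a + e)) * s ^ (-γ))) := by
          gcongr
          calc _ ≤ (C * (hkC T δ * a + e) + e * T ^ γ) * s ^ (-γ) := by linarith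
            _ ≤ _ := by gcongr
      _ = _ := by rw [h4]; ring
  have h1 := weighted_hbNorm_le (α := α) (f := w t - w' t)
    (a := smC T * a) (p := (α - α₀) / 2) (q := 1 - (1 + α) / 2 - 3 * γ)
    (b := smC T * (L * (C * (hkC T δ + 1) + T ^ γ) * (a + e)) * betaC ((1 + α) / 2) (3 * γ))
    (by positivity) (by positivity) hη (by linarith) ht (fun j => by
      have h2 := norm_blk_heatC_le_of_besov ht.1 ht.2 hα₀ hα₀' hα.le hα'.le hζ j
      have h3 := norm_blk_duh_le_of_bound hδ hδ' hα.le hα' hq hq' (by positivity) ht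
        (hFc.sub hFc') hFF j
      have e2 : w t - w' t = heatC t (ζ - ζ') + duh (fun s => F s - F' s) t := by
        rw [hw.eq t ht, hw'.eq t ht, heatC_sub ht.1, ← e1]; abel
      rw [e2, map_add]
      refine (norm_add_le _ _).trans ((add_le_add h2 h3).trans (le_of_eq ?_))
      ring)
  refine h1.trans (ENNReal.ofReal_le_ofReal ?_)
  calc _ = k₁ * a + k₂ * (a + e) := by rw [hk₁, hk₂]; ring
    _ ≤ k₁ * (a + e) + k₂ * (a + e) := by gcongr; linarith
    _ = _ := by ring

/-! ### Data of the equation -/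

/-- The properties of a noise in `C_T 𝒞^α_0` of norm at most `R` that the equation uses. -/
structure IsNoise (T α R : ℝ) (Z : ℝ → C(Torus, ℝ)) : Prop where
  cont : ContinuousOn Z (Ioc 0 T)
  avg_eq : ∀ t ∈ Ioc 0 T, avg (Z t) = 0
  blk_le : ∀ t ∈ Ioc 0 T, ∀ j : ℕ, ‖blk j (Z t)‖ ≤ R * 2 ^ (-(α * ((j : ℝ) - 1)))

theorem IsNoise.norm_le {T α R : ℝ} (hα : 0 < α) {Z : ℝ → C(Torus, ℝ)} (h : IsNoise T α R Z) :
    ∀ t ∈ Ioc 0 T, ‖Z t‖ ≤ embC α * R := fun t ht => norm_le_of_blk hα (h.blk_le t ht)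

theorem hbNorm_le_normCT {T α t : ℝ} (f : ℝ → C(Torus, ℝ)) (ht : t ∈ Ioc 0 T) :
    hbNorm α (f t) ≤ normCT T α f :=
  le_iSup₂_of_le (f := fun t (_ : t ∈ Icc 0 T) => hbNorm α (f t)) t (Ioc_subset_Icc_self ht) le_rfl

theorem isNoise_of_mem {T α R : ℝ} (hα : 0 < α) (hR : 0 ≤ R) {Z : ℝ → C(Torus, ℝ)}
    (hZ : Z ∈ SpaceCT T α 0) (h : normCT T α Z ≤ ENNReal.ofReal R) : IsNoise T α R Z :=
  ⟨(hZ.2.continuousOn hα).mono Ioc_subset_Icc_self, fun t ht => by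
    rw [← mean_toDist_eq_avg]; exact (hZ.1 t (Ioc_subset_Icc_self ht)).2, fun _ ht =>
    (hbNorm_le_iff hR).1 ((hbNorm_le_normCT Z ht).trans h)⟩

/-- The bound B depends on the data only through R, which is what uniform Lipschitz estimates on
bounded sets require. -/
theorem exists_mildSolution {T δ α₀ α η χ R : ℝ} (hT : 0 < T) (hδ : 0 < δ) (hδ' : δ < 1 / 2)
    (hp : (1 + δ) / 2 + 2 * ((δ - α₀) / 2) < 1) (hα₀ : -1 ≤ α₀) (hα₀' : α₀ ≤ 0)
    (hα : 0 < α) (hα' : α < 1) (hη : (α - α₀) / 2 ≤ η) (hχ : 0 < χ) (hR : 0 ≤ R) :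
    ∃ B : ℝ, ∀ (ζ : PeriodicDist) (Z : ℝ → C(Torus, ℝ)), |mean ζ| ≤ 1 →
      besovNorm α₀ ζ ≤ ENNReal.ofReal R → IsNoise T α R Z →
      ∃ w, IsDuhamelSol χ ((δ - α₀) / 2) T B ζ Z w ∧ IsMildSolution α η T χ ζ Z w := by
  obtain ⟨B, hB, h⟩ := exists_duhamelSol hT hδ hδ' rfl hp hα₀ hα₀' hα hχ hR
  refine ⟨B, fun ζ Z hζ hζR hZ => ?_⟩
  have hζ' := (besovNorm_le_iff hR).1 hζR
  obtain ⟨w, hw⟩ := h ζ Z hζ hζ' hZ.cont hZ.avg_eq hZ.blk_le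
  have hemb := embC_pos hα
  exact ⟨w, hw, hw.isMildSolution hT (by linarith) (by linarith) hα₀ hα₀' hα hα' hη (by linarith)
    (by positivity : 0 ≤ embC α * R) hB hR hζ' hZ.cont (hZ.norm_le hα)⟩

theorem add_mem_spaceCetaMean {α η T χ m R : ℝ} (hα : 0 < α) (hη : 0 < η) (hη' : η < 1 / 4)
    (hR : 0 ≤ R) {ζ : PeriodicDist} (hζ : mean ζ = m)
    {Z w : ℝ → C(Torus, ℝ)} (hZ : Z ∈ SpaceCT T α 0) (hZR : normCT T α Z ≤ ENNReal.ofReal R)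
    (hw : IsMildSolution α η T χ ζ Z w) : w + Z ∈ SpaceCetaMean η T α m := by
  have hN := isNoise_of_mem hα hR hZ hZR
  have hemb := embC_pos hα
  obtain ⟨B, hB⟩ := hw.isDuhamelSol hα hη hη' (by positivity : 0 ≤ embC α * R) hN.cont
    (hN.norm_le hα)
  refine ⟨⟨fun t ht ε hε => ?_, fun t ht => ?_, ?_⟩, fun t ht => ?_⟩
  · obtain ⟨φ, hφ, h1⟩ := hw.mem.1 t ht (ε / 2) (ENNReal.half_pos hε.ne')
    obtain ⟨ψ, hψ, h2⟩ := (hZ.1 t (Ioc_subset_Icc_self ht)).1 (ε / 2) (ENNReal.half_pos hε.ne')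
    refine ⟨φ + ψ, hφ.add hψ, ?_⟩
    rw [Pi.add_apply, toDist_add, toDist_add, add_sub_add_comm]
    exact (besovNorm_add_le _ _ _).trans ((add_le_add h1 h2).trans (ENNReal.add_halves ε).le)
  · have h1 := (hw.mem.2.1 t ht).add
      ((hZ.2 t (Ioc_subset_Icc_self ht)).mono_left (nhdsWithin_mono t Ioc_subset_Icc_self))
    rw [add_zero] at h1
    refine tendsto_of_tendsto_of_tendsto_of_le_of_le tendsto_const_nhds h1 (fun _ => zero_le)
      fun s => ?_
    change hbNorm α ((w + Z) s - (w + Z) t) ≤ hbNorm α (w s - w t) + hbNorm α (Z s - Z t)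
    rw [Pi.add_apply, Pi.add_apply, add_sub_add_comm]
    exact hbNorm_add_le _ _ _
  · refine lt_of_le_of_lt (iSup₂_le (a := normCeta η T α w + normCT T α Z) fun t ht => ?_)
      (ENNReal.add_lt_top.2 ⟨hw.mem.2.2, hZR.trans_lt ENNReal.ofReal_lt_top⟩)
    refine (mul_le_mul_right (hbNorm_add_le _ _ _) _).trans ?_
    rw [mul_add]
    refine add_le_add ?_ ?_
    · exact le_iSup₂_of_le (f := fun t (_ : t ∈ Ioc 0 T) =>
        ENNReal.ofReal (min (t ^ η) 1) * hbNorm α (w t)) t ht le_rfl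
    · refine (mul_le_of_le_one_left' ?_).trans (hbNorm_le_normCT Z ht)
      rw [ENNReal.ofReal_le_one]
      exact min_le_right _ _
  · rw [Pi.add_apply, mean_toDist_eq_avg, map_add, hN.avg_eq t ht, add_zero, ← hζ]
    exact coefR_zero_of_duhamel (δ := 1 / 2) (by norm_num) (by norm_num)
      (by linarith : 0 ≤ 3 * η) (by linarith) ht (continuousOn_source χ hB.cont hN.cont)
      (fun s hs => norm_source_le χ hη.le (by positivity) hs (hB.bound s hs) (hN.norm_le hα s hs))
      (hB.eq t ht)

open Classical in
/-- The solution map `(ζ, Z) ↦ w(ζ, Z) + Z`. -/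
def solutionMap (α η T χ : ℝ) (ζ : PeriodicDist) (Z : ℝ → C(Torus, ℝ)) : ℝ → C(Torus, ℝ) :=
  if h : ∃ w, IsMildSolution α η T χ ζ Z w then h.choose + Z else 0

theorem solutionMap_eq {α η T χ : ℝ} {ζ : PeriodicDist} {Z : ℝ → C(Torus, ℝ)}
    (h : ∃ w, IsMildSolution α η T χ ζ Z w) :
    ∃ w, IsMildSolution α η T χ ζ Z w ∧ solutionMap α η T χ ζ Z = w + Z :=
  ⟨h.choose, h.choose_spec, by rw [solutionMap, dif_pos h]⟩

end Chemorepulsion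

end

/-! ### Assembly: existence, uniqueness and the Lipschitz solution map. -/

open Chemorepulsion in
theorem mainTheorem4 (α₀ α η T χ m : ℝ)
    (hα₀ : -(1 / 2) < α₀) (hα₀' : α₀ < 0) (hα : 0 < α) (hα' : α < α₀ + 1 / 2)
    (hη : (α - α₀) / 2 < η) (hη' : η < 1 / 4) (hT : 0 < T) (hχ : 0 < χ)
    (hm : m = 0 ∨ m = 1) :
    (∀ ζ ∈ HolderBesovMean α₀ m, ∀ Z ∈ SpaceCT T α 0,
      ∃ w : ℝ → C(Torus, ℝ), IsMildSolution α η T χ ζ Z w ∧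
        ∀ w' : ℝ → C(Torus, ℝ), IsMildSolution α η T χ ζ Z w' → EqOn w' w (Ioc 0 T)) ∧
    (∃ S : PeriodicDist → (ℝ → C(Torus, ℝ)) → (ℝ → C(Torus, ℝ)),
      (∀ ζ ∈ HolderBesovMean α₀ m, ∀ Z ∈ SpaceCT T α 0,
        S ζ Z ∈ SpaceCetaMean η T α m ∧
        ∀ w : ℝ → C(Torus, ℝ), IsMildSolution α η T χ ζ Z w →
          EqOn (S ζ Z) (w + Z) (Ioc 0 T)) ∧
      ∀ R : ℝ≥0, ∃ K : ℝ≥0,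
        ∀ ζ ∈ HolderBesovMean α₀ m, ∀ ζ' ∈ HolderBesovMean α₀ m,
        ∀ Z ∈ SpaceCT T α 0, ∀ Z' ∈ SpaceCT T α 0,
          besovNorm α₀ ζ + normCT T α Z < R → besovNorm α₀ ζ' + normCT T α Z' < R →
          normCeta η T α (S ζ Z - S ζ' Z') ≤
            K * (besovNorm α₀ (ζ - ζ') + normCT T α (Z - Z'))) := by
  have hη0 : 0 < η := by linarith
  have hemb := embC_pos hα
  obtain ⟨δ, hδ, hδ', hp⟩ : ∃ δ : ℝ, 0 < δ ∧ δ < 1 / 2 ∧ (1 + δ) / 2 + 2 * ((δ - α₀) / 2) < 1 :=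
    -- For this δ the sum of exponents equals 3/4 - α₀/2, which is below 1 precisely because α₀ >
    -- -1/2.
    ⟨(1 + 2 * α₀) / 6, by linarith, by linarith, by linarith⟩
  have hα1 : α < 1 := by linarith
  have hmean : ∀ ζ ∈ HolderBesovMean α₀ m, |mean ζ| ≤ 1 := fun ζ hζ => by
    rw [hζ.2]
    rcases hm with rfl | rfl <;> simp
  have hfin : ∀ ζ ∈ HolderBesovMean α₀ m, ∀ Z ∈ SpaceCT T α 0, ∃ R : ℝ, 0 ≤ R ∧
      besovNorm α₀ ζ ≤ ENNReal.ofReal R ∧ normCT T α Z ≤ ENNReal.ofReal R := fun ζ hζ Z hZ => by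
    have h1 := besovNorm_lt_top (by linarith) (by linarith) hζ.1
    have h2 := normCT_lt_top hα.le hα1.le hZ
    refine ⟨_, le_max_of_le_left ENNReal.toReal_nonneg,
      (ENNReal.ofReal_toReal h1.ne).symm.le.trans (ENNReal.ofReal_le_ofReal (le_max_left _ _)),
      (ENNReal.ofReal_toReal h2.ne).symm.le.trans (ENNReal.ofReal_le_ofReal (le_max_right _ _))⟩
  have hsol := fun {R : ℝ} (hR : 0 ≤ R) => exists_mildSolution (R := R) hT hδ hδ' hp
    (by linarith) hα₀'.le hα hα1 hη.le hχ hR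
  have hex : ∀ ζ ∈ HolderBesovMean α₀ m, ∀ Z ∈ SpaceCT T α 0,
      ∃ w, IsMildSolution α η T χ ζ Z w := fun ζ hζ Z hZ => by
    obtain ⟨R, hR, h1, h2⟩ := hfin ζ hζ Z hZ
    obtain ⟨B, hB⟩ := hsol hR
    obtain ⟨w, -, hw⟩ := hB ζ Z (hmean ζ hζ) h1 (isNoise_of_mem hα hR hZ h2)
    exact ⟨w, hw⟩
  have huniq : ∀ ζ ∈ HolderBesovMean α₀ m, ∀ Z ∈ SpaceCT T α 0, ∀ w w',
      IsMildSolution α η T χ ζ Z w → IsMildSolution α η T χ ζ Z w' → EqOn w w' (Ioc 0 T) :=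
    fun ζ hζ Z hZ w w' hw hw' => by
      obtain ⟨R, hR, -, h2⟩ := hfin ζ hζ Z hZ
      have hN := isNoise_of_mem hα hR hZ h2
      exact hw.unique hα hη0 hη' hT (by positivity : 0 ≤ embC α * R) hN.cont (hN.norm_le hα) hw'
  refine ⟨fun ζ hζ Z hZ => ?_, solutionMap α η T χ, fun ζ hζ Z hZ => ?_, fun R => ?_⟩
  · obtain ⟨w, hw⟩ := hex ζ hζ Z hZ
    exact ⟨w, hw, fun w' hw' => huniq ζ hζ Z hZ w' w hw' hw⟩
  · obtain ⟨v, hv, hS⟩ := solutionMap_eq (hex ζ hζ Z hZ)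
    obtain ⟨R, hR, -, h2⟩ := hfin ζ hζ Z hZ
    rw [hS]
    refine ⟨add_mem_spaceCetaMean hα hη0 hη' hR hζ.2 hZ h2 hv, fun w hw t ht => ?_⟩
    rw [Pi.add_apply, Pi.add_apply, huniq ζ hζ Z hZ v w hv hw ht]
  · obtain ⟨B, hB⟩ := hsol R.2
    obtain ⟨K, hK, hlip⟩ := exists_duhamel_lipschitz (E := embC α * R) χ B hT hδ (by linarith) rfl
      hp (by linarith) hα₀'.le hα hα1 hη.le (by positivity)
    -- The term K(1 + embC α) comes from the remainder, with the noise difference converted to sup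
    -- norm; the added 1 accounts for the summand Z - Z' of the solution map.
    set Q : ℝ := K * (1 + embC α) + 1 with hQ
    have hQ0 : 0 < Q := by positivity
    refine ⟨Q.toNNReal, ?_⟩
    intro ζ hζ ζ' hζ' Z hZ Z' hZ' hR hR'
    change _ ≤ ENNReal.ofReal Q * _
    by_cases htop : besovNorm α₀ (ζ - ζ') + normCT T α (Z - Z') = ⊤
    · rw [htop, ENNReal.mul_top (ENNReal.ofReal_pos.2 hQ0).ne']
      exact le_top
    obtain ⟨ht1, ht2⟩ := ENNReal.add_ne_top.1 htop
    have hRe : (R : ℝ≥0∞) = ENNReal.ofReal R := (ENNReal.ofReal_coe_nnreal).symm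
    rw [hRe] at hR hR'
    have hN := isNoise_of_mem hα R.2 hZ (le_add_self.trans hR.le)
    have hN' := isNoise_of_mem hα R.2 hZ' (le_add_self.trans hR'.le)
    obtain ⟨v, hv, hS⟩ := solutionMap_eq (hex ζ hζ Z hZ)
    obtain ⟨v', hv', hS'⟩ := solutionMap_eq (hex ζ' hζ' Z' hZ')
    -- The solution selected by the solution map carries no uniform bound; by uniqueness it may be
    -- replaced by this one, bounded in terms of R.
    obtain ⟨w, hw, hwm⟩ := hB ζ Z (hmean ζ hζ) (le_self_add.trans hR.le) hN
    obtain ⟨w', hw', hwm'⟩ := hB ζ' Z' (hmean ζ' hζ') (le_self_add.trans hR'.le) hN'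
    set a := (besovNorm α₀ (ζ - ζ')).toReal with ha
    set b := (normCT T α (Z - Z')).toReal with hb
    have ha0 : 0 ≤ a := ENNReal.toReal_nonneg
    have hb0 : 0 ≤ b := ENNReal.toReal_nonneg
    have hZZ : ∀ t ∈ Ioc 0 T, hbNorm α (Z t - Z' t) ≤ ENNReal.ofReal b := fun t ht => by
      rw [hb, ENNReal.ofReal_toReal ht2]
      exact hbNorm_le_normCT (Z - Z') ht
    have key := hlip ζ ζ' Z Z' w w' a (embC α * b) hw hw' hN.cont hN'.cont (hN.norm_le hα)
      (hN'.norm_le hα) ha0 (by positivity) (norm_dblk_le ht1)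
      fun t ht => norm_le_of_blk hα ((hbNorm_le_iff hb0).1 (hZZ t ht))
    refine iSup₂_le fun t ht => ?_
    have e : (solutionMap α η T χ ζ Z - solutionMap α η T χ ζ' Z') t =
        (w t - w' t) + (Z t - Z' t) := by
      rw [hS, hS', Pi.sub_apply, Pi.add_apply, Pi.add_apply, huniq ζ hζ Z hZ v w hv hwm ht,
        huniq ζ' hζ' Z' hZ' v' w' hv' hwm' ht]
      abel
    rw [e]
    have h1 : ENNReal.ofReal (min (t ^ η) 1) * hbNorm α (Z t - Z' t) ≤ ENNReal.ofReal b := by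
      refine (mul_le_of_le_one_left' ?_).trans (hZZ t ht)
      rw [ENNReal.ofReal_le_one]
      exact min_le_right _ _
    calc _ ≤ ENNReal.ofReal (min (t ^ η) 1) * (hbNorm α (w t - w' t) + hbNorm α (Z t - Z' t)) := by
          gcongr
          exact hbNorm_add_le _ _ _
      _ ≤ ENNReal.ofReal (K * (a + embC α * b)) + ENNReal.ofReal b := by
          rw [mul_add]
          exact add_le_add (key t ht) h1
      _ = ENNReal.ofReal (K * (a + embC α * b) + b) :=
          (ENNReal.ofReal_add (by positivity) hb0).symm
      _ ≤ ENNReal.ofReal (Q * (a + b)) := by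
          refine ENNReal.ofReal_le_ofReal ?_
          have h2 : 0 ≤ K * b + K * (embC α * a) + a := by positivity
          rw [hQ]
          linarith
      _ = _ := by
          rw [ENNReal.ofReal_mul hQ0.le, ENNReal.ofReal_add ha0 hb0, ha, hb,
            ENNReal.ofReal_toReal ht1, ENNReal.ofReal_toReal ht2]
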